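/- Let $M=(m_{ij})$ be an $N\times N$ row-stochastic matrix, let $|\mathrm{init}\rangle$ be a probability vector on $\{1,\dots,N\}$, let $\phi^{(1)},\dots,\phi^{(N)}$ be probability laws on $(0,\infty)$ (waiting times) and $\lambda^{(1)},\dots,\lambda^{(N)}$ probability laws on $\mathbb R$ (jump lengths). Consider the continuous time random walk that starts at $x=0$ in an internal state drawn from $|\mathrm{init}\rangle$; in state $i$ it waits a time drawn from $\phi^{(i)}$, then makes a jump drawn from $\lambda^{(i)}$, and moves to the internal state $j$ with probability $m_{ij}$; given the Markov chain of internal states, all waiting times and jumps are independent. Let $g^{(i)}(\cdot,t)$ be the (sub-probability) law of the position at time $t$ on the event that the internal state at time $t$ is $i$, and let $$\widehat g^{(i)}(k,s)=\int_0^\infty e^{-st}\int_{\mathbb R}e^{ikx}\,g^{(i)}(dx,t)\,dt ,\qquad |G(k,s)\rangle=(\widehat g^{(1)}(k,s),\dots,\widehat g^{(N)}(k,s))^T .$$ Write $\Phi(s)=\mathrm{diag}(\int e^{-s\tau}\phi^{(i)}(d\tau))$ and $\Lambda(k)=\mathrm{diag}(\int e^{ikx}\lambda^{(i)}(dx))$.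 (1) For all $k\in\mathbb R$ and all $s\in\mathbb C$ with $\operatorname{Re}s>0$, the integrals defining $|G(k,s)\rangle$ converge, $I-M^T\Phi(s)\Lambda(k)$ is invertible, and $$|G(k,s)\rangle=\frac1s\,[I-\Phi(s)]\,[I-M^T\Phi(s)\Lambda(k)]^{-1}|\mathrm{init}\rangle .$$ Now let $0<\alpha_i<1$, $B_i>0$, $\sigma>0$ and $\Psi(s)=\mathrm{diag}(B_1s^{\alpha_1},\dots,B_Ns^{\alpha_N})$. Suppose that the waiting times are asymptotically power laws, $1-\int e^{-s\tau}\phi^{(i)}(d\tau)\sim B_is^{\alpha_i}$ as $s\downarrow0$ for every $i$, and that every $\lambda^{(i)}$ is the centred Gaussian law of variance $2\sigma^2$ (so that its Fourier transform is $1-\sigma^2k^2$ to leading order). (2) For all sufficiently small $s>0$ and $|k|$ the two inverses below exist, and as $(s,k)\to(0,0)$ with $s>0$ and $k$ real, $|G(k,s)\rangle$ is asymptotically equivalent, component by component, both to $$\frac1s\Psi(s)\,[I-M^T(I-\Psi(s))(1-\sigma^2k^2)]^{-1}|\mathrm{init}\rangle$$ and to its leading-order form $$|G_0(k,s)\rangle=\frac1s\Psi(s)\,[I-M^T(I-\Psi(s)-\sigma^2k^2I)]^{-1}|\mathrm{init}\rangle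 .$$ (Equivalence $u\sim v$ means $u-v=o(v)$; in particular $u=0$ near the limit wherever $v=0$ there.) (3) $|G_0\rangle$ is the Fourier–Laplace form of the multi-state fractional Fokker–Planck equation, in the following sense. Let $s_0\ge0$ and let $|H(x,t)\rangle=(H_1,\dots,H_N)^T$, $t>0$, be any vector of measurable families $H_i(\cdot,t)$ of finite signed measures on $\mathbb R$ with $\int_0^\infty e^{-s_0t}\|H_i(\cdot,t)\|_{TV}\,dt<\infty$. Then $|H\rangle$, extended by $0$ to $t\le 0$, solves, in the sense of distributions on $\mathbb R_x\times\mathbb R_t$, $$M^T\partial_t|H\rangle=(M^T-I)\,\mathrm{diag}(B_1^{-1},\dots,B_N^{-1})\,D_t^{\mathrm{diag}(1-\alpha_1,\dots,1-\alpha_N)}|H\rangle+M^T\mathrm{diag}(K_1,\dots,K_N)\,D_t^{\mathrm{diag}(1-\alpha_1,\dots,1-\alpha_N)}\,\partial_x^2|H\rangle+\delta(x)\delta(t)|\mathrm{init}\rangle,\qquad K_i=\sigma^2/B_i,$$ if and only if its Fourier–Laplace transform $|H(k,s)\rangle$ equals $|G_0(k,s)\rangle$ for all real $k$ and all complex $s$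 with $\operatorname{Re}s>s_0$ at which $I-M^T(I-\Psi(s)-\sigma^2k^2I)$ is invertible. Here $D_t^{\mathrm{diag}(1-\alpha_1,\dots,1-\alpha_N)}=\mathrm{diag}(D_t^{1-\alpha_1},\dots,D_t^{1-\alpha_N})$ with the Riemann–Liouville derivatives $$D_t^{1-\alpha}f(t)=\frac1{\Gamma(\alpha)}\frac{d}{dt}\int_0^t(t-\tau)^{\alpha-1}f(\tau)\,d\tau ,$$ the time derivative being taken in the sense of distributions. -/

import Mathlib

open MeasureTheory ProbabilityTheory Filter Topology Set

noncomputable section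

namespace MultiStateCTRW

/-! ## The continuous time random walk with internal states -/

/-- The data of a walk with `N` internal states: the sequence of internal states, the waiting times
and the jump lengths, with their joint law. The chain of states starts from `p₀` and moves with the
transition probabilities `M i j` (from `i` to `j`); given the states, the waiting time and the jump
length of step `m` are independent, drawn from `φ i` and `lam i` when step `m` is in state `i`. -/
structure IsCTRW {N : ℕ} {Ω : Type*} [MeasurableSpace Ω] (P : Measure Ω)
    (M : Matrix (Fin N) (Fin N) ℝ) (p₀ : Fin N → ℝ) (φ lam : Fin N → Measure ℝ)
    (state : ℕ → Ω → Fin N) (wait jump : ℕ → Ω → ℝ) : Prop where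
  measurableSet_state : ∀ n i, MeasurableSet {ω | state n ω = i}
  measurable_wait : ∀ n, Measurable (wait n)
  measurable_jump : ∀ n, Measurable (jump n)
  law : ∀ (n : ℕ) (i : ℕ → Fin N) (A B : ℕ → Set ℝ),
    (∀ m, MeasurableSet (A m)) → (∀ m, MeasurableSet (B m)) →
    P {ω | ∀ m ≤ n, state m ω = i m ∧ wait m ω ∈ A m ∧ jump m ω ∈ B m} =
      ENNReal.ofReal (p₀ (i 0) * ∏ m ∈ Finset.range n, M (i m) (i (m + 1))) *
        ∏ m ∈ Finset.range (n + 1), φ (i m) (A m) * lam (i m) (B m)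

section Walk

variable {N : ℕ} {Ω : Type*}

/-- The time of the `n`-th renewal. -/
def renewalTime (wait : ℕ → Ω → ℝ) (n : ℕ) (ω : Ω) : ℝ := ∑ m ∈ Finset.range n, wait m ω

/-- The number of renewals up to time `t`. -/
def renewalCount (wait : ℕ → Ω → ℝ) (t : ℝ) (ω : Ω) : ℕ := sSup {n | renewalTime wait n ω ≤ t}

/-- The position of the particle at time `t`; the particle starts at the origin. -/
def position (wait jump : ℕ → Ω → ℝ) (t : ℝ) (ω : Ω) : ℝ :=
  ∑ m ∈ Finset.range (renewalCount wait t ω), jump m ω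

/-- The internal state of the particle at time `t`. -/
def internalState (state : ℕ → Ω → Fin N) (wait : ℕ → Ω → ℝ) (t : ℝ) (ω : Ω) : Fin N :=
  state (renewalCount wait t ω) ω

/-- The state-resolved distribution of the position: the measure
`B ↦ P (position at time t in B, internal state i at time t)`. It has an atom at the origin (no
renewal up to time `t`), so it is a measure and not a function. -/
def stateLaw [MeasurableSpace Ω] (P : Measure Ω) (state : ℕ → Ω → Fin N)
    (wait jump : ℕ → Ω → ℝ) (i : Fin N) (t : ℝ) : Measure ℝ :=
  (P.restrict {ω | internalState state wait t ω = i}).map (position wait jump t)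

end Walk

/-! ## Transforms -/

/-- The Laplace transform of a measure on the time axis, at a complex argument. -/
def laplace (φ : Measure ℝ) (s : ℂ) : ℂ := ∫ τ, Complex.exp (-s * τ) ∂φ

/-- The Laplace transform in `t > 0` of a function of time. -/
def laplaceFun (f : ℝ → ℂ) (s : ℂ) : ℂ := ∫ t in Ioi (0 : ℝ), Complex.exp (-s * t) * f t

/-- The Fourier-Laplace transform of a family of measures indexed by time. -/
def fourierLaplace (G : ℝ → Measure ℝ) (k : ℝ) (s : ℂ) : ℂ :=
  laplaceFun (fun t => charFun (G t) k) s

/-- The integral of a real function against a signed measure. -/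
def signedIntegral (μ : SignedMeasure ℝ) (f : ℝ → ℝ) : ℝ :=
  ∫ x, f x ∂μ.toJordanDecomposition.posPart - ∫ x, f x ∂μ.toJordanDecomposition.negPart

/-- The Fourier transform of a signed measure. -/
def signedCharFun (μ : SignedMeasure ℝ) (k : ℝ) : ℂ :=
  charFun μ.toJordanDecomposition.posPart k - charFun μ.toJordanDecomposition.negPart k

/-- The Fourier-Laplace transform of a family of signed measures indexed by time. -/
def signedFourierLaplace (H : ℝ → SignedMeasure ℝ) (k : ℝ) (s : ℂ) : ℂ :=
  laplaceFun (fun t => signedCharFun (H t) k) s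

/-- A measurable family of signed measures whose total variation has a convergent Laplace integral
at `s₀`. Its Fourier-Laplace transform converges for `s₀ ≤ re s` and all real `k`. -/
def IsLaplaceFamily (s₀ : ℝ) (H : ℝ → SignedMeasure ℝ) : Prop :=
  (∀ B, MeasurableSet B → Measurable fun t => H t B) ∧
    IntegrableOn (fun t => Real.exp (-s₀ * t) * (H t).totalVariation.real univ) (Ioi 0)

/-! ## The Fourier-Laplace densities -/

section Densities

open Matrix

variable {N : ℕ}

/-- The transition matrix with complex entries. -/
def complexMatrix (M : Matrix (Fin N) (Fin N) ℝ) : Matrix (Fin N) (Fin N) ℂ :=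
  M.map fun x => (x : ℂ)

/-- The matrix `I - Mᵀ Φ Λ`. -/
def walkMatrix (M : Matrix (Fin N) (Fin N) ℝ) (Φ Λ : Fin N → ℂ) : Matrix (Fin N) (Fin N) ℂ :=
  1 - (complexMatrix M)ᵀ * diagonal Φ * diagonal Λ

/-- The vector `s⁻¹ (I - Φ) (I - Mᵀ Φ Λ)⁻¹ p₀`. -/
def walkDensity (M : Matrix (Fin N) (Fin N) ℝ) (p₀ : Fin N → ℝ) (Φ Λ : Fin N → ℂ) (s : ℂ) :
    Fin N → ℂ :=
  s⁻¹ • (((1 - diagonal Φ) * (walkMatrix M Φ Λ)⁻¹) *ᵥ fun i => (p₀ i : ℂ))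

/-- The diagonal entries `B i * s ^ α i` of the matrix `Ψ(s)`. -/
def powerLaw (α B : Fin N → ℝ) (s : ℂ) (i : Fin N) : ℂ := (B i : ℂ) * s ^ (α i : ℂ)

/-- The matrix `I - Mᵀ (I - Ψ(s) - σ² k² I)`: in `I - Mᵀ Φ(s) Λ(k)` the product
`(I - Ψ(s)) (1 - σ² k²)` is kept to leading order. -/
def leadingMatrix (M : Matrix (Fin N) (Fin N) ℝ) (α B : Fin N → ℝ) (σ k : ℝ) (s : ℂ) :
    Matrix (Fin N) (Fin N) ℂ :=
  1 - (complexMatrix M)ᵀ * (1 - diagonal (powerLaw α B s) - ((σ ^ 2 * k ^ 2 : ℝ) : ℂ) • 1)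

/-- The vector `s⁻¹ Ψ(s) [I - Mᵀ (I - Ψ(s) - σ² k² I)]⁻¹ p₀`. -/
def leadingDensity (M : Matrix (Fin N) (Fin N) ℝ) (p₀ : Fin N → ℝ) (α B : Fin N → ℝ) (σ k : ℝ)
    (s : ℂ) : Fin N → ℂ :=
  s⁻¹ • ((diagonal (powerLaw α B s) * (leadingMatrix M α B σ k s)⁻¹) *ᵥ fun i => (p₀ i : ℂ))

end Densities

/-! ## The fractional Fokker-Planck equation -/

/-- The Riemann-Liouville integral of order `β > 0` with base point `0`. -/
def rlIntegral (β : ℝ) (f : ℝ → ℝ) (t : ℝ) : ℝ :=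
  (Real.Gamma β)⁻¹ * ∫ τ in (0 : ℝ)..t, (t - τ) ^ (β - 1) * f τ

/-- The distributional time derivative, paired with a test function `θ` on the whole time axis, of
the function that equals `f` for `t > 0` and `0` for `t ≤ 0`. -/
def timeDeriv (f : ℝ → ℝ) (θ : ℝ → ℝ) : ℝ := -∫ t in Ioi (0 : ℝ), f t * deriv θ t

/-- The Riemann-Liouville derivative of order `γ ∈ (0, 1)`: the time derivative of the
Riemann-Liouville integral of order `1 - γ`, in the sense of distributions. -/
def rlDeriv (γ : ℝ) (f : ℝ → ℝ) (θ : ℝ → ℝ) : ℝ := timeDeriv (rlIntegral (1 - γ) f) θ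

/-- A smooth compactly supported function on the real line. -/
def IsTestFunction (θ : ℝ → ℝ) : Prop := ContDiff ℝ (⊤ : ℕ∞) θ ∧ HasCompactSupport θ

/-- The family `H` solves, in the sense of distributions in `x ∈ ℝ` and `t ∈ ℝ` (with `H` extended
by `0` to negative times) the system
`Mᵀ ∂ₜ H = (Mᵀ - I) diag(1/B) D^{1-α} H + Mᵀ diag(σ²/B) D^{1-α} ∂ₓ² H + δ(x) δ(t) p₀`.
It is tested against products `ψ(x) θ(t)`; the second derivative in `x` is moved to `ψ`. -/
def SolvesFokkerPlanck {N : ℕ} (M : Matrix (Fin N) (Fin N) ℝ) (p₀ α B : Fin N → ℝ) (σ : ℝ)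
    (H : Fin N → ℝ → SignedMeasure ℝ) : Prop :=
  ∀ ψ θ : ℝ → ℝ, IsTestFunction ψ → IsTestFunction θ → ∀ i,
    ∑ j, M j i * timeDeriv (fun t => signedIntegral (H j t) ψ) θ =
      ∑ j, (M j i - (1 : Matrix (Fin N) (Fin N) ℝ) j i) * (B j)⁻¹ *
          rlDeriv (1 - α j) (fun t => signedIntegral (H j t) ψ) θ +
        ∑ j, M j i * (σ ^ 2 / B j) *
          rlDeriv (1 - α j) (fun t => signedIntegral (H j t) (iteratedDeriv 2 ψ)) θ +
        p₀ i * (ψ 0 * θ 0)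

end MultiStateCTRW

end

/-!
The three parts of the theorem reduce to one linear system, `x = p₀ + Mᵀ (d x)` with `d` a vector of
factors in the unit disc (written componentwise, `x i = p₀ i + ∑ j, M j i * (d j * x j)`). Since `M`
is stochastic, `x ↦ Mᵀ (d x)` strictly decreases the total mass when all `‖d j‖ < 1`, whence
uniqueness, invertibility of `I - Mᵀ diag(d)`, and a maximum principle (`eq_zero_of_subinvariant`,
`nonneg_of_superharmonic`).

*The Montroll-Weiss formula.* Almost surely the renewal times tend to infinity, because
`E exp(-Tₙ)` decays geometrically. The time axis is therefore cut into the intervals between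
renewals, and the transform of the walk is a series over the number `n` of renewals. Its `n`-th term
is computed by summing the path law over all paths of internal states (`IsCTRW.integral_state`) and
is the `n`-th iterate of `Mᵀ Φ Λ` on `p₀`, times `(1 - Φᵢ) / s`. Shifting the series by one step
shows that its sum solves the linear system with `d = Φ Λ`; see `IsCTRW.fourierLaplace_eq`.

*The asymptotics.* For real `s` the three densities have the form `s⁻¹ Ψᵢ xᵢ`, up to equivalence of
the factor `Ψᵢ`, where `x` solves the system with killing rates `1 - d` equal to `1 - Φᵢ Λ`, to
`1 - (1 - Ψᵢ) (1 - σ² k²)` and to `Ψᵢ + σ² k²`. These rates are equivalent to each other as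
`(s, k) → (0, 0)`, however `s` and `k` are related. The point is that `x` is stable in the
*relative* sense, in every component and without irreducibility (`solution_isEquivalent`). Indeed,
if the rates change by a fraction `η`, then `x` changes by at most a constant times
`η ∑ⱼ (1 - dⱼ) xⱼ rⱼ`, where `rⱼ` is the solution with source in `j`; and `(1 - dⱼ) xⱼ rⱼ ≤ x` by
the maximum principle, because the mass killed at `j` is at most the mass of the source
(`mul_column_le`).

*The fractional Fokker-Planck equation.* After pairing with a test function in `x` the equation says
that the time derivative of a function built from Riemann-Liouville integrals is a multiple of `δ`,
that is, this function is constant in `t > 0`. By uniqueness of Laplace transforms this is an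
identity for all `s`, in which a Riemann-Liouville integral of order `α` has become the factor
`s ^ (-α)` (`solvesFokkerPlanck_iff_spatialEquation`). Test functions in `x` can be exchanged for
the characters `exp(i k x)`: a character is a bounded limit of test functions, and a test function
is a superposition of characters by Fourier inversion (`forall_spatialEquation_iff_wave`). For a
character the identity is the linear system that defines `leadingDensity`. Where its matrix is
singular the density is not defined; but the determinant is analytic in `(k, s)` and does not vanish
near the origin, so invertible points are dense and the system extends to all `(k, s)` by
continuity (`solvesFokkerPlanck_iff`).
-/

/-! ### Sub-stochastic systems -/

namespace MultiStateCTRW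

section Substochastic

variable {ι : Type*} [Fintype ι] {M : Matrix ι ι ℝ}

theorem sum_sum_weighted_row (h1 : ∀ i, ∑ j, M i j = 1) (f : ι → ℝ) :
    ∑ i, ∑ j, M j i * f j = ∑ j, f j := by
  rw [Finset.sum_comm]
  exact Finset.sum_congr rfl fun j _ => by rw [← Finset.sum_mul, h1, one_mul]

/-- The operator `w ↦ Mᵀ diag(d) w` strictly decreases the total mass, so it has no nonzero
nonnegative subinvariant vector. -/
theorem eq_zero_of_subinvariant (h1 : ∀ i, ∑ j, M i j = 1) {d w : ι → ℝ}
    (hd1 : ∀ i, d i < 1) (hw : ∀ i, 0 ≤ w i)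
    (h : ∀ i, w i ≤ ∑ j, M j i * (d j * w j)) (i : ι) : w i = 0 := by
  have hs : ∑ i, w i ≤ ∑ j, d j * w j :=
    (Finset.sum_le_sum fun i _ => h i).trans_eq (sum_sum_weighted_row h1 _)
  have hz : ∑ j, (1 - d j) * w j = 0 := by
    refine le_antisymm ?_ (Finset.sum_nonneg fun j _ =>
      mul_nonneg (sub_nonneg.2 (hd1 j).le) (hw j))
    simp only [sub_mul, one_mul, Finset.sum_sub_distrib]
    linarith
  have := (Finset.sum_eq_zero_iff_of_nonneg fun j _ =>
    mul_nonneg (sub_nonneg.2 (hd1 j).le) (hw j)).1 hz i (Finset.mem_univ i)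
  exact (mul_eq_zero.1 this).resolve_left (sub_pos.2 (hd1 i)).ne'

/-- The maximum principle: a vector that is superharmonic wherever it is negative is
nonnegative. -/
theorem nonneg_of_superharmonic (h0 : ∀ i j, 0 ≤ M i j) (h1 : ∀ i, ∑ j, M i j = 1)
    {d u : ι → ℝ} (hd0 : ∀ i, 0 ≤ d i) (hd1 : ∀ i, d i < 1)
    (h : ∀ i, 0 ≤ u i ∨ ∑ j, M j i * (d j * u j) ≤ u i) (i : ι) : 0 ≤ u i := by
  have hw : ∀ i, max (-u i) 0 = 0 := by
    refine eq_zero_of_subinvariant h1 hd1 (fun i => le_max_right _ _) fun i => ?_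
    have hnn : 0 ≤ ∑ j, M j i * (d j * max (-u j) 0) := Finset.sum_nonneg fun j _ =>
      mul_nonneg (h0 j i) (mul_nonneg (hd0 j) (le_max_right _ _))
    refine max_le ?_ hnn
    rcases h i with hi | hi
    · linarith
    · refine (neg_le_neg hi).trans ?_
      rw [← Finset.sum_neg_distrib]
      refine Finset.sum_le_sum fun j _ => ?_
      rw [← mul_neg, ← mul_neg]
      exact mul_le_mul_of_nonneg_left (mul_le_mul_of_nonneg_left (le_max_left _ _) (hd0 j))
        (h0 j i)
  have := hw i
  rw [max_eq_right_iff] at this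
  linarith

variable {d d' p x x' : ι → ℝ}

theorem nonneg_of_eq_add_sum (h0 : ∀ i j, 0 ≤ M i j) (h1 : ∀ i, ∑ j, M i j = 1)
    (hd0 : ∀ i, 0 ≤ d i) (hd1 : ∀ i, d i < 1) (hp : ∀ i, 0 ≤ p i)
    (hx : ∀ i, x i = p i + ∑ j, M j i * (d j * x j)) (i : ι) : 0 ≤ x i :=
  nonneg_of_superharmonic h0 h1 hd0 hd1 (fun i => Or.inr (by linarith [hx i, hp i])) i

theorem le_of_eq_add_sum (h0 : ∀ i j, 0 ≤ M i j) (h1 : ∀ i, ∑ j, M i j = 1)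
    (hd0 : ∀ i, 0 ≤ d i) (hd1' : ∀ i, d' i < 1) (hdd : ∀ i, d i ≤ d' i)
    (hp : ∀ i, 0 ≤ p i)
    (hx : ∀ i, x i = p i + ∑ j, M j i * (d j * x j))
    (hx' : ∀ i, x' i = p i + ∑ j, M j i * (d' j * x' j)) (i : ι) : x i ≤ x' i := by
  have hxn := nonneg_of_eq_add_sum h0 h1 hd0 (fun i => (hdd i).trans_lt (hd1' i)) hp hx
  have := nonneg_of_superharmonic h0 h1 (d := d') (u := fun i => x' i - x i)
    (fun i => (hd0 i).trans (hdd i)) hd1' (fun i => Or.inr ?_) i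
  · linarith
  · have : ∑ j, M j i * (d j * x j) ≤ ∑ j, M j i * (d' j * x j) :=
      Finset.sum_le_sum fun j _ => mul_le_mul_of_nonneg_left
        (mul_le_mul_of_nonneg_right (hdd j) (hxn j)) (h0 j i)
    simp only [mul_sub, Finset.sum_sub_distrib]
    linarith [hx i, hx' i]

variable [DecidableEq ι]

/-- If `r` solves the system with source at `j`, then `(1 - d j) * x j` is the rate at which the
solution `x` loses mass in `j`, and the mass reaching `i` through `j` is at most `x i`. -/
theorem mul_column_le (h0 : ∀ i j, 0 ≤ M i j) (h1 : ∀ i, ∑ j, M i j = 1)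
    (hd0 : ∀ i, 0 ≤ d i) (hd1 : ∀ i, d i < 1) (hp : ∀ i, 0 ≤ p i)
    (hx : ∀ i, x i = p i + ∑ j, M j i * (d j * x j)) {j : ι} {r : ι → ℝ}
    (hr : ∀ i, r i = (if i = j then 1 else 0) + ∑ l, M l i * (d l * r l)) (i : ι) :
    (1 - d j) * x j * r i ≤ x i := by
  have hrn : ∀ i, 0 ≤ r i :=
    nonneg_of_eq_add_sum h0 h1 hd0 hd1 (fun i => by split_ifs <;> norm_num) hr
  have hxn := nonneg_of_eq_add_sum h0 h1 hd0 hd1 hp hx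
  have hrj : 1 ≤ r j := by
    have : 0 ≤ ∑ l, M l j * (d l * r l) := Finset.sum_nonneg fun l _ =>
      mul_nonneg (h0 l j) (mul_nonneg (hd0 l) (hrn l))
    have h := hr j
    rw [if_pos rfl] at h
    linarith
  -- Summing the system gives conservation of mass, `∑ (1 - d l) * r l = 1`.
  have hkill : (1 - d j) * r j ≤ 1 := by
    have hs : ∑ i, r i = 1 + ∑ l, d l * r l := by
      rw [← sum_sum_weighted_row h1 fun l => d l * r l]
      conv_lhs => rw [Finset.sum_congr rfl fun i _ => hr i]
      rw [Finset.sum_add_distrib]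
      simp
    have : ∑ l, (1 - d l) * r l = 1 := by
      simp only [sub_mul, one_mul, Finset.sum_sub_distrib]
      linarith
    refine le_of_le_of_eq ?_ this
    exact Finset.single_le_sum (f := fun l => (1 - d l) * r l)
      (fun l _ => mul_nonneg (sub_nonneg.2 (hd1 l).le) (hrn l)) (Finset.mem_univ j)
  have hrj0 : 0 < r j := by linarith
  -- The multiple of `r` that agrees with `x` at `j` lies below `x`.
  have hcmp : 0 ≤ x i - x j / r j * r i := by
    refine nonneg_of_superharmonic h0 h1 (u := fun i => x i - x j / r j * r i) hd0 hd1
      (fun i => ?_) i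
    by_cases hij : i = j
    · subst hij
      left
      rw [div_mul_cancel₀ _ hrj0.ne', sub_self]
    · right
      have h := hr i
      rw [if_neg hij, zero_add] at h
      have hlin : ∑ l, M l i * (d l * (x l - x j / r j * r l)) =
          ∑ l, M l i * (d l * x l) - x j / r j * ∑ l, M l i * (d l * r l) := by
        rw [Finset.mul_sum, ← Finset.sum_sub_distrib]
        exact Finset.sum_congr rfl fun l _ => by ring
      rw [hlin, ← h]
      linarith [hx i, hp i]
  have hle : (1 - d j) * x j ≤ x j / r j := by
    rw [le_div_iff₀ hrj0]
    nlinarith [hxn j]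
  linarith [mul_le_mul_of_nonneg_right hle (hrn i)]

/-- Relative stability: a small relative change of the killing rates `1 - d i` changes the solution
by a small relative amount, uniformly as the killing rates tend to zero. -/
theorem sub_le_of_killing_close (h0 : ∀ i j, 0 ≤ M i j) (h1 : ∀ i, ∑ j, M i j = 1)
    (hd0 : ∀ i, 0 ≤ d i) (hd1' : ∀ i, d' i < 1) (hd2' : ∀ i, 1 / 2 ≤ d' i)
    (hdd : ∀ i, d i ≤ d' i) {η : ℝ} (hη : 0 ≤ η) (hclose : ∀ i, d' i - d i ≤ η * (1 - d' i))
    (hp : ∀ i, 0 ≤ p i)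
    (hx : ∀ i, x i = p i + ∑ j, M j i * (d j * x j))
    (hx' : ∀ i, x' i = p i + ∑ j, M j i * (d' j * x' j))
    {r : ι → ι → ℝ}
    (hr : ∀ j i, r j i = (if i = j then 1 else 0) + ∑ l, M l i * (d' l * r j l)) (i : ι) :
    x' i - x i ≤ 2 * η * Fintype.card ι * x' i := by
  have hd0' : ∀ i, 0 ≤ d' i := fun i => (hd0 i).trans (hdd i)
  have hxx := le_of_eq_add_sum h0 h1 hd0 hd1' hdd hp hx hx'
  have hxn := nonneg_of_eq_add_sum h0 h1 hd0 (fun i => (hdd i).trans_lt (hd1' i)) hp hx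
  have hxn' : ∀ i, 0 ≤ x' i := fun i => (hxn i).trans (hxx i)
  -- The columns `r j` without their source dominate the difference of the two solutions.
  set c : ι → ℝ := fun j => 2 * η * ((1 - d' j) * x' j)
  have hc : ∀ j, 0 ≤ c j := fun j => mul_nonneg (by linarith)
    (mul_nonneg (sub_nonneg.2 (hd1' j).le) (hxn' j))
  have key : 0 ≤ ∑ j, c j * (r j i - if i = j then 1 else 0) - (x' i - x i) := by
    refine nonneg_of_superharmonic h0 h1
      (u := fun i => ∑ j, c j * (r j i - if i = j then 1 else 0) - (x' i - x i)) hd0' hd1'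
      (fun i => Or.inr ?_) i
    have e1 : ∀ j, r j i - (if i = j then 1 else 0) = ∑ l, M l i * (d' l * r j l) :=
      fun j => by linarith [hr j i]
    have e2 : x' i - x i = ∑ l, M l i * (d' l * x' l - d l * x l) := by
      simp only [mul_sub, Finset.sum_sub_distrib]
      linarith [hx i, hx' i]
    simp only [e1, e2]
    have e3 : ∑ j, c j * ∑ l, M l i * (d' l * r j l) =
        ∑ l, M l i * (d' l * ∑ j, c j * r j l) := by
      simp only [Finset.mul_sum]
      rw [Finset.sum_comm]
      exact Finset.sum_congr rfl fun l _ => Finset.sum_congr rfl fun j _ => by ring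
    rw [e3, ← Finset.sum_sub_distrib]
    refine Finset.sum_le_sum fun l _ => ?_
    rw [← mul_sub]
    refine mul_le_mul_of_nonneg_left ?_ (h0 l i)
    have e4 : ∑ j, c j * (r j l - if l = j then 1 else 0) = ∑ j, c j * r j l - c l := by
      simp [mul_sub, Finset.sum_sub_distrib]
    simp only [e4]
    have h5 : (d' l - d l) * x l ≤ d' l * c l := by
      have a : (d' l - d l) * x l ≤ η * (1 - d' l) * x' l :=
        mul_le_mul (hclose l) (hxx l) (hxn l)
          (mul_nonneg hη (sub_nonneg.2 (hd1' l).le))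
      have b : 1 / 2 * c l ≤ d' l * c l := mul_le_mul_of_nonneg_right (hd2' l) (hc l)
      have e : 1 / 2 * c l = η * (1 - d' l) * x' l := by simp only [c]; ring
      linarith
    nlinarith [h5]
  have hb : ∑ j, c j * (r j i - if i = j then 1 else 0) ≤ ∑ _j : ι, 2 * η * x' i := by
    refine Finset.sum_le_sum fun j _ => ?_
    have a := mul_column_le h0 h1 hd0' hd1' hp hx' (hr j) i
    have b : c j * (r j i - if i = j then 1 else 0) ≤ c j * r j i :=
      mul_le_mul_of_nonneg_left (by split_ifs <;> linarith) (hc j)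
    refine b.trans ?_
    calc c j * r j i = 2 * η * ((1 - d' j) * x' j * r j i) := by simp only [c]; ring
      _ ≤ _ := mul_le_mul_of_nonneg_left a (by linarith)
  rw [Finset.sum_const, Finset.card_univ, nsmul_eq_mul] at hb
  linarith

end Substochastic

section Inverse

open Matrix

variable {ι : Type*} [Fintype ι] [DecidableEq ι] {M : Matrix ι ι ℝ}

/-- `I - Mᵀ diag(d)` is invertible as soon as all `d i` lie in the open unit disc. -/
theorem isUnit_one_sub_transpose_mul_diagonal (h0 : ∀ i j, 0 ≤ M i j)
    (h1 : ∀ i, ∑ j, M i j = 1) {𝕜 : Type*} [RCLike 𝕜] {d : ι → 𝕜} (hd : ∀ i, ‖d i‖ < 1) :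
    IsUnit (1 - (M.map (algebraMap ℝ 𝕜))ᵀ * diagonal d) := by
  rw [← mulVec_injective_iff_isUnit]
  refine (injective_iff_map_eq_zero (mulVecLin _)).2 fun v hv => ?_
  have hv' : ∀ i, v i = ∑ j, (algebraMap ℝ 𝕜 (M j i)) * (d j * v j) := fun i => by
    have := congrFun hv i
    simp only [mulVecLin_apply, sub_mulVec, one_mulVec, Pi.sub_apply, Pi.zero_apply,
      ← mulVec_mulVec] at this
    rw [sub_eq_zero] at this
    rw [this]
    simp [mulVec, dotProduct, diagonal_apply]
  ext i
  have := eq_zero_of_subinvariant h1 (w := fun i => ‖v i‖) hd (fun i => norm_nonneg _)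
    (fun i => ?_) i
  · simpa using this
  · conv_lhs => rw [hv' i]
    refine (norm_sum_le _ _).trans (Finset.sum_le_sum fun j _ => ?_)
    rw [norm_mul, norm_mul, norm_algebraMap', Real.norm_of_nonneg (h0 j i)]

/-- The solution of `(I - Mᵀ diag(d)) x = p`. -/
noncomputable def solution (M : Matrix ι ι ℝ) (p d : ι → ℝ) : ι → ℝ :=
  (1 - Mᵀ * diagonal d)⁻¹ *ᵥ p

theorem solution_eq_add_sum (h0 : ∀ i j, 0 ≤ M i j) (h1 : ∀ i, ∑ j, M i j = 1) {d : ι → ℝ}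
    (hd0 : ∀ i, 0 ≤ d i) (hd1 : ∀ i, d i < 1) (p : ι → ℝ) (i : ι) :
    solution M p d i = p i + ∑ j, M j i * (d j * solution M p d j) := by
  have hu := isUnit_one_sub_transpose_mul_diagonal (𝕜 := ℝ) h0 h1 (d := d) fun i => by
    rw [Real.norm_of_nonneg (hd0 i)]; exact hd1 i
  rw [show M.map (algebraMap ℝ ℝ) = M by ext; simp] at hu
  have h : (1 - Mᵀ * diagonal d) *ᵥ solution M p d = p := by
    rw [solution, mulVec_mulVec, mul_nonsing_inv _ ((isUnit_iff_isUnit_det _).1 hu), one_mulVec]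
  have h' := congrFun h i
  simp only [sub_mulVec, one_mulVec, Pi.sub_apply, ← mulVec_mulVec] at h'
  have e : (Mᵀ *ᵥ diagonal d *ᵥ solution M p d) i =
      ∑ j, M j i * (d j * solution M p d j) := by
    simp [mulVec, dotProduct, diagonal_apply]
  linarith

/-- The two-sided form of `sub_le_of_killing_close`, with rates that need not be ordered. -/
theorem abs_solution_sub_le (h0 : ∀ i j, 0 ≤ M i j) (h1 : ∀ i, ∑ j, M i j = 1)
    {p d d' : ι → ℝ} (hp : ∀ i, 0 ≤ p i) (hd : ∀ i, 1 / 2 ≤ d i) (hd1 : ∀ i, d i < 1)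
    (hd' : ∀ i, 1 / 2 ≤ d' i) (hd1' : ∀ i, d' i < 1) {η : ℝ} (hη : 0 ≤ η)
    (hη1 : 2 * η * Fintype.card ι ≤ 1 / 2)
    (hclose : ∀ i, |d i - d' i| ≤ η * (1 - d i)) (hclose' : ∀ i, |d i - d' i| ≤ η * (1 - d' i))
    (i : ι) :
    |solution M p d i - solution M p d' i| ≤ 4 * η * Fintype.card ι * solution M p d' i := by
  -- Both solutions are compared with the one for the smaller of the two rates.
  set e : ι → ℝ := fun i => min (d i) (d' i) with he
  have he0 : ∀ i, 0 ≤ e i := fun i => by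
    have := hd i; have := hd' i; exact le_min (by linarith) (by linarith)
  have hx := solution_eq_add_sum h0 h1 (fun i => by linarith [hd i]) hd1 p
  have hx' := solution_eq_add_sum h0 h1 (fun i => by linarith [hd' i]) hd1' p
  have hy := solution_eq_add_sum h0 h1 he0 (fun i => (min_le_left _ _).trans_lt (hd1 i)) p
  have hcol : ∀ {c : ι → ℝ}, (∀ i, 1 / 2 ≤ c i) → (∀ i, c i < 1) → ∀ j i,
      solution M (fun i => if i = j then 1 else 0) c i = (if i = j then 1 else 0) +
        ∑ l, M l i * (c l * solution M (fun i => if i = j then 1 else 0) c l) :=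
    fun hc hc1 j i => solution_eq_add_sum h0 h1 (fun i => by linarith [hc i]) hc1 _ i
  have s := sub_le_of_killing_close h0 h1 he0 hd1 hd (fun i => min_le_left _ _) hη (fun i => ?_)
    hp hy hx (hcol hd hd1) i
  have s' := sub_le_of_killing_close h0 h1 he0 hd1' hd' (fun i => min_le_right _ _) hη
    (fun i => ?_) hp hy hx' (hcol hd' hd1') i
  · have l := le_of_eq_add_sum h0 h1 he0 hd1 (fun i => min_le_left _ _) hp hy hx i
    have l' := le_of_eq_add_sum h0 h1 he0 hd1' (fun i => min_le_right _ _) hp hy hx' i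
    have n := nonneg_of_eq_add_sum h0 h1 he0 (fun i => (min_le_left _ _).trans_lt (hd1 i)) hp hy i
    set a := solution M p d i
    set b := solution M p d' i
    set y := solution M p e i
    set κ := 2 * η * Fintype.card ι with hκ
    have hκ0 : 0 ≤ κ := by positivity
    have e4 : 4 * η * Fintype.card ι * b = 2 * κ * b := by rw [hκ]; ring
    rw [e4, abs_le]
    constructor
    · nlinarith
    -- `a ≤ y / (1 - κ) ≤ (1 + 2κ) b`
    · have h2 : a * (1 - κ) ≤ b := by linarith
      have h3 : a ≤ 2 * b := by nlinarith
      nlinarith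
  · have := hclose' i
    simp only [he]
    rcases min_choice (d i) (d' i) with h | h <;> rw [h]
    · rw [abs_sub_comm] at this; exact (le_abs_self _).trans this
    · rw [sub_self]; exact mul_nonneg hη (by linarith [hd1' i])
  · have := hclose i
    simp only [he]
    rcases min_choice (d i) (d' i) with h | h <;> rw [h]
    · rw [sub_self]; exact mul_nonneg hη (by linarith [hd1 i])
    · exact (le_abs_self _).trans this

open Asymptotics in
/-- Equivalent killing rates give equivalent solutions. No irreducibility is needed, since the
estimate behind it is relative in every component. -/
theorem solution_isEquivalent (h0 : ∀ i j, 0 ≤ M i j) (h1 : ∀ i, ∑ j, M i j = 1)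
    {p : ι → ℝ} (hp : ∀ i, 0 ≤ p i) {α : Type*} {l : Filter α} {ε ε' : α → ι → ℝ}
    (hε : ∀ i, ∀ᶠ a in l, 0 < ε a i) (hε' : ∀ i, ∀ᶠ a in l, 0 < ε' a i)
    (hlim : ∀ i, Tendsto (fun a => ε a i) l (𝓝 0))
    (hlim' : ∀ i, Tendsto (fun a => ε' a i) l (𝓝 0))
    (h : ∀ i, IsEquivalent l (fun a => ε a i) (fun a => ε' a i)) (i : ι) :
    IsEquivalent l (fun a => solution M p (fun i => 1 - ε a i) i)
      (fun a => solution M p (fun i => 1 - ε' a i) i) := by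
  refine isLittleO_iff.2 fun c hc => ?_
  have hn0 : (0 : ℝ) < 4 * (Fintype.card ι + 1) := by positivity
  obtain ⟨η, hη, hη1, hη2⟩ : ∃ η : ℝ, 0 < η ∧ 4 * η * Fintype.card ι ≤ 1 ∧
      4 * η * Fintype.card ι ≤ c := by
    refine ⟨min 1 c / (4 * (Fintype.card ι + 1)), by positivity, ?_, ?_⟩
    · rw [show 4 * (min 1 c / (4 * ((Fintype.card ι : ℝ) + 1))) * Fintype.card ι =
        min 1 c * (Fintype.card ι / (Fintype.card ι + 1)) by field_simp]
      exact (mul_le_of_le_one_right (by positivity) (div_le_one_of_le₀ (by linarith)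
        (by positivity))).trans (min_le_left _ _)
    · rw [show 4 * (min 1 c / (4 * ((Fintype.card ι : ℝ) + 1))) * Fintype.card ι =
        min 1 c * (Fintype.card ι / (Fintype.card ι + 1)) by field_simp]
      exact (mul_le_of_le_one_right (by positivity) (div_le_one_of_le₀ (by linarith)
        (by positivity))).trans (min_le_right _ _)
  have a1 := eventually_all.2 hε
  have a2 := eventually_all.2 hε'
  have a3 := eventually_all.2 fun i => (hlim i).eventually_lt_const
    (by norm_num : (0 : ℝ) < 1 / 2)
  have a4 := eventually_all.2 fun i => (hlim' i).eventually_lt_const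
    (by norm_num : (0 : ℝ) < 1 / 2)
  have a5 := eventually_all.2 fun i => isLittleO_iff.1 (h i).isLittleO hη
  have a6 := eventually_all.2 fun i => isLittleO_iff.1 (h i).symm.isLittleO hη
  filter_upwards [a1, a2, a3, a4, a5, a6] with a b1 b2 b3 b4 b5 b6
  have hs' : ∀ i, 0 ≤ solution M p (fun i => 1 - ε' a i) i :=
    nonneg_of_eq_add_sum h0 h1 (d := fun i => 1 - ε' a i) (fun i => by linarith [b4 i])
      (fun i => by linarith [b2 i]) hp
      (solution_eq_add_sum h0 h1 (fun i => by linarith [b4 i]) (fun i => by linarith [b2 i]) p)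
  have := abs_solution_sub_le h0 h1 hp (d := fun i => 1 - ε a i) (d' := fun i => 1 - ε' a i)
    (fun i => by linarith [b3 i]) (fun i => by linarith [b1 i])
    (fun i => by linarith [b4 i]) (fun i => by linarith [b2 i]) hη.le (by linarith)
    (fun i => ?_) (fun i => ?_) i
  · rw [Pi.sub_apply, Real.norm_eq_abs, Real.norm_of_nonneg (hs' i)]
    exact this.trans (mul_le_mul_of_nonneg_right hη2 (hs' i))
  · have := b6 i
    simp only [Pi.sub_apply, Real.norm_eq_abs, abs_of_pos (b1 i)] at this
    rw [show (1 - ε a i) - (1 - ε' a i) = ε' a i - ε a i by ring, sub_sub_cancel]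
    exact this
  · have := b5 i
    simp only [Pi.sub_apply, Real.norm_eq_abs, abs_of_pos (b2 i)] at this
    rw [show (1 - ε a i) - (1 - ε' a i) = -(ε a i - ε' a i) by ring, abs_neg, sub_sub_cancel]
    exact this

end Inverse

end MultiStateCTRW

/-! ### Occupation of the internal states after `n` steps -/

namespace MultiStateCTRW

section Visit

variable {N : ℕ}

/-- The vector `(Mᵀ diag(z))ⁿ p`: the contribution to state `j` of all paths of `n` steps, where
every step leaving a state `i` carries the weight `z i`. -/
noncomputable def visit (M : Matrix (Fin N) (Fin N) ℝ) (z p : Fin N → ℂ) : ℕ → Fin N → ℂ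
  | 0 => p
  | n + 1 => fun j => ∑ i, (M i j : ℂ) * (z i * visit M z p n i)

/-- The path expansion of `visit`. -/
theorem visit_eq_sum_paths (M : Matrix (Fin N) (Fin N) ℝ) (z p : Fin N → ℂ) (n : ℕ) (j : Fin N) :
    visit M z p n j = ∑ q : Fin (n + 1) → Fin N, if q (Fin.last n) = j then
      p (q 0) * ∏ m : Fin n, ((M (q m.castSucc) (q m.succ) : ℂ) * z (q m.castSucc)) else 0 := by
  induction n generalizing j with
  | zero =>
    rw [Fintype.sum_equiv (Equiv.funUnique (Fin 1) (Fin N)) _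
      (fun a => if a = j then p a else 0) (fun q => by simp [Fin.last])]
    simp [visit]
  | succ n ih =>
    rw [← (Fin.snocEquiv fun _ => Fin N).sum_comp, Fintype.sum_prod_type]
    simp only [Fin.snocEquiv, Equiv.coe_fn_mk, Fin.snoc_last]
    rw [Finset.sum_eq_single j (fun a _ ha => by simp [ha]) (by simp)]
    simp only [if_true, visit, ih, Finset.mul_sum, mul_ite, mul_zero]
    rw [Finset.sum_comm]
    refine Finset.sum_congr rfl fun q _ => ?_
    rw [Finset.sum_ite_eq Finset.univ (q (Fin.last n)), if_pos (Finset.mem_univ _),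
      Fin.prod_univ_castSucc]
    have e0 : (Fin.snoc q j : Fin (n + 2) → Fin N) 0 = q 0 := by
      rw [← Fin.castSucc_zero, Fin.snoc_castSucc]
    simp only [e0, Fin.snoc_castSucc, Fin.succ_castSucc, Fin.succ_last, Fin.snoc_last]
    ring

theorem sum_norm_visit_le {M : Matrix (Fin N) (Fin N) ℝ} (h0 : ∀ i j, 0 ≤ M i j)
    (h1 : ∀ i, ∑ j, M i j = 1) {z : Fin N → ℂ} {c : ℝ} (hc : 0 ≤ c) (hz : ∀ i, ‖z i‖ ≤ c)
    (p : Fin N → ℂ) (n : ℕ) : ∑ j, ‖visit M z p n j‖ ≤ c ^ n * ∑ j, ‖p j‖ := by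
  induction n with
  | zero => simp [visit]
  | succ n ih =>
    calc ∑ j, ‖visit M z p (n + 1) j‖
        ≤ ∑ j, ∑ i, M i j * (c * ‖visit M z p n i‖) := by
          refine Finset.sum_le_sum fun j _ => (norm_sum_le _ _).trans ?_
          refine Finset.sum_le_sum fun i _ => ?_
          rw [norm_mul, norm_mul, Complex.norm_real, Real.norm_of_nonneg (h0 i j)]
          exact mul_le_mul_of_nonneg_left
            (mul_le_mul_of_nonneg_right (hz i) (norm_nonneg _)) (h0 i j)
      _ = c * ∑ i, ‖visit M z p n i‖ := by
          rw [sum_sum_weighted_row h1, Finset.mul_sum]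
      _ ≤ _ := by rw [pow_succ', mul_assoc]; exact mul_le_mul_of_nonneg_left ih hc

end Visit

section Paths

variable {N : ℕ} {Ω : Type*} {state : ℕ → Ω → Fin N} {wait : ℕ → Ω → ℝ}

/-- A path of finitely many internal states, continued arbitrarily. -/
def extendPath {n : ℕ} (q : Fin (n + 1) → Fin N) (m : ℕ) : Fin N :=
  if h : m < n + 1 then q ⟨m, h⟩ else q 0

@[simp] theorem extendPath_coe {n : ℕ} (q : Fin (n + 1) → Fin N) (m : Fin (n + 1)) :
    extendPath q m = q m := by simp only [extendPath, Fin.is_lt, dite_true, Fin.eta]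

theorem path_eq_iff {n : ℕ} (q : Fin (n + 1) → Fin N) (ω : Ω) :
    (∀ m ≤ n, state m ω = extendPath q m) ↔ (fun m : Fin (n + 1) => state m ω) = q := by
  constructor
  · intro h
    funext m
    rw [h m (Nat.le_of_lt_succ m.2), extendPath_coe]
  · rintro rfl m hm
    rw [show m = ((⟨m, Nat.lt_succ_of_le hm⟩ : Fin (n + 1)) : ℕ) from rfl, extendPath_coe]

theorem exp_neg_mul_renewalTime (s : ℂ) (n : ℕ) (ω : Ω) :
    Complex.exp (-s * renewalTime wait n ω) = ∏ m : Fin n, Complex.exp (-s * wait m ω) := by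
  rw [renewalTime, Complex.ofReal_sum, Finset.mul_sum, Complex.exp_sum, Finset.prod_range]

theorem renewalTime_nonneg {ω : Ω} (h : ∀ n, 0 < wait n ω) (n : ℕ) : 0 ≤ renewalTime wait n ω :=
  Finset.sum_nonneg fun m _ => (h m).le

theorem norm_exp_neg_mul_le_one {s : ℂ} (hs : 0 ≤ s.re) {t : ℝ} (ht : 0 ≤ t) :
    ‖Complex.exp (-s * t)‖ ≤ 1 := by
  rw [Complex.norm_exp, Real.exp_le_one_iff]
  simp
  positivity

end Paths

section Law

variable {N : ℕ} {Ω : Type*} [MeasurableSpace Ω] {P : Measure Ω}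
  {M : Matrix (Fin N) (Fin N) ℝ} {p₀ : Fin N → ℝ} {φ lam : Fin N → Measure ℝ}
  {state : ℕ → Ω → Fin N} {wait jump : ℕ → Ω → ℝ}

/-- The waiting times and the jumps of the steps `0, …, n` as one point of a finite product. -/
def stepVector (wait jump : ℕ → Ω → ℝ) (n : ℕ) (ω : Ω) : Fin (n + 1) ⊕ Fin (n + 1) → ℝ :=
  Sum.elim (fun m => wait m ω) (fun m => jump m ω)

theorem IsCTRW.measurable_stepVector (hW : IsCTRW P M p₀ φ lam state wait jump) (n : ℕ) :
    Measurable (stepVector wait jump n) := by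
  refine measurable_pi_lambda _ fun x => ?_
  rcases x with m | m
  · exact hW.measurable_wait m
  · exact hW.measurable_jump m

theorem IsCTRW.measurable_state (hW : IsCTRW P M p₀ φ lam state wait jump) (n : ℕ) :
    Measurable (state n) :=
  measurable_to_countable' fun i => hW.measurableSet_state n i

theorem IsCTRW.measurableSet_path (hW : IsCTRW P M p₀ φ lam state wait jump) (n : ℕ)
    (i : ℕ → Fin N) : MeasurableSet {ω | ∀ m ≤ n, state m ω = i m} := by
  simp only [ofPred_forall]
  exact MeasurableSet.iInter fun m => MeasurableSet.iInter fun _ => hW.measurableSet_state m _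

/-- Given a path of internal states, the waiting times and the jumps are independent with the laws
prescribed by the states. -/
theorem IsCTRW.map_stepVector (hW : IsCTRW P M p₀ φ lam state wait jump)
    [IsProbabilityMeasure P] [∀ i, IsProbabilityMeasure (φ i)]
    [∀ i, IsProbabilityMeasure (lam i)] (n : ℕ) (i : ℕ → Fin N) :
    (P.restrict {ω | ∀ m ≤ n, state m ω = i m}).map (stepVector wait jump n) =
      ENNReal.ofReal (p₀ (i 0) * ∏ m ∈ Finset.range n, M (i m) (i (m + 1))) •
        Measure.pi (Sum.elim (fun m : Fin (n + 1) => φ (i m))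
          (fun m : Fin (n + 1) => lam (i m))) := by
  have : ∀ x, IsProbabilityMeasure (Sum.elim (fun m : Fin (n + 1) => φ (i m))
      (fun m : Fin (n + 1) => lam (i m)) x) := by rintro (m | m) <;> dsimp <;> infer_instance
  have key : ∀ S : Fin (n + 1) ⊕ Fin (n + 1) → Set ℝ, (∀ x, MeasurableSet (S x)) →
      (P.restrict {ω | ∀ m ≤ n, state m ω = i m}).map (stepVector wait jump n) (pi univ S) =
      (ENNReal.ofReal (p₀ (i 0) * ∏ m ∈ Finset.range n, M (i m) (i (m + 1))) •
        Measure.pi (Sum.elim (fun m : Fin (n + 1) => φ (i m))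
          (fun m : Fin (n + 1) => lam (i m)))) (pi univ S) := by
    intro S hS
    have hmem : MeasurableSet (pi univ S) := MeasurableSet.univ_pi hS
    rw [Measure.map_apply (hW.measurable_stepVector n) hmem,
      Measure.restrict_apply (hW.measurable_stepVector n hmem), Measure.smul_apply, Measure.pi_pi,
      smul_eq_mul, Fintype.prod_sum_type]
    have h := hW.law n i
      (fun m => if h : m < n + 1 then S (Sum.inl ⟨m, h⟩) else univ)
      (fun m => if h : m < n + 1 then S (Sum.inr ⟨m, h⟩) else univ)
      (fun m => by split_ifs; exacts [hS _, MeasurableSet.univ])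
      (fun m => by split_ifs; exacts [hS _, MeasurableSet.univ])
    rw [Finset.prod_range (n := n + 1), Finset.prod_mul_distrib] at h
    simp only [Fin.is_lt, dite_true, Fin.eta] at h
    simp only [Sum.elim_inl, Sum.elim_inr]
    rw [← h]
    congr 1
    ext ω
    simp only [stepVector, mem_inter_iff, mem_preimage, Set.mem_pi, mem_univ, forall_true_left,
      Sum.forall, Sum.elim_inl, Sum.elim_inr, mem_ofPred_eq]
    constructor
    · rintro ⟨⟨ha, hb⟩, hc⟩ m hm
      have hm' := Nat.lt_succ_of_le hm
      refine ⟨hc m hm, ?_, ?_⟩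
      · rw [dif_pos hm']; exact ha ⟨m, hm'⟩
      · rw [dif_pos hm']; exact hb ⟨m, hm'⟩
    · intro h
      refine ⟨⟨fun m => ?_, fun m => ?_⟩, fun m hm => (h m hm).1⟩
      · have := (h m (Nat.le_of_lt_succ m.2)).2.1
        rwa [dif_pos m.2] at this
      · have := (h m (Nat.le_of_lt_succ m.2)).2.2
        rwa [dif_pos m.2] at this
  have : IsFiniteMeasure
      ((P.restrict {ω | ∀ m ≤ n, state m ω = i m}).map (stepVector wait jump n)) :=
    Measure.isFiniteMeasure_map _ _
  refine ext_of_generate_finite _ generateFrom_pi.symm isPiSystem_pi ?_ ?_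
  · rintro _ ⟨S, hS, rfl⟩
    exact key S fun x => hS x (mem_univ x)
  · simpa only [pi_univ] using key (fun _ => univ) fun _ => MeasurableSet.univ

/-- The expectation, on the event of a given path of internal states, of a product of functions of
the single waiting times and jumps. -/
theorem IsCTRW.setIntegral_path (hW : IsCTRW P M p₀ φ lam state wait jump)
    [IsProbabilityMeasure P] [∀ i, IsProbabilityMeasure (φ i)]
    [∀ i, IsProbabilityMeasure (lam i)] (h0 : ∀ i j, 0 ≤ M i j) (hp : ∀ i, 0 ≤ p₀ i)
    (n : ℕ) (i : ℕ → Fin N) {f g : ℕ → ℝ → ℂ}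
    (hf : ∀ m, Measurable (f m)) (hg : ∀ m, Measurable (g m)) :
    ∫ ω in {ω | ∀ m ≤ n, state m ω = i m},
        ∏ m : Fin (n + 1), (f m (wait m ω) * g m (jump m ω)) ∂P =
      (p₀ (i 0) * ∏ m : Fin n, M (i m) (i (m + 1)) : ℝ) *
        ∏ m : Fin (n + 1), ((∫ τ, f m τ ∂φ (i m)) * ∫ x, g m x ∂lam (i m)) := by
  have : ∀ x, IsProbabilityMeasure (Sum.elim (fun m : Fin (n + 1) => φ (i m))
      (fun m : Fin (n + 1) => lam (i m)) x) := by rintro (m | m) <;> dsimp <;> infer_instance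
  set F : Fin (n + 1) ⊕ Fin (n + 1) → ℝ → ℂ :=
    Sum.elim (fun m : Fin (n + 1) => f m) (fun m : Fin (n + 1) => g m) with hF
  have hFm : ∀ x, Measurable (F x) := by
    rintro (m | m)
    · exact hf m
    · exact hg m
  have e : ∀ ω, ∏ m : Fin (n + 1), (f m (wait m ω) * g m (jump m ω)) =
      (fun y : Fin (n + 1) ⊕ Fin (n + 1) → ℝ => ∏ x, F x (y x)) (stepVector wait jump n ω) :=
    fun ω => by simp [hF, stepVector, Finset.prod_mul_distrib]
  simp only [e]
  rw [← integral_map (φ := stepVector wait jump n)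
    (f := fun y : Fin (n + 1) ⊕ Fin (n + 1) → ℝ => ∏ x, F x (y x))
    (hW.measurable_stepVector n).aemeasurable
    (Finset.measurable_prod _ fun x _ =>
      (hFm x).comp (measurable_pi_apply x)).aestronglyMeasurable,
    hW.map_stepVector n i, integral_smul_measure, integral_fintype_prod_eq_prod,
    ENNReal.toReal_ofReal (mul_nonneg (hp _) (Finset.prod_nonneg fun m _ => h0 _ _)),
    Fintype.prod_sum_type, Finset.prod_range, Complex.real_smul, Finset.prod_mul_distrib]
  simp only [hF, Sum.elim_inl, Sum.elim_inr]

theorem IsCTRW.ae_wait_pos (hW : IsCTRW P M p₀ φ lam state wait jump)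
    (hφpos : ∀ i, φ i (Iic 0) = 0) : ∀ᵐ ω ∂P, ∀ n, 0 < wait n ω := by
  refine ae_all_iff.2 fun n => ?_
  have hz : ∀ q : Fin (n + 1) → Fin N, P {ω | ∀ m ≤ n, state m ω = extendPath q m ∧
      wait m ω ∈ (if m = n then Iic (0 : ℝ) else univ) ∧ jump m ω ∈ (univ : Set ℝ)} = 0 := by
    intro q
    rw [hW.law n (extendPath q) (fun m => if m = n then Iic (0 : ℝ) else univ) (fun _ => univ)
      (fun m => by split_ifs; exacts [measurableSet_Iic, MeasurableSet.univ])
      (fun _ => MeasurableSet.univ)]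
    refine mul_eq_zero_of_right _ (Finset.prod_eq_zero (Finset.self_mem_range_succ n) ?_)
    simp [hφpos]
  have hU := measure_iUnion_null hz
  refine measure_mono_null (fun ω hω => ?_) hU
  simp only [mem_compl_iff, mem_ofPred_eq, not_lt] at hω
  refine mem_iUnion.2 ⟨fun m => state m ω, fun m hm => ⟨?_, ?_, mem_univ _⟩⟩
  · exact (path_eq_iff (state := state) _ ω).2 rfl m hm
  · split_ifs with h
    · rw [h]; exact hω
    · exact mem_univ _

theorem IsCTRW.measurable_renewalTime (hW : IsCTRW P M p₀ φ lam state wait jump) (n : ℕ) :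
    Measurable (renewalTime wait n) :=
  Finset.measurable_sum _ fun m _ => hW.measurable_wait m

/-- The expectation of a function of the first `n + 1` steps, on the event that step `n` is in
state `j`, by summation over all paths. -/
theorem IsCTRW.integral_state (hW : IsCTRW P M p₀ φ lam state wait jump)
    [IsProbabilityMeasure P] [∀ i, IsProbabilityMeasure (φ i)]
    [∀ i, IsProbabilityMeasure (lam i)] (hφpos : ∀ i, φ i (Iic 0) = 0)
    (h0 : ∀ i j, 0 ≤ M i j) (hp : ∀ i, 0 ≤ p₀ i)
    (k : ℝ) {s : ℂ} (hs : 0 ≤ s.re) {h : ℝ → ℂ} (hh : Measurable h) {C : ℝ}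
    (hC : ∀ τ > 0, ‖h τ‖ ≤ C) (n : ℕ) (j : Fin N) :
    ∫ ω in {ω | state n ω = j}, Complex.exp (-s * renewalTime wait n ω) *
        Complex.exp (k * (∑ m ∈ Finset.range n, jump m ω : ℝ) * Complex.I) * h (wait n ω) ∂P =
      visit M (fun i => laplace (φ i) s * charFun (lam i) k) (fun i => (p₀ i : ℂ)) n j *
        ∫ τ, h τ ∂φ j := by
  set G : Ω → ℂ := fun ω => Complex.exp (-s * renewalTime wait n ω) *
        Complex.exp (k * (∑ m ∈ Finset.range n, jump m ω : ℝ) * Complex.I) * h (wait n ω)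
  have hGm : Measurable G := by
    have := hW.measurable_renewalTime n
    have := hW.measurable_wait n
    have : Measurable fun ω => (∑ m ∈ Finset.range n, jump m ω : ℝ) :=
      Finset.measurable_sum _ fun m _ => hW.measurable_jump m
    fun_prop
  have hGi : Integrable G P := by
    refine Integrable.of_bound (C := C) hGm.aestronglyMeasurable ?_
    filter_upwards [hW.ae_wait_pos hφpos] with ω hω
    simp only [G, norm_mul]
    have a := norm_exp_neg_mul_le_one hs (renewalTime_nonneg hω n)
    have b : ‖Complex.exp (k * (∑ m ∈ Finset.range n, jump m ω : ℝ) * Complex.I)‖ = 1 := by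
      rw [← Complex.ofReal_mul, Complex.norm_exp_ofReal_mul_I]
    rw [b, mul_one]
    exact (mul_le_of_le_one_left (norm_nonneg _) a).trans (hC _ (hω n))
  have hset : {ω | state n ω = j} = ⋃ q ∈ (Finset.univ.filter
      fun q : Fin (n + 1) → Fin N => q (Fin.last n) = j),
      {ω | ∀ m ≤ n, state m ω = extendPath q m} := by
    ext ω
    simp only [Finset.mem_filter, Finset.mem_univ, true_and, mem_iUnion, mem_ofPred_eq,
      path_eq_iff, exists_prop, exists_eq_right', Fin.val_last]
  rw [hset, integral_biUnion_finset _ (fun q _ => hW.measurableSet_path n _) ?_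
    (fun q _ => hGi.integrableOn)]
  · rw [visit_eq_sum_paths, Finset.sum_mul, Finset.sum_filter]
    refine Finset.sum_congr rfl fun q _ => ?_
    split_ifs with hq
    swap
    · rw [zero_mul]
    have hG : ∀ ω, G ω = ∏ m : Fin (n + 1),
        ((if (m : ℕ) < n then fun τ : ℝ => Complex.exp (-s * τ) else h) (wait m ω) *
          (if (m : ℕ) < n then fun x : ℝ => Complex.exp (k * x * Complex.I) else 1)
            (jump m ω)) := by
      intro ω
      rw [Fin.prod_univ_castSucc]
      simp only [G, exp_neg_mul_renewalTime, Fin.val_castSucc, Fin.is_lt, if_true, Fin.val_last,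
        lt_irrefl, if_false, Finset.prod_mul_distrib, Pi.one_apply, mul_one, Complex.ofReal_sum,
        Finset.mul_sum, Finset.sum_mul, Complex.exp_sum, Finset.prod_range]
    simp only [hG]
    rw [hW.setIntegral_path h0 hp n (extendPath q)
      (f := fun m => if m < n then fun τ : ℝ => Complex.exp (-s * τ) else h)
      (g := fun m => if m < n then fun x : ℝ => Complex.exp (k * x * Complex.I) else 1)
      (fun m => by split_ifs <;> fun_prop)
      (fun m => by split_ifs; exacts [by fun_prop, measurable_const])]
    rw [Fin.prod_univ_castSucc (n := n)]
    have e1 : ∀ m : Fin n, extendPath q m = q m.castSucc := fun m =>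
      extendPath_coe q m.castSucc
    have e2 : ∀ m : Fin n, extendPath q (m + 1) = q m.succ := fun m =>
      extendPath_coe q m.succ
    have e3 : extendPath q 0 = q 0 := extendPath_coe q 0
    have e4 : extendPath q n = q (Fin.last n) := extendPath_coe q (Fin.last n)
    simp only [Fin.val_castSucc, Fin.is_lt, if_true, Fin.val_last, lt_irrefl, if_false, e1, e2,
      e3, e4, hq, Pi.one_apply, integral_const, probReal_univ, one_smul, mul_one,
      charFun_apply_real, laplace, Complex.ofReal_mul, Complex.ofReal_prod]
    rw [Finset.prod_mul_distrib (f := fun m : Fin n => ((M (q m.castSucc) (q m.succ) : ℝ) : ℂ))]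
    ring
  · intro q _ q' _ hne
    refine Set.disjoint_left.2 fun ω h1 h2 => hne ?_
    exact ((path_eq_iff q ω).1 h1).symm.trans ((path_eq_iff q' ω).1 h2)

end Law

end MultiStateCTRW

/-! ### The Montroll-Weiss formula -/

namespace MultiStateCTRW

section Renewal

variable {Ω : Type*} {wait : ℕ → Ω → ℝ}

theorem renewalTime_succ (n : ℕ) (ω : Ω) :
    renewalTime wait (n + 1) ω = renewalTime wait n ω + wait n ω :=
  Finset.sum_range_succ _ _

theorem strictMono_renewalTime {ω : Ω} (h : ∀ n, 0 < wait n ω) :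
    StrictMono fun n => renewalTime wait n ω :=
  strictMono_nat_of_lt_succ fun n => by rw [renewalTime_succ]; linarith [h n]

theorem renewalCount_eq_iff {ω : Ω} (h : ∀ n, 0 < wait n ω)
    (hlim : Tendsto (fun n => renewalTime wait n ω) atTop atTop) {t : ℝ} (ht : 0 ≤ t) (n : ℕ) :
    renewalCount wait t ω = n ↔ renewalTime wait n ω ≤ t ∧ t < renewalTime wait (n + 1) ω := by
  have hmono := strictMono_renewalTime h
  constructor
  · rintro rfl
    obtain ⟨b, hb⟩ := (hlim.eventually_gt_atTop t).exists
    have hbdd : BddAbove {n | renewalTime wait n ω ≤ t} :=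
      ⟨b, fun m hm => (hmono.lt_iff_lt.1 (lt_of_le_of_lt hm hb)).le⟩
    have hne : {n | renewalTime wait n ω ≤ t}.Nonempty :=
      ⟨0, by simpa [renewalTime] using ht⟩
    refine ⟨Nat.sSup_mem hne hbdd, lt_of_not_ge fun hle => ?_⟩
    exact absurd (le_csSup hbdd hle) (Nat.not_succ_le_self _)
  · rintro ⟨h1, h2⟩
    have : {n | renewalTime wait n ω ≤ t} = Iic n := by
      ext m
      refine ⟨fun hm => Nat.le_of_lt_succ (hmono.lt_iff_lt.1 (lt_of_le_of_lt hm h2)), fun hm => ?_⟩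
      exact (hmono.monotone hm).trans h1
    rw [renewalCount, this, csSup_Iic]

/-- Conditions that hold for almost every realization and make `renewalCount` the counting function
of the renewals. -/
def IsRegular (wait : ℕ → Ω → ℝ) (ω : Ω) : Prop :=
  (∀ n, 0 < wait n ω) ∧ Tendsto (fun n => renewalTime wait n ω) atTop atTop

theorem IsRegular.between_renewals_iff {ω : Ω} (h : IsRegular wait ω) {t : ℝ} (ht : 0 ≤ t) (n : ℕ) :
    (renewalTime wait n ω ≤ t ∧ t < renewalTime wait (n + 1) ω) ↔ n = renewalCount wait t ω := by
  rw [← renewalCount_eq_iff h.1 h.2 ht, eq_comm]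

variable {N : ℕ} {state : ℕ → Ω → Fin N} {jump : ℕ → Ω → ℝ}

/-- The part of the Fourier-Laplace transform that comes from the time between the renewals `n` and
`n + 1`, as a function of the time and of the realization. -/
noncomputable def pieceFun (state : ℕ → Ω → Fin N) (wait jump : ℕ → Ω → ℝ) (i : Fin N) (k : ℝ)
    (s : ℂ) (n : ℕ) (y : ℝ × Ω) : ℂ :=
  {y : ℝ × Ω | state n y.2 = i ∧ renewalTime wait n y.2 ≤ y.1 ∧
    y.1 < renewalTime wait (n + 1) y.2}.indicator
    (fun y => Complex.exp (-s * y.1) *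
      Complex.exp (k * (∑ m ∈ Finset.range n, jump m y.2 : ℝ) * Complex.I)) y

theorem IsRegular.hasSum_pieceFun {ω : Ω} (h : IsRegular wait ω) {t : ℝ} (ht : 0 ≤ t)
    (i : Fin N) (k : ℝ) (s : ℂ) :
    HasSum (fun n => pieceFun state wait jump i k s n (t, ω))
      (Complex.exp (-s * t) * {ω | internalState state wait t ω = i}.indicator
        (fun ω => Complex.exp (k * position wait jump t ω * Complex.I)) ω) := by
  have hS := hasSum_single (f := fun n => pieceFun state wait jump i k s n (t, ω))
    (renewalCount wait t ω) fun n hn =>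
      indicator_of_notMem (fun hmem => hn ((h.between_renewals_iff ht n).1 hmem.2)) _
  have hc := (h.between_renewals_iff ht _).2 rfl
  convert! hS using 1
  by_cases hi : internalState state wait t ω = i
  · rw [indicator_of_mem (show ω ∈ {ω | internalState state wait t ω = i} from hi), pieceFun]
    symm
    exact indicator_of_mem (show (t, ω) ∈ {y : ℝ × Ω | state (renewalCount wait t ω) y.2 = i ∧
      renewalTime wait (renewalCount wait t ω) y.2 ≤ y.1 ∧
        y.1 < renewalTime wait (renewalCount wait t ω + 1) y.2} from And.intro hi hc) _
  · rw [indicator_of_notMem (show ω ∉ {ω | internalState state wait t ω = i} from hi), pieceFun,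
      indicator_of_notMem fun hmem => hi hmem.1, mul_zero]

end Renewal

theorem integrable_exp_neg_mul {φ : Measure ℝ} [IsProbabilityMeasure φ] (hφ : φ (Iic 0) = 0)
    {s : ℂ} (hs : 0 ≤ s.re) : Integrable (fun τ : ℝ => Complex.exp (-s * τ)) φ := by
  refine Integrable.of_bound (C := 1) (by fun_prop) ?_
  have : ∀ᵐ τ ∂φ, τ ∉ Iic (0 : ℝ) := measure_eq_zero_iff_ae_notMem.1 hφ
  filter_upwards [this] with τ hτ
  exact norm_exp_neg_mul_le_one hs (not_le.1 hτ).le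

/-- A waiting time that is almost surely positive has a Laplace transform of modulus less than one
in the open right half-plane. -/
theorem norm_laplace_lt_one {φ : Measure ℝ} [IsProbabilityMeasure φ] (hφ : φ (Iic 0) = 0)
    {s : ℂ} (hs : 0 < s.re) : ‖laplace φ s‖ < 1 := by
  have hae : ∀ᵐ τ ∂φ, 0 < τ := by
    have : ∀ᵐ τ ∂φ, τ ∉ Iic (0 : ℝ) := measure_eq_zero_iff_ae_notMem.1 hφ
    filter_upwards [this] with τ hτ using not_le.1 hτ
  have hlt : ∀ᵐ τ : ℝ ∂φ, ‖Complex.exp (-s * τ)‖ < 1 := by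
    filter_upwards [hae] with τ hτ
    rw [Complex.norm_exp, Real.exp_lt_one_iff]
    simp
    positivity
  have hint := (integrable_exp_neg_mul hφ hs.le).norm
  refine (norm_integral_le_integral_norm _).trans_lt ?_
  have hpos : 0 < ∫ τ, (1 - ‖Complex.exp (-s * τ)‖) ∂φ := by
    rw [integral_pos_iff_support_of_nonneg_ae]
    · have : Function.support (fun τ : ℝ => 1 - ‖Complex.exp (-s * τ)‖) =ᵐ[φ] univ := by
        filter_upwards [hlt] with τ hτ
        refine eq_true ?_
        exact (sub_pos.2 hτ).ne'
      rw [measure_congr this]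
      simp
    · filter_upwards [hlt] with τ hτ using (sub_pos.2 hτ).le
    · exact (integrable_const _).sub hint
  rw [integral_sub (integrable_const _) hint] at hpos
  simpa using hpos

variable {N : ℕ} {Ω : Type*} [MeasurableSpace Ω] {P : Measure Ω}
  {M : Matrix (Fin N) (Fin N) ℝ} {p₀ : Fin N → ℝ} {φ lam : Fin N → Measure ℝ}
  {state : ℕ → Ω → Fin N} {wait jump : ℕ → Ω → ℝ}

/-- The walk makes finitely many steps in finite time: `E exp(-Tₙ)` decays geometrically. -/
theorem IsCTRW.ae_tendsto_renewalTime (hW : IsCTRW P M p₀ φ lam state wait jump)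
    [IsProbabilityMeasure P] [∀ i, IsProbabilityMeasure (φ i)]
    [∀ i, IsProbabilityMeasure (lam i)] (hφpos : ∀ i, φ i (Iic 0) = 0)
    (h0 : ∀ i j, 0 ≤ M i j) (h1 : ∀ i, ∑ j, M i j = 1) (hp : ∀ i, 0 ≤ p₀ i) :
    ∀ᵐ ω ∂P, Tendsto (fun n => renewalTime wait n ω) atTop atTop := by
  obtain ⟨c, hc0, hc1, hc⟩ : ∃ c : ℝ, 0 ≤ c ∧ c < 1 ∧
      ∀ i, ‖laplace (φ i) 1 * charFun (lam i) 0‖ ≤ c := by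
    have hlt : ∀ i, ‖laplace (φ i) 1 * charFun (lam i) 0‖ < 1 := fun i => by
      simpa using norm_laplace_lt_one (hφpos i) (s := 1) (by simp)
    rcases isEmpty_or_nonempty (Fin N) with hN | hN
    · exact ⟨0, le_rfl, zero_lt_one, fun i => hN.elim i⟩
    · obtain ⟨i, hi⟩ := Finite.exists_max fun i => ‖laplace (φ i) 1 * charFun (lam i) 0‖
      exact ⟨_, norm_nonneg _, hlt i, hi⟩
  set C : ℝ := ∑ j, ‖(p₀ j : ℂ)‖
  have hcont : ∀ n, Measurable fun ω => Real.exp (-renewalTime wait n ω) := fun n =>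
    (hW.measurable_renewalTime n).neg.exp
  have hle1 : ∀ n, ∀ᵐ ω ∂P, ‖Real.exp (-renewalTime wait n ω)‖ ≤ 1 := fun n => by
    filter_upwards [hW.ae_wait_pos hφpos] with ω hω
    rw [Real.norm_of_nonneg (Real.exp_pos _).le, Real.exp_le_one_iff]
    linarith [renewalTime_nonneg hω n]
  have hint : ∀ n, Integrable (fun ω => Real.exp (-renewalTime wait n ω)) P := fun n =>
    Integrable.of_bound (C := 1) (hcont n).aestronglyMeasurable (hle1 n)
  have hE : ∀ n, ∫ ω, Real.exp (-renewalTime wait n ω) ∂P ≤ c ^ n * C := by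
    intro n
    have e : ((∫ ω, Real.exp (-renewalTime wait n ω) ∂P : ℝ) : ℂ) =
        ∑ j, visit M (fun i => laplace (φ i) 1 * charFun (lam i) 0) (fun i => (p₀ i : ℂ)) n j := by
      have hj : ∀ j, visit M (fun i => laplace (φ i) 1 * charFun (lam i) 0)
          (fun i => (p₀ i : ℂ)) n j =
          ∫ ω in {ω | state n ω = j}, ((Real.exp (-renewalTime wait n ω) : ℝ) : ℂ) ∂P := by
        intro j
        have := hW.integral_state hφpos h0 hp 0 (s := 1) (by simp) (h := fun _ => 1)
          measurable_const (C := 1) (by simp) n j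
        simp only [integral_const, probReal_univ, one_smul, mul_one] at this
        rw [← this]
        congr 1
        ext ω
        simp
      simp only [hj]
      rw [← integral_complex_ofReal, ← setIntegral_univ]
      have hC : Integrable (fun ω => ((Real.exp (-renewalTime wait n ω) : ℝ) : ℂ)) P :=
        (hint n).ofReal
      have hU : (univ : Set Ω) = ⋃ j ∈ (Finset.univ : Finset (Fin N)), {ω | state n ω = j} := by
        ext ω; simp
      rw [hU, integral_biUnion_finset (s := fun j => {ω | state n ω = j}) _
        (fun j _ => hW.measurableSet_state n j)
        (fun j _ j' _ hne => Set.disjoint_left.2 fun ω a b => hne (a.symm.trans b))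
        (fun j _ => hC.integrableOn)]
    have := sum_norm_visit_le h0 h1 hc0 hc (fun i => (p₀ i : ℂ)) n
    refine le_trans ?_ this
    refine le_trans ?_ (norm_sum_le _ _)
    rw [← e, Complex.norm_real]
    exact Real.le_norm_self _
  have hsum : Summable fun n => c ^ n * C := (summable_geometric_of_lt_one hc0 hc1).mul_right C
  have hfin : ∫⁻ ω, ∑' n, ENNReal.ofReal (Real.exp (-renewalTime wait n ω)) ∂P ≠ ⊤ := by
    rw [lintegral_tsum fun n => (hcont n).ennreal_ofReal.aemeasurable]
    simp only [← ofReal_integral_eq_lintegral_ofReal (hint _)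
      (Eventually.of_forall fun ω => (Real.exp_pos _).le)]
    refine ne_top_of_le_ne_top (ENNReal.ofReal_ne_top (r := ∑' n, c ^ n * C)) ?_
    rw [ENNReal.ofReal_tsum_of_nonneg (fun n => by positivity) hsum]
    exact ENNReal.tsum_le_tsum fun n => ENNReal.ofReal_le_ofReal (hE n)
  have hmeas : Measurable fun ω => ∑' n, ENNReal.ofReal (Real.exp (-renewalTime wait n ω)) :=
    Measurable.tsum fun n => (hcont n).ennreal_ofReal
  filter_upwards [ae_lt_top hmeas hfin] with ω hω
  have h2 := ENNReal.tendsto_atTop_zero_of_tsum_ne_top hω.ne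
  have h3 := (ENNReal.tendsto_toReal ENNReal.zero_ne_top).comp h2
  have h4 : Tendsto (fun n => Real.exp (-renewalTime wait n ω)) atTop (𝓝 0) := by
    refine h3.congr fun n => ?_
    simp [ENNReal.toReal_ofReal (Real.exp_pos _).le]
  have h5 := Real.tendsto_exp_comp_nhds_zero.1 h4
  simpa [Function.comp_def] using tendsto_neg_atBot_atTop.comp h5

theorem IsCTRW.measurable_pieceFun (hW : IsCTRW P M p₀ φ lam state wait jump) (i : Fin N) (k : ℝ)
    (s : ℂ) (n : ℕ) : Measurable (pieceFun state wait jump i k s n) := by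
  have a1 := hW.measurable_renewalTime n
  have a2 := hW.measurable_renewalTime (n + 1)
  have a3 : Measurable fun ω => (∑ m ∈ Finset.range n, jump m ω : ℝ) :=
    Finset.measurable_sum _ fun m _ => hW.measurable_jump m
  have a4 : Measurable fun y : ℝ × Ω => (∑ m ∈ Finset.range n, jump m y.2 : ℝ) :=
    a3.comp measurable_snd
  refine Measurable.indicator (Measurable.mul (by fun_prop) ?_) ?_
  · exact ((measurable_const.mul (Complex.measurable_ofReal.comp a4)).mul_const _).cexp
  refine (measurable_snd (hW.measurableSet_state n i)).inter (MeasurableSet.inter ?_ ?_)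
  · exact measurableSet_le (a1.comp measurable_snd) measurable_fst
  · exact measurableSet_lt measurable_fst (a2.comp measurable_snd)

theorem setIntegral_Ioi_exp_indicator {s : ℂ} (hs : s ≠ 0) {a b : ℝ} (ha : 0 ≤ a) (hab : a < b)
    (c : ℂ) :
    ∫ t in Ioi (0 : ℝ), (Ico a b).indicator (fun t : ℝ => Complex.exp (-s * t) * c) t =
      s⁻¹ * (Complex.exp (-s * a) * c * (1 - Complex.exp (-s * (b - a : ℝ)))) := by
  rw [setIntegral_congr_set (t := Ici 0) Ioi_ae_eq_Ici, setIntegral_indicator measurableSet_Ico,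
    inter_eq_right.2 (Ico_subset_Ici_self.trans (Ici_subset_Ici.2 ha)),
    setIntegral_congr_set (t := Ioc a b) Ico_ae_eq_Ioc,
    ← intervalIntegral.integral_of_le hab.le, intervalIntegral.integral_mul_const,
    integral_exp_mul_complex (neg_ne_zero.2 hs)]
  have : Complex.exp (-s * b) = Complex.exp (-s * a) * Complex.exp (-s * (b - a : ℝ)) := by
    rw [← Complex.exp_add]; push_cast; ring_nf
  rw [this]
  field_simp
  ring

/-- The integral over the time between two renewals depends on the realization only through the
duration of that interval, which is the waiting time of step `n`. -/
theorem IsCTRW.integral_pieceFun (hW : IsCTRW P M p₀ φ lam state wait jump)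
    [IsProbabilityMeasure P] [∀ i, IsProbabilityMeasure (φ i)]
    [∀ i, IsProbabilityMeasure (lam i)] (hφpos : ∀ i, φ i (Iic 0) = 0)
    (h0 : ∀ i j, 0 ≤ M i j) (hp : ∀ i, 0 ≤ p₀ i)
    (k : ℝ) {s : ℂ} (hs : 0 < s.re) (n : ℕ) (i : Fin N)
    (hint : Integrable (pieceFun state wait jump i k s n)
      ((volume.restrict (Ioi (0 : ℝ))).prod P)) :
    ∫ y, pieceFun state wait jump i k s n y ∂((volume.restrict (Ioi (0 : ℝ))).prod P) =
      s⁻¹ * (1 - laplace (φ i) s) *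
        visit M (fun i => laplace (φ i) s * charFun (lam i) k) (fun i => (p₀ i : ℂ)) n i := by
  have hs0 : s ≠ 0 := fun h => by simp [h] at hs
  rw [integral_prod_symm _ hint]
  have hst := hW.integral_state hφpos h0 hp k hs.le (h := fun τ => 1 - Complex.exp (-s * τ))
    (by fun_prop) (C := 2) (fun τ hτ => by
      have := norm_exp_neg_mul_le_one hs.le hτ.le
      exact (norm_sub_le _ _).trans (by rw [norm_one]; linarith)) n i
  rw [integral_sub (integrable_const _) (integrable_exp_neg_mul (hφpos i) hs.le)] at hst
  simp only [integral_const, probReal_univ, one_smul] at hst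
  have hL : ∫ τ, Complex.exp (-s * τ) ∂φ i = laplace (φ i) s := rfl
  rw [hL] at hst
  rw [mul_assoc, mul_comm (1 - _), ← hst, ← integral_const_mul,
    ← integral_indicator (hW.measurableSet_state n i)]
  refine integral_congr_ae ?_
  filter_upwards [hW.ae_wait_pos hφpos] with ω hω
  by_cases hi : state n ω = i
  · rw [indicator_of_mem (show ω ∈ {ω | state n ω = i} from hi)]
    have e := setIntegral_Ioi_exp_indicator hs0 (renewalTime_nonneg hω n)
      (strictMono_renewalTime hω n.lt_succ_self)
      (Complex.exp (k * (∑ m ∈ Finset.range n, jump m ω : ℝ) * Complex.I))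
    have e2 : renewalTime wait n.succ ω - renewalTime wait n ω = wait n ω := by
      rw [renewalTime_succ]; ring
    rw [e2] at e
    rw [← e]
    refine integral_congr_ae (Eventually.of_forall fun t => ?_)
    simp only [pieceFun, indicator, mem_ofPred_eq, hi, true_and, mem_Ico, Nat.succ_eq_add_one]
  · rw [indicator_of_notMem (show ω ∉ {ω | state n ω = i} from hi)]
    refine integral_eq_zero_of_ae (Eventually.of_forall fun t => ?_)
    exact indicator_of_notMem (fun hmem => hi hmem.1) _

theorem IsCTRW.aemeasurable_renewalCount (hW : IsCTRW P M p₀ φ lam state wait jump)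
    (hreg : ∀ᵐ ω ∂P, IsRegular wait ω) {t : ℝ} (ht : 0 ≤ t) :
    AEMeasurable (renewalCount wait t) P := by
  refine NullMeasurable.aemeasurable fun A _ => ?_
  rw [← biUnion_preimage_singleton]
  refine NullMeasurableSet.biUnion A.to_countable fun n _ => ?_
  refine NullMeasurableSet.congr (s := {ω | renewalTime wait n ω ≤ t} ∩
    {ω | t < renewalTime wait (n + 1) ω}) ?_ ?_
  · exact ((measurableSet_le (hW.measurable_renewalTime n) measurable_const).inter
      (measurableSet_lt measurable_const (hW.measurable_renewalTime _))).nullMeasurableSet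
  · filter_upwards [hreg] with ω hω
    exact propext ((hω.between_renewals_iff ht n).trans eq_comm)

/-- A quantity of step `n`, evaluated at the current step. -/
theorem aemeasurable_comp_renewalCount {β : Type*} [MeasurableSpace β] {X : ℕ → Ω → β}
    (hX : ∀ n, Measurable (X n)) {t : ℝ} (h : AEMeasurable (renewalCount wait t) P) :
    AEMeasurable (fun ω => X (renewalCount wait t ω) ω) P := by
  have : Measurable fun y : ℕ × Ω => X y.1 y.2 := measurable_from_prod_countable_right hX
  exact this.comp_aemeasurable (h.prodMk aemeasurable_id)

theorem IsCTRW.charFun_stateLaw (hW : IsCTRW P M p₀ φ lam state wait jump)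
    (hreg : ∀ᵐ ω ∂P, IsRegular wait ω) {t : ℝ} (ht : 0 ≤ t) (i : Fin N) (k : ℝ) :
    charFun (stateLaw P state wait jump i t) k =
      ∫ ω, {ω | internalState state wait t ω = i}.indicator
        (fun ω => Complex.exp (k * position wait jump t ω * Complex.I)) ω ∂P := by
  have hc := hW.aemeasurable_renewalCount hreg ht
  have hpos : AEMeasurable (position wait jump t) P :=
    aemeasurable_comp_renewalCount (X := fun n ω => ∑ m ∈ Finset.range n, jump m ω)
      (fun n => Finset.measurable_sum _ fun m _ => hW.measurable_jump m) hc
  have hst : AEMeasurable (internalState state wait t) P :=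
    aemeasurable_comp_renewalCount hW.measurable_state hc
  have hset : NullMeasurableSet {ω | internalState state wait t ω = i} P :=
    hst.nullMeasurable (measurableSet_singleton i)
  rw [charFun_apply_real, stateLaw, integral_map hpos.restrict (by fun_prop),
    ← integral_indicator₀ hset]

/-- The Montroll-Weiss formula before summation: the transform of the state-resolved position is
the sum over the number `n` of renewals. -/
theorem IsCTRW.hasSum_fourierLaplace (hW : IsCTRW P M p₀ φ lam state wait jump)
    [IsProbabilityMeasure P] [∀ i, IsProbabilityMeasure (φ i)]
    [∀ i, IsProbabilityMeasure (lam i)] (hφpos : ∀ i, φ i (Iic 0) = 0)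
    (h0 : ∀ i j, 0 ≤ M i j) (h1 : ∀ i, ∑ j, M i j = 1) (hp : ∀ i, 0 ≤ p₀ i)
    (k : ℝ) {s : ℂ} (hs : 0 < s.re) (i : Fin N) :
    IntegrableOn (fun t : ℝ => Complex.exp (-s * t) *
        charFun (stateLaw P state wait jump i t) k) (Ioi 0) ∧
      HasSum (fun n => s⁻¹ * (1 - laplace (φ i) s) *
        visit M (fun i => laplace (φ i) s * charFun (lam i) k) (fun i => (p₀ i : ℂ)) n i)
        (fourierLaplace (stateLaw P state wait jump i) k s) := by
  have hreg : ∀ᵐ ω ∂P, IsRegular wait ω :=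
    (hW.ae_wait_pos hφpos).and (hW.ae_tendsto_renewalTime hφpos h0 h1 hp)
  set μ : Measure (ℝ × Ω) := (volume.restrict (Ioi (0 : ℝ))).prod P
  set F : ℝ × Ω → ℂ := fun y => Complex.exp (-s * y.1) *
    {ω | internalState state wait y.1 ω = i}.indicator
        (fun ω => Complex.exp (k * position wait jump y.1 ω * Complex.I)) y.2
  set p : ℕ → ℝ × Ω → ℂ := pieceFun state wait jump i k s
  have hμ : ∀ᵐ y ∂μ, 0 < y.1 ∧ IsRegular wait y.2 := by
    have a : ∀ᵐ y ∂μ, y.1 ∈ Ioi (0 : ℝ) :=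
      Measure.quasiMeasurePreserving_fst.ae (ae_restrict_mem measurableSet_Ioi)
    exact a.and (Measure.quasiMeasurePreserving_snd.ae hreg)
  have hexp : IntegrableOn (fun t : ℝ => Real.exp (-s.re * t)) (Ioi 0) :=
    exp_neg_integrableOn_Ioi 0 hs
  have hexp' : Integrable (fun y : ℝ × Ω => Real.exp (-s.re * y.1)) μ :=
    hexp.comp_fst P
  have hnorm : ∀ t : ℝ, ‖Complex.exp (-s * t)‖ = Real.exp (-s.re * t) := fun t => by
    rw [Complex.norm_exp]; simp
  have hphase : ∀ x : ℝ, ‖Complex.exp (k * x * Complex.I)‖ = 1 := fun x => by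
    rw [← Complex.ofReal_mul, Complex.norm_exp_ofReal_mul_I]
  have hpm : ∀ n, AEStronglyMeasurable (p n) μ := fun n =>
    (hW.measurable_pieceFun i k s n).aestronglyMeasurable
  have hFsum : ∀ᵐ y ∂μ, HasSum (fun n => p n y) (F y) := by
    filter_upwards [hμ] with y hy
    exact hy.2.hasSum_pieceFun hy.1.le i k s
  -- The pieces are disjoint in time, which bounds the sum of their moduli.
  let b : ℕ → ℝ × Ω → ℝ := fun n y =>
    if n = renewalCount wait y.1 y.2 then Real.exp (-s.re * y.1) else 0
  have hbound : ∀ᵐ y ∂μ, HasSum (fun n => b n y) (Real.exp (-s.re * y.1)) :=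
    Eventually.of_forall fun y => hasSum_ite_eq _ _
  have hple : ∀ n, ∀ᵐ y ∂μ, ‖p n y‖ ≤ b n y := by
    intro n
    filter_upwards [hμ] with y hy
    simp only [b, p, pieceFun, indicator, mem_ofPred_eq, hy.2.between_renewals_iff hy.1.le n]
    by_cases hn : n = renewalCount wait y.1 y.2
    · rw [if_pos hn]
      split_ifs
      · rw [norm_mul, hnorm, hphase, mul_one]
      · rw [norm_zero]; exact (Real.exp_pos _).le
    · simp [hn]
  have hpi : ∀ n, Integrable (p n) μ := fun n => by
    refine hexp'.mono' (hpm n) ?_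
    filter_upwards [hple n] with y hy
    refine hy.trans ?_
    simp only [b]
    split_ifs
    · exact le_rfl
    · exact (Real.exp_pos _).le
  have hFm : AEStronglyMeasurable F μ :=
    aestronglyMeasurable_of_tendsto_ae atTop
      (fun n => Finset.aestronglyMeasurable_fun_sum (Finset.range n) fun m _ => hpm m)
      (hFsum.mono fun y hy => hy.tendsto_sum_nat)
  have hFi : Integrable F μ := by
    refine hexp'.mono' hFm (Eventually.of_forall fun y => ?_)
    simp only [F, norm_mul, hnorm]
    refine mul_le_of_le_one_right (Real.exp_pos _).le ?_
    refine (norm_indicator_le_norm_self _ _).trans ?_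
    rw [hphase]
  have hbi : Integrable (fun y => ∑' n, b n y) μ :=
    hexp'.congr (hbound.mono fun y hy => hy.tsum_eq.symm)
  have hS := hasSum_integral_of_dominated_convergence b hpm hple
    (hbound.mono fun y hy => hy.summable) hbi hFsum
  have heq : ∀ t ∈ Ioi (0 : ℝ), ∫ ω, F (t, ω) ∂P = Complex.exp (-s * t) *
      charFun (stateLaw P state wait jump i t) k := by
    intro t ht
    rw [hW.charFun_stateLaw hreg (le_of_lt ht), ← integral_const_mul]
  refine ⟨?_, ?_⟩
  · refine hFi.integral_prod_left.congr ?_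
    filter_upwards [ae_restrict_mem measurableSet_Ioi] with t ht using heq t ht
  · rw [integral_prod _ hFi] at hS
    have e : ∫ t in Ioi (0 : ℝ), ∫ ω, F (t, ω) ∂P =
        fourierLaplace (stateLaw P state wait jump i) k s :=
      setIntegral_congr_fun measurableSet_Ioi heq
    rw [e] at hS
    have e' : (fun n => ∫ y, p n y ∂μ) = _ :=
      funext fun n => hW.integral_pieceFun hφpos h0 hp k hs n i (hpi n)
    rwa [e'] at hS

/-- A waiting time law and a jump law contribute a factor of modulus less than one per step. -/
theorem norm_laplace_mul_charFun_lt_one {φ lam : Measure ℝ} [IsProbabilityMeasure φ]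
    [IsProbabilityMeasure lam] (hφ : φ (Iic 0) = 0) {s : ℂ} (hs : 0 < s.re) (k : ℝ) :
    ‖laplace φ s * charFun lam k‖ < 1 := by
  rw [norm_mul]
  exact (mul_le_of_le_one_right (norm_nonneg _) (norm_charFun_le_one k)).trans_lt
    (norm_laplace_lt_one hφ hs)

open Matrix in
theorem walkMatrix_mulVec (M : Matrix (Fin N) (Fin N) ℝ) (Φ Λ v : Fin N → ℂ) (i : Fin N) :
    (walkMatrix M Φ Λ *ᵥ v) i = v i - ∑ j, (M j i : ℂ) * (Φ j * Λ j * v j) := by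
  rw [walkMatrix, mul_assoc, diagonal_mul_diagonal, sub_mulVec, one_mulVec, ← mulVec_mulVec]
  simp [mulVec, dotProduct, complexMatrix, mul_assoc]

theorem isUnit_walkMatrix (h0 : ∀ i j, 0 ≤ M i j) (h1 : ∀ i, ∑ j, M i j = 1) {Φ Λ : Fin N → ℂ}
    (h : ∀ i, ‖Φ i * Λ i‖ < 1) : IsUnit (walkMatrix M Φ Λ) := by
  have := isUnit_one_sub_transpose_mul_diagonal (𝕜 := ℂ) h0 h1 h
  rwa [← Matrix.diagonal_mul_diagonal, ← mul_assoc] at this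

open Matrix in
/-- A solution of the linear system determines `walkDensity`. -/
theorem walkDensity_apply {Φ Λ v : Fin N → ℂ} (hu : IsUnit (walkMatrix M Φ Λ))
    (hv : ∀ i, v i = p₀ i + ∑ j, (M j i : ℂ) * (Φ j * Λ j * v j)) (s : ℂ) (i : Fin N) :
    walkDensity M p₀ Φ Λ s i = s⁻¹ * (1 - Φ i) * v i := by
  have e : walkMatrix M Φ Λ *ᵥ v = fun i => (p₀ i : ℂ) := by
    ext i
    rw [walkMatrix_mulVec]
    nth_rewrite 1 [hv i]
    ring
  rw [walkDensity, ← e, ← mulVec_mulVec, mulVec_mulVec _ _ (walkMatrix M Φ Λ),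
    nonsing_inv_mul _ ((isUnit_iff_isUnit_det _).1 hu), one_mulVec, sub_mulVec, one_mulVec]
  simp only [Pi.smul_apply, Pi.sub_apply, mulVec_diagonal, smul_eq_mul]
  ring

/-- The Montroll-Weiss formula: the series over the number of renewals is a Neumann series, and
its sum solves the linear system because shifting the series by one step applies `Mᵀ Φ Λ`. -/
theorem IsCTRW.fourierLaplace_eq (hW : IsCTRW P M p₀ φ lam state wait jump)
    [IsProbabilityMeasure P] [∀ i, IsProbabilityMeasure (φ i)]
    [∀ i, IsProbabilityMeasure (lam i)] (hφpos : ∀ i, φ i (Iic 0) = 0)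
    (h0 : ∀ i j, 0 ≤ M i j) (h1 : ∀ i, ∑ j, M i j = 1) (hp : ∀ i, 0 ≤ p₀ i)
    (k : ℝ) {s : ℂ} (hs : 0 < s.re) (i : Fin N) :
    fourierLaplace (stateLaw P state wait jump i) k s =
      walkDensity M p₀ (fun i => laplace (φ i) s) (fun i => charFun (lam i) k) s i := by
  have hs0 : s ≠ 0 := fun h => by simp [h] at hs
  set z : Fin N → ℂ := fun i => laplace (φ i) s * charFun (lam i) k
  have hc : ∀ i, s⁻¹ * (1 - laplace (φ i) s) ≠ 0 := fun i => by
    refine mul_ne_zero (inv_ne_zero hs0) (sub_ne_zero.2 fun h => ?_)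
    have := norm_laplace_lt_one (hφpos i) hs
    rw [← h, norm_one] at this
    exact lt_irrefl _ this
  have hS := fun i => (hW.hasSum_fourierLaplace hφpos h0 h1 hp k hs i).2
  have hV : ∀ i, HasSum (fun n => visit M z (fun i => (p₀ i : ℂ)) n i)
      ((s⁻¹ * (1 - laplace (φ i) s))⁻¹ * fourierLaplace (stateLaw P state wait jump i) k s) :=
    fun i => by
      have := (hS i).mul_left (s⁻¹ * (1 - laplace (φ i) s))⁻¹
      simpa only [inv_mul_cancel_left₀ (hc i)] using this
  set v : Fin N → ℂ := fun i =>
    (s⁻¹ * (1 - laplace (φ i) s))⁻¹ * fourierLaplace (stateLaw P state wait jump i) k s with hv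
  have hfix : ∀ i, v i = p₀ i + ∑ j, (M j i : ℂ) * (laplace (φ j) s * charFun (lam j) k * v j) := by
    intro i
    refine (hV i).unique ((hasSum_nat_add_iff' 1).1 ?_)
    simp only [Finset.range_one, Finset.sum_singleton, visit, add_sub_cancel_left]
    exact hasSum_sum fun j _ => ((hV j).mul_left _).mul_left _
  rw [walkDensity_apply (isUnit_walkMatrix h0 h1 fun i =>
    norm_laplace_mul_charFun_lt_one (hφpos i) hs k) hfix s i, hv]
  exact (mul_inv_cancel_left₀ (hc i) _).symm

end MultiStateCTRW

/-! ### The long-time, large-scale regime -/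

namespace MultiStateCTRW

section Asymptotic

open Asymptotics

variable {N : ℕ} {M : Matrix (Fin N) (Fin N) ℝ} {p₀ : Fin N → ℝ}

theorem leadingMatrix_eq_walkMatrix (M : Matrix (Fin N) (Fin N) ℝ) (α B : Fin N → ℝ) (σ k : ℝ)
    (s : ℂ) : leadingMatrix M α B σ k s =
      walkMatrix M (fun i => 1 - powerLaw α B s i - ((σ ^ 2 * k ^ 2 : ℝ) : ℂ)) fun _ => 1 := by
  rw [leadingMatrix, walkMatrix, mul_assoc, Matrix.diagonal_mul_diagonal]
  congr 2
  ext i j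
  by_cases h : i = j
  · subst h; simp
  · simp [h]

open Matrix in
/-- A solution of the linear system determines `leadingDensity`. -/
theorem leadingDensity_apply {α B : Fin N → ℝ} {σ k : ℝ} {s : ℂ}
    (hu : IsUnit (leadingMatrix M α B σ k s)) {v : Fin N → ℂ}
    (hv : leadingMatrix M α B σ k s *ᵥ v = fun i => (p₀ i : ℂ)) (i : Fin N) :
    leadingDensity M p₀ α B σ k s i = s⁻¹ * powerLaw α B s i * v i := by
  rw [leadingDensity, ← hv, mulVec_mulVec, mul_assoc,
    nonsing_inv_mul _ ((isUnit_iff_isUnit_det _).1 hu), mul_one, Pi.smul_apply,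
    mulVec_diagonal, smul_eq_mul, mul_assoc]

/-- For real rates the complex system has the real `solution`. -/
theorem ofReal_solution (h0 : ∀ i j, 0 ≤ M i j) (h1 : ∀ i, ∑ j, M i j = 1) {Φ Λ : Fin N → ℂ}
    {d : Fin N → ℝ} (hd0 : ∀ i, 0 ≤ d i) (hd1 : ∀ i, d i < 1) (hd : ∀ i, Φ i * Λ i = d i) :
    IsUnit (walkMatrix M Φ Λ) ∧ ∀ i, (solution M p₀ d i : ℂ) =
      p₀ i + ∑ j, (M j i : ℂ) * (Φ j * Λ j * (solution M p₀ d j : ℂ)) := by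
  refine ⟨isUnit_walkMatrix h0 h1 fun i => ?_, fun i => ?_⟩
  · rw [hd, Complex.norm_real, Real.norm_of_nonneg (hd0 i)]
    exact hd1 i
  · conv_lhs => rw [solution_eq_add_sum h0 h1 hd0 hd1]
    simp only [hd]
    push_cast
    rfl

theorem powerLaw_ofReal (α B : Fin N → ℝ) {s : ℝ} (hs : 0 ≤ s) (i : Fin N) :
    powerLaw α B s i = ((B i * s ^ α i : ℝ) : ℂ) := by
  rw [powerLaw, Complex.ofReal_mul, Complex.ofReal_cpow hs]

theorem laplace_ofReal (φ : Measure ℝ) (s : ℝ) :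
    laplace φ s = ((∫ τ, Real.exp (-s * τ) ∂φ : ℝ) : ℂ) := by
  rw [laplace, ← integral_complex_ofReal]
  simp

theorem charFun_gaussianReal_eq (σ k : ℝ) :
    charFun (gaussianReal 0 (2 * σ ^ 2).toNNReal) k = ((Real.exp (-(σ ^ 2 * k ^ 2)) : ℝ) : ℂ) := by
  rw [charFun_gaussianReal, Real.coe_toNNReal _ (by positivity)]
  push_cast
  congr 1
  ring

/-- The rates `1 - (1 - a) (1 - e)` and `ψ + c` are equivalent when `a ~ ψ` and `e ~ c`. -/
theorem isEquivalent_killing {ι : Type*} {l : Filter ι} {a e ψ c : ι → ℝ}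
    (hψ : ∀ᶠ q in l, 0 ≤ ψ q) (hc : ∀ᶠ q in l, 0 ≤ c q) (haψ : IsEquivalent l a ψ)
    (hec : IsEquivalent l e c) (ha : Tendsto a l (𝓝 0)) :
    IsEquivalent l (fun q => 1 - (1 - a q) * (1 - e q)) (fun q => ψ q + c q) := by
  refine isLittleO_iff.2 fun δ hδ => ?_
  have hη : 0 < min (δ / 3) 1 := by positivity
  have h4 : ∀ᶠ q in l, |a q| < min (δ / 3) 1 := by
    have := ha.abs
    rw [abs_zero] at this
    exact this.eventually_lt_const hη
  filter_upwards [hψ, hc, isLittleO_iff.1 haψ.isLittleO hη, isLittleO_iff.1 hec.isLittleO hη, h4]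
    with q b1 b2 b3 b4 b5
  simp only [Pi.sub_apply, Real.norm_eq_abs, abs_of_nonneg b1, abs_of_nonneg b2,
    abs_of_nonneg (add_nonneg b1 b2)] at b3 b4 ⊢
  have hη1 : min (δ / 3) 1 ≤ 1 := min_le_right _ _
  have hη2 : min (δ / 3) 1 ≤ δ / 3 := min_le_left _ _
  set η := min (δ / 3) 1
  have he : |e q| ≤ 2 * c q := by
    have : |e q| ≤ |e q - c q| + |c q| := by
      simpa using abs_add_le (e q - c q) (c q)
    rw [abs_of_nonneg b2] at this
    nlinarith
  have hae : |a q * e q| ≤ η * (2 * c q) := by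
    rw [abs_mul]
    exact mul_le_mul b5.le he (abs_nonneg _) hη.le
  have e1 : 1 - (1 - a q) * (1 - e q) - (ψ q + c q) =
      (a q - ψ q) + (e q - c q) - a q * e q := by ring
  rw [e1]
  have : |(a q - ψ q) + (e q - c q) - a q * e q| ≤ η * ψ q + η * c q + η * (2 * c q) :=
    (abs_sub _ _).trans (add_le_add ((abs_add_le _ _).trans (add_le_add b3 b4)) hae)
  nlinarith

theorem isEquivalent_one_sub_exp_neg {ι : Type*} {l : Filter ι} {c : ι → ℝ}
    (hc : Tendsto c l (𝓝 0)) : IsEquivalent l (fun q => 1 - Real.exp (-c q)) c := by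
  refine isLittleO_iff.2 fun δ hδ => ?_
  have h : ∀ᶠ q in l, |c q| < min δ 1 := by
    have := hc.abs
    rw [abs_zero] at this
    exact this.eventually_lt_const (by positivity)
  filter_upwards [h] with q hq
  have := Real.abs_exp_sub_one_sub_id_le (x := -c q)
    (by rw [abs_neg]; exact hq.le.trans (min_le_right _ _))
  rw [Pi.sub_apply, Real.norm_eq_abs, Real.norm_eq_abs, abs_sub_comm,
    show c q - (1 - Real.exp (-c q)) = Real.exp (-c q) - 1 - -c q by ring]
  refine this.trans ?_
  rw [neg_sq, ← sq_abs, sq]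
  exact mul_le_mul_of_nonneg_right (hq.le.trans (min_le_left _ _)) (abs_nonneg _)

theorem isEquivalent_ofReal {ι : Type*} {l : Filter ι} {u v : ι → ℝ} :
    IsEquivalent l (fun q => (u q : ℂ)) (fun q => (v q : ℂ)) ↔ IsEquivalent l u v := by
  simp only [IsEquivalent, isLittleO_iff, Pi.sub_apply, ← Complex.ofReal_sub, Complex.norm_real]

theorem tendsto_mul_rpow_nhdsGT_zero {a b : ℝ} (ha : 0 < a) :
    Tendsto (fun s : ℝ => b * s ^ a) (𝓝[>] 0) (𝓝 0) := by
  have : Tendsto (fun s : ℝ => b * s ^ a) (𝓝 0) (𝓝 (b * 0 ^ a)) :=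
    ((Real.continuousAt_rpow_const 0 a (Or.inr ha.le)).tendsto).const_mul b
  rw [Real.zero_rpow ha.ne', mul_zero] at this
  exact this.mono_left nhdsWithin_le_nhds

variable {α B : Fin N → ℝ} {σ : ℝ}

theorem eventually_pos_of_prod : ∀ᶠ q : ℝ × ℝ in 𝓝[>] 0 ×ˢ 𝓝 0, 0 < q.1 :=
  tendsto_fst.eventually self_mem_nhdsWithin

theorem tendsto_sq_mul_sq (σ : ℝ) :
    Tendsto (fun q : ℝ × ℝ => σ ^ 2 * q.2 ^ 2) (𝓝[>] 0 ×ˢ 𝓝 0) (𝓝 0) := by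
  have : Tendsto (fun k : ℝ => σ ^ 2 * k ^ 2) (𝓝 0) (𝓝 (σ ^ 2 * 0 ^ 2)) :=
    (Continuous.tendsto (by fun_prop) 0)
  rw [zero_pow two_ne_zero, mul_zero] at this
  exact this.comp tendsto_snd

/-- Near the origin, the rates `1 - (1 - Bᵢ s ^ αᵢ) (1 - σ² k²)` and `Bᵢ s ^ αᵢ + σ² k²` lie in
the interval `(0, 1)`. -/
theorem eventually_rates (hα : ∀ i, 0 < α i ∧ α i < 1) (hB : ∀ i, 0 < B i) (σ : ℝ) :
    ∀ᶠ q : ℝ × ℝ in 𝓝[>] 0 ×ˢ 𝓝 0, 0 < q.1 ∧ 0 ≤ σ ^ 2 * q.2 ^ 2 ∧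
      σ ^ 2 * q.2 ^ 2 < 1 / 2 ∧ ∀ i, 0 < B i * q.1 ^ α i ∧ B i * q.1 ^ α i < 1 / 2 := by
  have h3 : ∀ᶠ q : ℝ × ℝ in 𝓝[>] 0 ×ˢ 𝓝 0, ∀ i, B i * q.1 ^ α i < 1 / 2 :=
    eventually_all.2 fun i => ((tendsto_mul_rpow_nhdsGT_zero (hα i).1).comp
      tendsto_fst).eventually_lt_const (by norm_num)
  filter_upwards [eventually_pos_of_prod, (tendsto_sq_mul_sq σ).eventually_lt_const
    (show (0 : ℝ) < 1 / 2 by norm_num), h3] with q b1 b2 b3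
  exact ⟨b1, by positivity, b2, fun i => ⟨mul_pos (hB i) (Real.rpow_pos_of_pos b1 _), b3 i⟩⟩

theorem walkDensity_powerLaw_eq (h0 : ∀ i j, 0 ≤ M i j) (h1 : ∀ i, ∑ j, M i j = 1) {s c : ℝ}
    (hs : 0 < s) (hc : 0 ≤ c) (hc1 : c < 1 / 2)
    (hψ : ∀ i, 0 < B i * s ^ α i ∧ B i * s ^ α i < 1 / 2) :
    IsUnit (walkMatrix M (fun i => 1 - powerLaw α B s i) (fun _ => ((1 - c : ℝ) : ℂ))) ∧
    ∀ i, walkDensity M p₀ (fun i => 1 - powerLaw α B s i) (fun _ => ((1 - c : ℝ) : ℂ)) s i =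
      (s : ℂ)⁻¹ * powerLaw α B s i *
        (solution M p₀ (fun i => 1 - (1 - (1 - B i * s ^ α i) * (1 - c))) i : ℂ) := by
  obtain ⟨hu, hv⟩ := ofReal_solution (p₀ := p₀) h0 h1 (Φ := fun i => 1 - powerLaw α B s i)
    (Λ := fun _ => ((1 - c : ℝ) : ℂ))
    (d := fun i => 1 - (1 - (1 - B i * s ^ α i) * (1 - c)))
    (fun i => by
      have := hψ i
      rw [sub_sub_cancel]
      exact mul_nonneg (by linarith) (by linarith))
    (fun i => by
      have := hψ i
      nlinarith)
    (fun i => by rw [powerLaw_ofReal _ _ hs.le]; push_cast; ring)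
  refine ⟨hu, fun i => ?_⟩
  rw [walkDensity_apply hu hv, sub_sub_cancel]

theorem leadingDensity_eq (h0 : ∀ i j, 0 ≤ M i j) (h1 : ∀ i, ∑ j, M i j = 1) {s k : ℝ}
    (hs : 0 < s) (hc : 0 ≤ σ ^ 2 * k ^ 2) (hc1 : σ ^ 2 * k ^ 2 < 1 / 2)
    (hψ : ∀ i, 0 < B i * s ^ α i ∧ B i * s ^ α i < 1 / 2) :
    IsUnit (leadingMatrix M α B σ k s) ∧
    ∀ i, leadingDensity M p₀ α B σ k s i = (s : ℂ)⁻¹ * powerLaw α B s i *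
        (solution M p₀ (fun i => 1 - (B i * s ^ α i + σ ^ 2 * k ^ 2)) i : ℂ) := by
  obtain ⟨hu, hv⟩ := ofReal_solution (p₀ := p₀) h0 h1
    (Φ := fun i => 1 - powerLaw α B s i - ((σ ^ 2 * k ^ 2 : ℝ) : ℂ)) (Λ := fun _ => 1)
    (d := fun i => 1 - (B i * s ^ α i + σ ^ 2 * k ^ 2))
    (fun i => by linarith [hψ i]) (fun i => by linarith [hψ i])
    (fun i => by rw [powerLaw_ofReal _ _ hs.le]; push_cast; ring)
  have hu' := hu
  rw [← leadingMatrix_eq_walkMatrix] at hu'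
  refine ⟨hu', fun i => leadingDensity_apply hu'
    (v := fun i => (solution M p₀ (fun i => 1 - (B i * s ^ α i + σ ^ 2 * k ^ 2)) i : ℂ))
    (funext fun i => ?_) i⟩
  rw [leadingMatrix_eq_walkMatrix, walkMatrix_mulVec, sub_eq_iff_eq_add]
  exact hv i

/-- The exact density for real `s`, with its rate `1 - L exp(-c)` written in terms of the small
quantities `1 - L` and `1 - exp(-c)`, as in `isEquivalent_killing`. -/
theorem walkDensity_laplace_eq (h0 : ∀ i j, 0 ≤ M i j) (h1 : ∀ i, ∑ j, M i j = 1)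
    {φ : Fin N → Measure ℝ} [∀ i, IsProbabilityMeasure (φ i)] (hφpos : ∀ i, φ i (Iic 0) = 0)
    {s c : ℝ} (hs : 0 < s) (hc : 0 ≤ c) {Λ : Fin N → ℂ}
    (hΛ : ∀ i, Λ i = ((Real.exp (-c) : ℝ) : ℂ)) (i : Fin N) :
    (∀ i, 0 < 1 - ∫ τ, Real.exp (-s * τ) ∂φ i) ∧
    walkDensity M p₀ (fun i => laplace (φ i) s) Λ s i = (s : ℂ)⁻¹ * (1 - laplace (φ i) s) *
      (solution M p₀ (fun i => 1 - (1 - (1 - (1 - ∫ τ, Real.exp (-s * τ) ∂φ i)) *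
        (1 - (1 - Real.exp (-c))))) i : ℂ) := by
  have hL0 : ∀ i, 0 ≤ ∫ τ, Real.exp (-s * τ) ∂φ i := fun i =>
    integral_nonneg fun τ => (Real.exp_pos _).le
  have hL1 : ∀ i, ∫ τ, Real.exp (-s * τ) ∂φ i < 1 := fun i => by
    have := norm_laplace_lt_one (hφpos i) (s := s) (by simpa using hs)
    rwa [laplace_ofReal, Complex.norm_real, Real.norm_of_nonneg (hL0 i)] at this
  refine ⟨fun i => sub_pos.2 (hL1 i), ?_⟩
  have hexp : Real.exp (-c) ≤ 1 := Real.exp_le_one_iff.2 (by linarith)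
  obtain ⟨hu, hv⟩ := ofReal_solution (p₀ := p₀) h0 h1 (Φ := fun i => laplace (φ i) s) (Λ := Λ)
    (d := fun i => 1 - (1 - (1 - (1 - ∫ τ, Real.exp (-s * τ) ∂φ i)) *
        (1 - (1 - Real.exp (-c)))))
    (fun i => by
      simp only [sub_sub_cancel]
      exact mul_nonneg (hL0 i) (Real.exp_pos _).le)
    (fun i => by
      simp only [sub_sub_cancel]
      exact (mul_le_of_le_one_right (hL0 i) hexp).trans_lt (hL1 i))
    (fun i => by rw [laplace_ofReal, hΛ]; push_cast; ring)
  rw [walkDensity_apply hu hv]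

variable {Ω : Type*} [MeasurableSpace Ω] {P : Measure Ω}
  {φ lam : Fin N → Measure ℝ} {state : ℕ → Ω → Fin N} {wait jump : ℕ → Ω → ℝ}

/-- The rates `1 - Φᵢ(s) Λ(k)`, `1 - (1 - Bᵢ s ^ αᵢ) (1 - σ² k²)` and `Bᵢ s ^ αᵢ + σ² k²` are
equivalent, so the solutions of the three linear systems are. -/
theorem IsCTRW.isEquivalent_densities (hW : IsCTRW P M p₀ φ lam state wait jump)
    [IsProbabilityMeasure P] [∀ i, IsProbabilityMeasure (φ i)]
    [∀ i, IsProbabilityMeasure (lam i)] (hφpos : ∀ i, φ i (Iic 0) = 0)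
    (h0 : ∀ i j, 0 ≤ M i j) (h1 : ∀ i, ∑ j, M i j = 1) (hp : ∀ i, 0 ≤ p₀ i)
    (hα : ∀ i, 0 < α i ∧ α i < 1) (hB : ∀ i, 0 < B i)
    (hlam : ∀ i, lam i = gaussianReal 0 (2 * σ ^ 2).toNNReal)
    (hφ : ∀ i, IsEquivalent (𝓝[>] (0 : ℝ)) (fun s : ℝ => 1 - laplace (φ i) s)
        (fun s : ℝ => powerLaw α B s i)) (i : Fin N) :
    IsEquivalent (𝓝[>] (0 : ℝ) ×ˢ 𝓝 (0 : ℝ))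
      (fun q : ℝ × ℝ => fourierLaplace (stateLaw P state wait jump i) q.2 q.1)
      (fun q : ℝ × ℝ => walkDensity M p₀ (fun j => 1 - powerLaw α B q.1 j)
            (fun _ => ((1 - σ ^ 2 * q.2 ^ 2 : ℝ) : ℂ)) q.1 i) ∧
    IsEquivalent (𝓝[>] (0 : ℝ) ×ˢ 𝓝 (0 : ℝ))
      (fun q : ℝ × ℝ => fourierLaplace (stateLaw P state wait jump i) q.2 q.1)
      (fun q : ℝ × ℝ => leadingDensity M p₀ α B σ q.2 q.1 i) := by
  set l : Filter (ℝ × ℝ) := 𝓝[>] (0 : ℝ) ×ˢ 𝓝 (0 : ℝ) with hl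
  set L : Fin N → ℝ → ℝ := fun i s => ∫ τ, Real.exp (-s * τ) ∂φ i with hLdef
  have hrates := eventually_rates hα hB σ
  rw [← hl] at hrates
  have hψ0 : ∀ i, Tendsto (fun q : ℝ × ℝ => B i * q.1 ^ α i) l (𝓝 0) := fun i =>
    (tendsto_mul_rpow_nhdsGT_zero (hα i).1).comp tendsto_fst
  have hc0 : Tendsto (fun q : ℝ × ℝ => σ ^ 2 * q.2 ^ 2) l (𝓝 0) := tendsto_sq_mul_sq σ
  have hψ : ∀ i, ∀ᶠ q : ℝ × ℝ in l, 0 ≤ B i * q.1 ^ α i := fun i =>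
    hrates.mono fun q hq => (hq.2.2.2 i).1.le
  have hc : ∀ᶠ q : ℝ × ℝ in l, 0 ≤ σ ^ 2 * q.2 ^ 2 := hrates.mono fun q hq => hq.2.1
  have hLC : ∀ i, IsEquivalent l (fun q : ℝ × ℝ => 1 - laplace (φ i) q.1)
      (fun q => powerLaw α B q.1 i) := fun i => (hφ i).comp_tendsto tendsto_fst
  have hLψ : ∀ i, IsEquivalent l (fun q : ℝ × ℝ => 1 - L i q.1)
      (fun q => B i * q.1 ^ α i) := fun i => by
    rw [← isEquivalent_ofReal]
    refine ((hLC i).congr_left (Eventually.of_forall fun q => ?_)).congr_right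
      (hrates.mono fun q hq => ?_)
    · dsimp only
      rw [laplace_ofReal]; push_cast; rfl
    · exact powerLaw_ofReal α B hq.1.le i
  have hL0 : ∀ i, Tendsto (fun q : ℝ × ℝ => 1 - L i q.1) l (𝓝 0) := fun i =>
    (hLψ i).symm.tendsto_nhds (hψ0 i)
  have hexp := isEquivalent_one_sub_exp_neg hc0
  have hsum0 : ∀ i, Tendsto (fun q : ℝ × ℝ => B i * q.1 ^ α i + σ ^ 2 * q.2 ^ 2) l (𝓝 0) :=
    fun i => by simpa using (hψ0 i).add hc0
  have hsumpos : ∀ i, ∀ᶠ q : ℝ × ℝ in l, 0 < B i * q.1 ^ α i + σ ^ 2 * q.2 ^ 2 := fun i =>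
    hrates.mono fun q hq => by linarith [hq.2.1, (hq.2.2.2 i).1]
  have key1 := fun i => isEquivalent_killing (hψ i) hc (hLψ i) hexp (hL0 i)
  have key2 := fun i => isEquivalent_killing (hψ i) hc IsEquivalent.refl
    (IsEquivalent.refl (u := fun q : ℝ × ℝ => σ ^ 2 * q.2 ^ 2)) (hψ0 i)
  have hpos1 : ∀ i, ∀ᶠ q : ℝ × ℝ in l,
      0 < 1 - (1 - (1 - L i q.1)) * (1 - (1 - Real.exp (-(σ ^ 2 * q.2 ^ 2)))) := fun i => by
    filter_upwards [hrates] with q hq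
    have := (walkDensity_laplace_eq (p₀ := p₀) h0 h1 hφpos hq.1 hq.2.1
      (Λ := fun _ => ((Real.exp (-(σ ^ 2 * q.2 ^ 2)) : ℝ) : ℂ)) (fun _ => rfl) i).1 i
    have h2 : Real.exp (-(σ ^ 2 * q.2 ^ 2)) ≤ 1 := Real.exp_le_one_iff.2 (by linarith [hq.2.1])
    have h3 : 0 ≤ L i q.1 := integral_nonneg fun τ => (Real.exp_pos _).le
    simp only [sub_sub_cancel]
    have := mul_le_of_le_one_right h3 h2
    simp only [hLdef] at this ⊢
    linarith
  have hpos2 : ∀ i, ∀ᶠ q : ℝ × ℝ in l,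
      0 < 1 - (1 - B i * q.1 ^ α i) * (1 - σ ^ 2 * q.2 ^ 2) := fun i => by
    filter_upwards [hrates] with q hq
    have := hq.2.2.2 i
    nlinarith [hq.2.1, hq.2.2.1]
  have s1 := solution_isEquivalent h0 h1 hp hpos1 hsumpos
    (fun i => (key1 i).symm.tendsto_nhds (hsum0 i)) hsum0 key1 i
  have s2 := solution_isEquivalent h0 h1 hp hpos2 hsumpos
    (fun i => (key2 i).symm.tendsto_nhds (hsum0 i)) hsum0 key2 i
  have hinv : IsEquivalent l (fun q : ℝ × ℝ => ((q.1 : ℂ))⁻¹) (fun q => ((q.1 : ℂ))⁻¹) :=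
    IsEquivalent.refl
  have hG : (fun q : ℝ × ℝ => fourierLaplace (stateLaw P state wait jump i) q.2 q.1) =ᶠ[l]
      fun q => (q.1 : ℂ)⁻¹ * (1 - laplace (φ i) q.1) *
      (solution M p₀ (fun i => 1 - (1 - (1 - (1 - L i q.1)) *
        (1 - (1 - Real.exp (-(σ ^ 2 * q.2 ^ 2)))))) i : ℂ) := by
    filter_upwards [hrates] with q hq
    rw [hW.fourierLaplace_eq hφpos h0 h1 hp q.2 (s := q.1) (by simpa using hq.1) i]
    exact (walkDensity_laplace_eq h0 h1 hφpos hq.1 hq.2.1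
      (fun i => by rw [hlam i, charFun_gaussianReal_eq]) i).2
  have hD : (fun q : ℝ × ℝ => leadingDensity M p₀ α B σ q.2 q.1 i) =ᶠ[l]
      fun q => (q.1 : ℂ)⁻¹ * powerLaw α B q.1 i *
        (solution M p₀ (fun i => 1 - (B i * q.1 ^ α i + σ ^ 2 * q.2 ^ 2)) i : ℂ) := by
    filter_upwards [hrates] with q hq
    exact (leadingDensity_eq h0 h1 hq.1 hq.2.1 hq.2.2.1 hq.2.2.2).2 i
  have hD' : (fun q : ℝ × ℝ => walkDensity M p₀ (fun j => 1 - powerLaw α B q.1 j)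
            (fun _ => ((1 - σ ^ 2 * q.2 ^ 2 : ℝ) : ℂ)) q.1 i) =ᶠ[l]
      fun q => (q.1 : ℂ)⁻¹ * powerLaw α B q.1 i * (solution M p₀
        (fun i => 1 - (1 - (1 - B i * q.1 ^ α i) * (1 - σ ^ 2 * q.2 ^ 2))) i : ℂ) := by
    filter_upwards [hrates] with q hq
    exact (walkDensity_powerLaw_eq h0 h1 hq.1 hq.2.1 hq.2.2.1 hq.2.2.2).2 i
  have e1 := (hinv.mul (hLC i)).mul (isEquivalent_ofReal.2 s1)
  have e2 := (hinv.mul (IsEquivalent.refl (u := fun q : ℝ × ℝ => powerLaw α B q.1 i))).mul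
    (isEquivalent_ofReal.2 s2)
  have f1 := (e1.congr_left hG.symm).congr_right hD.symm
  have f2 := (e2.congr_left hD'.symm).congr_right hD.symm
  exact ⟨f1.trans f2.symm, f1⟩

end Asymptotic

end MultiStateCTRW

/-! ### Families of signed measures -/

namespace MultiStateCTRW

/-- The integral of a complex function against a signed measure. -/
noncomputable def pairing (ν : SignedMeasure ℝ) (f : ℝ → ℂ) : ℂ :=
  ∫ x, f x ∂ν.toJordanDecomposition.posPart - ∫ x, f x ∂ν.toJordanDecomposition.negPart

/-- The character `x ↦ exp(i k x)`. -/
noncomputable def wave (k x : ℝ) : ℂ := Complex.exp (k * x * Complex.I)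

theorem norm_wave (k x : ℝ) : ‖wave k x‖ = 1 := by
  rw [wave, ← Complex.ofReal_mul, Complex.norm_exp_ofReal_mul_I]

theorem measurable_wave (k : ℝ) : Measurable (wave k) := by
  unfold wave
  fun_prop

theorem signedCharFun_eq (ν : SignedMeasure ℝ) (k : ℝ) :
    signedCharFun ν k = pairing ν (wave k) := by
  simp only [signedCharFun, pairing, charFun_apply_real, wave]

theorem ofReal_signedIntegral (ν : SignedMeasure ℝ) (ψ : ℝ → ℝ) :
    (signedIntegral ν ψ : ℂ) = pairing ν fun x => (ψ x : ℂ) := by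
  rw [signedIntegral, pairing, Complex.ofReal_sub, ← integral_complex_ofReal,
    ← integral_complex_ofReal]

section Pairing

variable (ν : SignedMeasure ℝ) {f g : ℝ → ℂ} {C : ℝ}

theorem integrable_of_bound {μ : Measure ℝ} [IsFiniteMeasure μ] (hf : Measurable f)
    (hC : ∀ x, ‖f x‖ ≤ C) : Integrable f μ :=
  Integrable.of_bound hf.aestronglyMeasurable C (Eventually.of_forall hC)

theorem norm_pairing_le (hC : ∀ x, ‖f x‖ ≤ C) :
    ‖pairing ν f‖ ≤ C * ν.totalVariation.real univ := by
  have e : ν.totalVariation.real univ = ν.toJordanDecomposition.posPart.real univ +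
      ν.toJordanDecomposition.negPart.real univ := by
    rw [SignedMeasure.totalVariation, measureReal_add_apply]
  rw [e, mul_add]
  exact (norm_sub_le _ _).trans (add_le_add
    (norm_integral_le_of_norm_le_const (Eventually.of_forall hC))
    (norm_integral_le_of_norm_le_const (Eventually.of_forall hC)))

theorem pairing_add (hf : Measurable f) (hC : ∀ x, ‖f x‖ ≤ C) (hg : Measurable g) {C' : ℝ}
    (hC' : ∀ x, ‖g x‖ ≤ C') : pairing ν (fun x => f x + g x) = pairing ν f + pairing ν g := by
  simp only [pairing]
  rw [integral_add (integrable_of_bound hf hC) (integrable_of_bound hg hC'),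
    integral_add (integrable_of_bound hf hC) (integrable_of_bound hg hC')]
  ring

theorem pairing_const_mul (c : ℂ) (f : ℝ → ℂ) :
    pairing ν (fun x => c * f x) = c * pairing ν f := by
  simp only [pairing, integral_const_mul, mul_sub]

theorem tendsto_pairing {F : ℕ → ℝ → ℂ} (hF : ∀ n, Measurable (F n))
    (hC : ∀ n x, ‖F n x‖ ≤ C) (hlim : ∀ x, Tendsto (fun n => F n x) atTop (𝓝 (f x))) :
    Tendsto (fun n => pairing ν (F n)) atTop (𝓝 (pairing ν f)) := by
  refine Tendsto.sub ?_ ?_ <;>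
  exact tendsto_integral_of_dominated_convergence (fun _ => C)
    (fun n => (hF n).aestronglyMeasurable) (integrable_const C)
    (fun n => Eventually.of_forall (hC n)) (Eventually.of_forall hlim)

theorem continuous_pairing_wave : Continuous fun k => pairing ν (wave k) := by
  refine Continuous.sub ?_ ?_ <;>
  refine continuous_of_dominated (bound := fun _ => 1)
    (fun k => (measurable_wave k).aestronglyMeasurable)
    (fun k => Eventually.of_forall fun x => (norm_wave k x).le) (integrable_const 1)
    (Eventually.of_forall fun x => by unfold wave; fun_prop)

/-- A superposition of characters can be integrated against a signed measure term by term. -/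
theorem pairing_integral_wave {g : ℝ → ℂ} (hg : Integrable g) :
    pairing ν (fun x => ∫ k, g k * wave k x) = ∫ k, g k * pairing ν (wave k) := by
  have hswap : ∀ μ : Measure ℝ, IsFiniteMeasure μ →
      Integrable (fun k => g k * ∫ x, wave k x ∂μ) ∧
      ∫ x, (∫ k, g k * wave k x) ∂μ = ∫ k, g k * ∫ x, wave k x ∂μ := by
    intro μ _
    have hi : Integrable (Function.uncurry fun k x => g k * wave k x) (volume.prod μ) := by
      refine (hg.comp_fst μ).mono ?_ (Eventually.of_forall fun y => ?_)
      · refine (hg.comp_fst μ).aestronglyMeasurable.mul (Continuous.aestronglyMeasurable ?_)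
        unfold wave
        fun_prop
      · simp [Function.uncurry, norm_wave]
    refine ⟨?_, ?_⟩
    · simpa only [Function.uncurry, integral_const_mul] using hi.integral_prod_left
    · rw [← integral_integral_swap hi]
      simp only [integral_const_mul]
  obtain ⟨i1, e1⟩ := hswap ν.toJordanDecomposition.posPart inferInstance
  obtain ⟨i2, e2⟩ := hswap ν.toJordanDecomposition.negPart inferInstance
  simp only [pairing]
  rw [e1, e2, ← integral_sub i1 i2]
  simp only [mul_sub]

end Pairing

section Family

variable {H : ℝ → SignedMeasure ℝ} {f : ℝ → ℂ} {C s₀ : ℝ}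

theorem measurable_pairing (hH : ∀ B, MeasurableSet B → Measurable fun t => H t B)
    (hf : Measurable f) (hC : ∀ x, ‖f x‖ ≤ C) : Measurable fun t => pairing (H t) f := by
  have hC0 : 0 ≤ C := (norm_nonneg _).trans (hC 0)
  have hs := hf.stronglyMeasurable
  refine measurable_of_tendsto_metrizable (f := fun n t => pairing (H t) (hs.approxBounded C n))
    (fun n => ?_) (tendsto_pi_nhds.2 fun t => tendsto_pairing (H t)
      (fun n => (hs.approxBounded C n).measurable)
      (fun n x => hs.norm_approxBounded_le hC0 n x)
      (fun x => hs.tendsto_approxBounded_of_norm_le (hC x)))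
  -- For a simple function the integral is a finite combination of values of the measure.
  set F := hs.approxBounded C n
  have e : ∀ t, pairing (H t) F =
      ∑ y ∈ F.range, ((H t (F ⁻¹' {y}) : ℝ) : ℂ) * y := by
    intro t
    have hi : ∀ μ : Measure ℝ, IsFiniteMeasure μ →
        ∫ x, F x ∂μ = ∑ y ∈ F.range, ((μ.real (F ⁻¹' {y}) : ℝ) : ℂ) * y := by
      intro μ _
      rw [SimpleFunc.integral_eq_sum F (integrable_of_bound F.measurable
        fun x => hs.norm_approxBounded_le hC0 n x)]
      simp only [Complex.real_smul]
    rw [pairing, hi _ inferInstance, hi _ inferInstance, ← Finset.sum_sub_distrib]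
    refine Finset.sum_congr rfl fun y _ => ?_
    rw [SignedMeasure.apply_eq_posPart_real_sub_negPart_real _ (F.measurableSet_preimage _)]
    push_cast
    ring
  simp only [e]
  exact Finset.measurable_sum _ fun y _ =>
    (Complex.measurable_ofReal.comp (hH _ (F.measurableSet_preimage _))).mul_const _

theorem norm_exp_neg_mul (s : ℂ) (t : ℝ) : ‖Complex.exp (-s * t)‖ = Real.exp (-s.re * t) := by
  rw [Complex.norm_exp]
  simp

theorem IsLaplaceFamily.integrable_totalVariation (hH : IsLaplaceFamily s₀ H) {a : ℝ}
    (ha : s₀ ≤ a) :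
    IntegrableOn (fun t => Real.exp (-a * t) * (H t).totalVariation.real univ) (Ioi 0) := by
  have hexp : ∀ b : ℝ, Continuous fun t : ℝ => Real.exp (b * t) := fun b => by fun_prop
  have e : ∀ t : ℝ, Real.exp (-a * t) * (H t).totalVariation.real univ =
      Real.exp ((s₀ - a) * t) * (Real.exp (-s₀ * t) * (H t).totalVariation.real univ) := by
    intro t
    rw [← mul_assoc, ← Real.exp_add]
    ring_nf
  refine Integrable.mono hH.2 ?_ ?_
  · simp only [e]
    exact (hexp _).aestronglyMeasurable.mul hH.2.aestronglyMeasurable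
  · filter_upwards [ae_restrict_mem measurableSet_Ioi] with t ht
    rw [e, norm_mul]
    refine mul_le_of_le_one_left (norm_nonneg _) ?_
    rw [Real.norm_of_nonneg (Real.exp_pos _).le, Real.exp_le_one_iff]
    exact mul_nonpos_of_nonpos_of_nonneg (by linarith) (le_of_lt ht)

theorem IsLaplaceFamily.integrable_pairing (hH : IsLaplaceFamily s₀ H) (hf : Measurable f)
    (hC : ∀ x, ‖f x‖ ≤ C) {s : ℂ} (hs : s₀ ≤ s.re) :
    IntegrableOn (fun t : ℝ => Complex.exp (-s * t) * pairing (H t) f) (Ioi 0) := by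
  refine ((hH.integrable_totalVariation hs).const_mul C).mono' ?_ (Eventually.of_forall fun t => ?_)
  · exact (Measurable.mul (by fun_prop) (measurable_pairing hH.1 hf hC)).aestronglyMeasurable
  · rw [norm_mul, norm_exp_neg_mul]
    calc _ ≤ Real.exp (-s.re * t) * (C * (H t).totalVariation.real univ) :=
          mul_le_mul_of_nonneg_left (norm_pairing_le _ hC) (Real.exp_pos _).le
      _ = _ := by ring

/-- The Laplace transform of the integral of `f` against a family of signed measures. -/
noncomputable def laplacePairing (H : ℝ → SignedMeasure ℝ) (s : ℂ) (f : ℝ → ℂ) : ℂ :=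
  laplaceFun (fun t => pairing (H t) f) s

theorem signedFourierLaplace_eq (H : ℝ → SignedMeasure ℝ) (k : ℝ) (s : ℂ) :
    signedFourierLaplace H k s = laplacePairing H s (wave k) := by
  simp only [signedFourierLaplace, laplacePairing, signedCharFun_eq]

theorem IsLaplaceFamily.laplacePairing_add (hH : IsLaplaceFamily s₀ H) {s : ℂ} (hs : s₀ ≤ s.re)
    {g : ℝ → ℂ} (hf : Measurable f) (hC : ∀ x, ‖f x‖ ≤ C) (hg : Measurable g) {C' : ℝ}
    (hC' : ∀ x, ‖g x‖ ≤ C') :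
    laplacePairing H s (fun x => f x + g x) = laplacePairing H s f + laplacePairing H s g := by
  simp only [laplacePairing, laplaceFun, pairing_add _ hf hC hg hC', mul_add]
  exact integral_add (hH.integrable_pairing hf hC hs) (hH.integrable_pairing hg hC' hs)

theorem laplacePairing_const_mul (H : ℝ → SignedMeasure ℝ) (s c : ℂ) (f : ℝ → ℂ) :
    laplacePairing H s (fun x => c * f x) = c * laplacePairing H s f := by
  simp only [laplacePairing, laplaceFun, pairing_const_mul]
  rw [← integral_const_mul]
  congr 1
  ext t
  ring

theorem IsLaplaceFamily.tendsto_laplacePairing (hH : IsLaplaceFamily s₀ H) {s : ℂ}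
    (hs : s₀ ≤ s.re) {F : ℕ → ℝ → ℂ} (hF : ∀ n, Measurable (F n))
    (hC : ∀ n x, ‖F n x‖ ≤ C) (hlim : ∀ x, Tendsto (fun n => F n x) atTop (𝓝 (f x))) :
    Tendsto (fun n => laplacePairing H s (F n)) atTop (𝓝 (laplacePairing H s f)) := by
  refine tendsto_integral_of_dominated_convergence
    (fun t => C * (Real.exp (-s.re * t) * (H t).totalVariation.real univ))
    (fun n => (hH.integrable_pairing (hF n) (hC n) hs).aestronglyMeasurable)
    ((hH.integrable_totalVariation hs).const_mul C)
    (fun n => Eventually.of_forall fun t => ?_)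
    (Eventually.of_forall fun t => (tendsto_pairing (H t) hF hC hlim).const_mul _)
  rw [norm_mul, norm_exp_neg_mul]
  calc _ ≤ Real.exp (-s.re * t) * (C * (H t).totalVariation.real univ) :=
        mul_le_mul_of_nonneg_left (norm_pairing_le _ (hC n)) (Real.exp_pos _).le
    _ = _ := by ring

theorem IsLaplaceFamily.measurable_uncurry_pairing_wave (hH : IsLaplaceFamily s₀ H) :
    Measurable (Function.uncurry fun k t => pairing (H t) (wave k)) :=
  measurable_uncurry_of_continuous_of_measurable (fun t => continuous_pairing_wave (H t))
    fun k => measurable_pairing hH.1 (measurable_wave k) fun x => (norm_wave k x).le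

/-- A superposition of characters can be transformed term by term. -/
theorem IsLaplaceFamily.laplacePairing_integral_wave (hH : IsLaplaceFamily s₀ H) {s : ℂ}
    (hs : s₀ ≤ s.re) {g : ℝ → ℂ} (hg : Integrable g) :
    Integrable (fun k => g k * laplacePairing H s (wave k)) ∧
    laplacePairing H s (fun x => ∫ k, g k * wave k x) =
      ∫ k, g k * laplacePairing H s (wave k) := by
  set F : ℝ → ℝ → ℂ := fun k t => g k * (Complex.exp (-s * t) * pairing (H t) (wave k))
  have hb : Integrable (fun y : ℝ × ℝ => g y.1 *
      ((Real.exp (-s.re * y.2) * (H y.2).totalVariation.real univ : ℝ) : ℂ))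
      (volume.prod (volume.restrict (Ioi 0))) :=
    hg.mul_prod (hH.integrable_totalVariation hs).ofReal
  have hi : Integrable (Function.uncurry F) (volume.prod (volume.restrict (Ioi 0))) := by
    refine hb.mono ?_ (Eventually.of_forall fun y => ?_)
    · refine hg.aestronglyMeasurable.comp_fst.mul
        (Measurable.aestronglyMeasurable (Measurable.mul (by fun_prop) ?_))
      exact hH.measurable_uncurry_pairing_wave
    · simp only [F, Function.uncurry, norm_mul, norm_exp_neg_mul, Complex.norm_real,
        Real.norm_of_nonneg (Real.exp_pos _).le, Real.norm_of_nonneg measureReal_nonneg]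
      refine mul_le_mul_of_nonneg_left (mul_le_mul_of_nonneg_left ?_ (Real.exp_pos _).le)
        (norm_nonneg _)
      simpa using norm_pairing_le (H y.2) (fun x => (norm_wave y.1 x).le)
  refine ⟨?_, ?_⟩
  · refine hi.integral_prod_left.congr (Eventually.of_forall fun k => ?_)
    simp only [F, Function.uncurry, integral_const_mul]
    rfl
  · have e : laplacePairing H s (fun x => ∫ k, g k * wave k x) =
        ∫ t in Ioi (0 : ℝ), ∫ k, F k t := by
      simp only [laplacePairing, laplaceFun, pairing_integral_wave _ hg, F]
      congr 1
      ext t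
      rw [← integral_const_mul]
      congr 1
      ext k
      ring
    rw [e, ← integral_integral_swap hi]
    simp only [F, integral_const_mul]
    rfl

/-- The Fourier-Laplace transform is jointly continuous. -/
theorem IsLaplaceFamily.continuousAt_laplacePairing_wave (hH : IsLaplaceFamily s₀ H)
    {q : ℝ × ℂ} (hq : s₀ < q.2.re) :
    ContinuousAt (fun q : ℝ × ℂ => laplacePairing H q.2 (wave q.1)) q := by
  have hev : ∀ᶠ q' : ℝ × ℂ in 𝓝 q, s₀ ≤ q'.2.re :=
    ((Complex.continuous_re.comp continuous_snd).tendsto q).eventually_const_le hq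
  refine continuousAt_of_dominated
    (bound := fun t => Real.exp (-s₀ * t) * (H t).totalVariation.real univ) ?_ ?_ hH.2 ?_
  · filter_upwards [hev] with q' hq'
    exact (hH.integrable_pairing (measurable_wave _) (fun x => (norm_wave _ x).le)
      hq').aestronglyMeasurable
  · filter_upwards [hev] with q' hq'
    filter_upwards [ae_restrict_mem measurableSet_Ioi] with t ht
    rw [norm_mul, norm_exp_neg_mul]
    refine mul_le_mul ?_ ?_ (norm_nonneg _) (Real.exp_pos _).le
    · refine Real.exp_le_exp.2 (mul_le_mul_of_nonneg_right (by linarith) (le_of_lt ht))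
    · simpa using norm_pairing_le (H t) (fun x => (norm_wave q'.1 x).le)
  · refine Eventually.of_forall fun t => ContinuousAt.mul (by fun_prop) ?_
    exact ((continuous_pairing_wave (H t)).comp continuous_fst).continuousAt

end Family

end MultiStateCTRW

/-! ### Laplace transforms and Riemann-Liouville integrals -/

namespace MultiStateCTRW

section PowerLaplace

theorem integrableOn_rpow_mul_exp_neg {a r : ℝ} (ha : 0 < a) (hr : 0 < r) :
    IntegrableOn (fun t : ℝ => t ^ (a - 1) * Real.exp (-r * t)) (Ioi 0) := by
  simpa using integrableOn_rpow_mul_exp_neg_mul_rpow (p := 1) (s := a - 1) (b := r)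
    (by linarith) zero_lt_one hr

theorem integrableOn_rpow_mul_cexp_neg {a : ℝ} (ha : 0 < a) {s : ℂ} (hs : 0 < s.re) :
    IntegrableOn (fun t : ℝ => ((t ^ (a - 1) : ℝ) : ℂ) * Complex.exp (-s * t)) (Ioi 0) := by
  refine Integrable.mono (integrableOn_rpow_mul_exp_neg ha hs) ?_
    (Eventually.of_forall fun t => ?_)
  · exact (Measurable.mul (by fun_prop) (by fun_prop)).aestronglyMeasurable
  · rw [norm_mul, norm_mul, norm_exp_neg_mul, Complex.norm_real,
      Real.norm_of_nonneg (Real.exp_pos _).le]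

/-- The Laplace transform of a power at a complex argument, by analytic continuation from the
positive real axis. -/
theorem integral_rpow_mul_cexp_neg {a : ℝ} (ha : 0 < a) {s : ℂ} (hs : 0 < s.re) :
    ∫ t in Ioi (0 : ℝ), ((t ^ (a - 1) : ℝ) : ℂ) * Complex.exp (-s * t) =
      (Real.Gamma a : ℂ) * s ^ (-a : ℂ) := by
  set μ : Measure ℝ := (volume.restrict (Ioi (0 : ℝ))).withDensity
    fun t => ENNReal.ofReal (t ^ (a - 1))
  have hm : Measurable fun t : ℝ => ENNReal.ofReal (t ^ (a - 1)) := by fun_prop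
  have hfin : ∀ᵐ t ∂volume.restrict (Ioi (0 : ℝ)), ENNReal.ofReal (t ^ (a - 1)) < ⊤ :=
    Eventually.of_forall fun t => ENNReal.ofReal_lt_top
  have hmgf : ∀ z : ℂ, complexMGF (fun t : ℝ => -t) μ z =
      ∫ t in Ioi (0 : ℝ), ((t ^ (a - 1) : ℝ) : ℂ) * Complex.exp (-z * t) := by
    intro z
    rw [complexMGF, integral_withDensity_eq_integral_toReal_smul hm hfin]
    refine setIntegral_congr_fun measurableSet_Ioi fun t ht => ?_
    rw [ENNReal.toReal_ofReal (Real.rpow_nonneg (le_of_lt ht) _), Complex.real_smul]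
    push_cast
    ring_nf
  have hset : Ioi (0 : ℝ) ⊆ integrableExpSet (fun t : ℝ => -t) μ := by
    intro r hr
    rw [integrableExpSet, mem_ofPred_eq, integrable_withDensity_iff_integrable_smul' hm hfin]
    refine (integrableOn_rpow_mul_exp_neg ha hr).congr ?_
    filter_upwards [ae_restrict_mem measurableSet_Ioi] with t ht
    rw [ENNReal.toReal_ofReal (Real.rpow_nonneg (le_of_lt ht) _), smul_eq_mul]
    ring_nf
  have hU : IsPreconnected {z : ℂ | 0 < z.re} :=
    (convex_halfSpace_re_gt 0).isPreconnected
  have hf : AnalyticOnNhd ℂ (complexMGF (fun t : ℝ => -t) μ) {z : ℂ | 0 < z.re} := fun z hz =>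
    analyticOnNhd_complexMGF z (interior_maximal hset isOpen_Ioi hz)
  have hg : AnalyticOnNhd ℂ (fun z : ℂ => (Real.Gamma a : ℂ) * z ^ (-a : ℂ))
      {z : ℂ | 0 < z.re} := fun z hz =>
    analyticAt_const.mul (analyticAt_id.cpow analyticAt_const (Or.inl hz))
  have hreal : ∀ r : ℝ, 0 < r → complexMGF (fun t : ℝ => -t) μ r =
      (Real.Gamma a : ℂ) * (r : ℂ) ^ (-a : ℂ) := by
    intro r hr
    have h := Complex.integral_cpow_mul_exp_neg_mul_Ioi (a := a) (r := r) (by simpa using ha) hr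
    rw [hmgf, Complex.Gamma_ofReal] at *
    rw [mul_comm, Complex.cpow_neg, ← Complex.inv_cpow, ← one_div, ← h]
    · refine setIntegral_congr_fun measurableSet_Ioi fun t ht => ?_
      rw [Complex.ofReal_cpow (le_of_lt ht)]
      push_cast
      ring_nf
    · rw [Complex.arg_ofReal_of_nonneg hr.le]
      exact Real.pi_pos.ne
  have hfreq : ∃ᶠ z in 𝓝[≠] (1 : ℂ), complexMGF (fun t : ℝ => -t) μ z =
      (Real.Gamma a : ℂ) * z ^ (-a : ℂ) := by
    have ht : Tendsto (fun r : ℝ => (r : ℂ)) (𝓝[≠] 1) (𝓝[≠] ((1 : ℝ) : ℂ)) := by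
      refine tendsto_nhdsWithin_iff.2 ⟨?_, ?_⟩
      · exact (Complex.continuous_ofReal.tendsto 1).mono_left nhdsWithin_le_nhds
      · filter_upwards [self_mem_nhdsWithin] with r hr
        simpa using hr
    rw [Complex.ofReal_one] at ht
    refine ht.frequently (Eventually.frequently ?_)
    filter_upwards [mem_nhdsWithin_of_mem_nhds (Ioi_mem_nhds zero_lt_one)] with r hr
    exact hreal r hr
  rw [← hmgf]
  exact hf.eqOn_of_preconnected_of_frequently_eq hg hU (z₀ := 1) (by simp) hfreq hs

end PowerLaplace

section LaplaceIntegrable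

/-- The Laplace integral of `f` converges absolutely at `a`. -/
def LaplaceIntegrable (a : ℝ) (f : ℝ → ℝ) : Prop :=
  IntegrableOn (fun t => Real.exp (-a * t) * f t) (Ioi 0)

variable {a b : ℝ} {f g : ℝ → ℝ}

theorem LaplaceIntegrable.complex {s : ℂ} (hf : LaplaceIntegrable s.re f) :
    IntegrableOn (fun t : ℝ => Complex.exp (-s * t) * (f t : ℂ)) (Ioi 0) := by
  have h1 : Integrable (fun t : ℝ => Complex.exp (-(s.im * t : ℝ) * Complex.I) *
      ((Real.exp (-s.re * t) * f t : ℝ) : ℂ)) (volume.restrict (Ioi 0)) := by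
    refine Integrable.bdd_mul (c := 1) hf.ofReal (by fun_prop) (Eventually.of_forall fun t => ?_)
    rw [← Complex.ofReal_neg, Complex.norm_exp_ofReal_mul_I]
  refine h1.congr (Eventually.of_forall fun t => ?_)
  simp only
  push_cast
  rw [← mul_assoc, ← Complex.exp_add]
  congr 2
  conv_rhs => rw [← Complex.re_add_im s]
  ring

theorem LaplaceIntegrable.mono (hf : LaplaceIntegrable a f) (hab : a ≤ b) :
    LaplaceIntegrable b f := by
  have h1 : Integrable (fun t : ℝ => Real.exp (-(b - a) * max t 0) *
      (Real.exp (-a * t) * f t)) (volume.restrict (Ioi 0)) := by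
    refine Integrable.bdd_mul (c := 1) hf (by fun_prop) (Eventually.of_forall fun t => ?_)
    rw [Real.norm_of_nonneg (Real.exp_pos _).le, Real.exp_le_one_iff, neg_mul, neg_nonpos]
    exact mul_nonneg (by linarith) (le_max_right _ _)
  refine h1.congr ?_
  filter_upwards [ae_restrict_mem measurableSet_Ioi] with t ht
  rw [max_eq_left (le_of_lt ht), ← mul_assoc, ← Real.exp_add]
  ring_nf

theorem LaplaceIntegrable.const_mul (hf : LaplaceIntegrable a f) (c : ℝ) :
    LaplaceIntegrable a fun t => c * f t := by
  refine (Integrable.const_mul hf c).congr (Eventually.of_forall fun t => ?_)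
  simp only
  ring

theorem LaplaceIntegrable.add (hf : LaplaceIntegrable a f) (hg : LaplaceIntegrable a g) :
    LaplaceIntegrable a fun t => f t + g t := by
  refine (Integrable.add hf hg).congr (Eventually.of_forall fun t => ?_)
  simp only [Pi.add_apply]
  ring

theorem LaplaceIntegrable.sub (hf : LaplaceIntegrable a f) (hg : LaplaceIntegrable a g) :
    LaplaceIntegrable a fun t => f t - g t := by
  simpa [sub_eq_add_neg] using hf.add (hg.const_mul (-1))

theorem LaplaceIntegrable.sum {ι : Type*} (S : Finset ι) {f : ι → ℝ → ℝ}
    (hf : ∀ i ∈ S, LaplaceIntegrable a (f i)) :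
    LaplaceIntegrable a fun t => ∑ i ∈ S, f i t := by
  refine (integrable_finsetSum S hf).congr (Eventually.of_forall fun t => ?_)
  simp only [Finset.mul_sum]

theorem laplaceIntegrable_const (ha : 0 < a) (c : ℝ) : LaplaceIntegrable a fun _ => c :=
  (exp_neg_integrableOn_Ioi 0 ha).mul_const c

/-- The Laplace transform of a real function. -/
noncomputable def laplaceReal (f : ℝ → ℝ) (s : ℂ) : ℂ := laplaceFun (fun t => (f t : ℂ)) s

theorem laplaceReal_const_mul (c : ℝ) (f : ℝ → ℝ) (s : ℂ) :
    laplaceReal (fun t => c * f t) s = c * laplaceReal f s := by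
  simp only [laplaceReal, laplaceFun]
  rw [← integral_const_mul]
  congr 1
  ext t
  push_cast
  ring

theorem laplaceReal_sub {s : ℂ} (hf : LaplaceIntegrable s.re f) (hg : LaplaceIntegrable s.re g) :
    laplaceReal (fun t => f t - g t) s = laplaceReal f s - laplaceReal g s := by
  simp only [laplaceReal, laplaceFun, Complex.ofReal_sub, mul_sub]
  exact integral_sub hf.complex hg.complex

theorem laplaceReal_sum {ι : Type*} (S : Finset ι) {f : ι → ℝ → ℝ} {s : ℂ}
    (hf : ∀ i ∈ S, LaplaceIntegrable s.re (f i)) :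
    laplaceReal (fun t => ∑ i ∈ S, f i t) s = ∑ i ∈ S, laplaceReal (f i) s := by
  simp only [laplaceReal, laplaceFun, Complex.ofReal_sum, Finset.mul_sum]
  exact integral_finsetSum S fun i hi => (hf i hi).complex

theorem laplaceReal_const {s : ℂ} (hs : 0 < s.re) (c : ℝ) :
    laplaceReal (fun _ => c) s = s⁻¹ * c := by
  have h := integral_rpow_mul_cexp_neg one_pos hs
  simp only [sub_self, Real.rpow_zero, Complex.ofReal_one, one_mul, Real.Gamma_one,
    Complex.cpow_neg_one] at h
  rw [laplaceReal, laplaceFun, integral_mul_const, h]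

theorem LaplaceIntegrable.rlIntegral (hb : 0 < b) (ha : 0 < a) (hf : LaplaceIntegrable a f) :
    LaplaceIntegrable a (rlIntegral b f) := by
  have hf' : IntegrableOn (fun t => Real.exp (-a * t) * f t) (Ioi 0) := hf
  have h := integrable_posConvolution hf' (integrableOn_rpow_mul_exp_neg hb ha)
    (ContinuousLinearMap.mul ℝ ℝ)
  refine ((h.const_mul (Real.Gamma b)⁻¹).integrableOn (s := Ioi 0)).congr ?_
  filter_upwards [ae_restrict_mem measurableSet_Ioi] with t ht
  simp only [posConvolution, indicator_of_mem ht]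
  rw [MultiStateCTRW.rlIntegral, mul_left_comm]
  congr 1
  rw [← intervalIntegral.integral_const_mul]
  refine intervalIntegral.integral_congr fun τ _ => ?_
  simp only [ContinuousLinearMap.mul_apply']
  rw [show -a * t = -a * τ + -a * (t - τ) by ring, Real.exp_add]
  ring

/-- The Riemann-Liouville integral of order `b` multiplies the Laplace transform by `s ^ (-b)`. -/
theorem laplaceReal_rlIntegral (hb : 0 < b) {s : ℂ} (hs : 0 < s.re)
    (hf : LaplaceIntegrable s.re f) :
    laplaceReal (rlIntegral b f) s = s ^ (-b : ℂ) * laplaceReal f s := by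
  have h := integral_posConvolution hf.complex (integrableOn_rpow_mul_cexp_neg hb hs)
    (ContinuousLinearMap.mul ℝ ℂ)
  rw [integral_rpow_mul_cexp_neg hb hs, ContinuousLinearMap.mul_apply'] at h
  have hG : (Real.Gamma b : ℂ) ≠ 0 := Complex.ofReal_ne_zero.2 (Real.Gamma_pos_of_pos hb).ne'
  have e : laplaceReal (rlIntegral b f) s = (Real.Gamma b : ℂ)⁻¹ *
      ∫ t in Ioi (0 : ℝ), ∫ τ in (0 : ℝ)..t, ContinuousLinearMap.mul ℝ ℂ
        (Complex.exp (-s * τ) * (f τ : ℂ))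
        ((((t - τ) ^ (b - 1) : ℝ) : ℂ) * Complex.exp (-s * (t - τ : ℝ))) := by
    rw [laplaceReal, laplaceFun, ← integral_const_mul]
    refine setIntegral_congr_fun measurableSet_Ioi fun t _ => ?_
    simp only [rlIntegral]
    rw [Complex.ofReal_mul, Complex.ofReal_inv, mul_left_comm, ← intervalIntegral.integral_ofReal,
      ← intervalIntegral.integral_const_mul]
    congr 1
    refine intervalIntegral.integral_congr fun τ _ => ?_
    simp only [ContinuousLinearMap.mul_apply', Complex.ofReal_mul]
    have : Complex.exp (-s * t) = Complex.exp (-s * τ) * Complex.exp (-s * (t - τ : ℝ)) := by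
      rw [← Complex.exp_add]
      push_cast
      ring_nf
    rw [this]
    ring
  rw [e, h]
  simp only [laplaceReal, laplaceFun]
  field_simp

/-- The Laplace transform on a vertical line determines the function. -/
theorem ae_eq_zero_of_laplaceReal_eq_zero (hf : LaplaceIntegrable a f)
    (h : ∀ y : ℝ, laplaceReal f (a + y * Complex.I) = 0) :
    ∀ᵐ t ∂volume.restrict (Ioi (0 : ℝ)), f t = 0 := by
  set ν : Measure ℝ := volume.restrict (Ioi (0 : ℝ))
  set u : ℝ → ℝ := fun t => Real.exp (-a * t) * f t
  have hu : Integrable u ν := hf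
  have hfin : ∀ {v : ℝ → ℝ}, Integrable v ν →
      IsFiniteMeasure (ν.withDensity fun t => ENNReal.ofReal (v t)) := fun hv =>
    isFiniteMeasure_withDensity_ofReal hv.2
  have := hfin hu
  have hun : Integrable (fun t => -u t) ν := hu.neg
  have := hfin hun
  have hchar : ∀ {v : ℝ → ℝ}, Integrable v ν → ∀ k : ℝ,
      charFun (ν.withDensity fun t => ENNReal.ofReal (v t)) k =
        ∫ t, ((max (v t) 0 : ℝ) : ℂ) * Complex.exp (k * t * Complex.I) ∂ν := by
    intro v hv k
    rw [charFun_apply_real, integral_withDensity_eq_integral_toReal_smul₀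
      hv.aemeasurable.ennreal_ofReal (Eventually.of_forall fun t => ENNReal.ofReal_lt_top)]
    simp only [ENNReal.toReal_ofReal', Complex.real_smul]
  have hint : ∀ {v : ℝ → ℝ}, Integrable v ν → ∀ k : ℝ,
      Integrable (fun t : ℝ => ((max (v t) 0 : ℝ) : ℂ) * Complex.exp (k * t * Complex.I)) ν := by
    intro v hv k
    refine Integrable.mul_bdd (c := 1) hv.pos_part.ofReal (by fun_prop)
      (Eventually.of_forall fun t => ?_)
    rw [← Complex.ofReal_mul, Complex.norm_exp_ofReal_mul_I]
  have heq : (ν.withDensity fun t => ENNReal.ofReal (u t)) =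
      ν.withDensity fun t => ENNReal.ofReal (-u t) := by
    refine Measure.ext_of_charFun (funext fun k => ?_)
    rw [hchar hu, hchar hun, ← sub_eq_zero, ← integral_sub (hint hu k) (hint hun k)]
    rw [← h (-k), laplaceReal, laplaceFun]
    refine integral_congr_ae (Eventually.of_forall fun t => ?_)
    beta_reduce
    rw [← sub_mul, ← Complex.ofReal_sub]
    have : max (u t) 0 - max (-u t) 0 = u t := by
      rcases le_total 0 (u t) with h0 | h0
      · rw [max_eq_left h0, max_eq_right (by linarith), sub_zero]
      · rw [max_eq_right h0, max_eq_left (by linarith)]; ring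
    rw [this]
    simp only [u]
    push_cast
    rw [mul_right_comm, ← Complex.exp_add]
    ring_nf
  rw [withDensity_eq_iff_of_sigmaFinite hu.aemeasurable.ennreal_ofReal
    hun.aemeasurable.ennreal_ofReal] at heq
  filter_upwards [heq] with t ht
  have hut : u t = 0 := by
    rcases lt_trichotomy (u t) 0 with h0 | h0 | h0
    · rw [ENNReal.ofReal_of_nonpos h0.le, eq_comm, ENNReal.ofReal_eq_zero] at ht
      linarith
    · exact h0
    · rw [ENNReal.ofReal_of_nonpos (by linarith : -u t ≤ 0), ENNReal.ofReal_eq_zero] at ht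
      linarith
  exact (mul_eq_zero.1 hut).resolve_left (Real.exp_pos _).ne'

/-- Functions with a convergent Laplace integral are integrable against test functions. -/
theorem LaplaceIntegrable.integrable_mul (hf : LaplaceIntegrable a f) (hg : Continuous g)
    (hg' : HasCompactSupport g) : IntegrableOn (fun t => f t * g t) (Ioi 0) := by
  have hc : Continuous fun t => Real.exp (a * t) * g t := by fun_prop
  have hcs : HasCompactSupport fun t => Real.exp (a * t) * g t := hg'.mul_left
  obtain ⟨C, hC⟩ := hc.bounded_above_of_compact_support hcs
  refine (Integrable.mul_bdd (c := C) hf hc.aestronglyMeasurable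
    (Eventually.of_forall hC)).congr (Eventually.of_forall fun t => ?_)
  simp only
  rw [show Real.exp (-a * t) * f t * (Real.exp (a * t) * g t) =
    (Real.exp (-a * t) * Real.exp (a * t)) * (f t * g t) by ring, ← Real.exp_add]
  simp

end LaplaceIntegrable

end MultiStateCTRW

/-! ### Distributional equations in time -/

namespace MultiStateCTRW

section TestFunction

variable {θ ψ : ℝ → ℝ}

theorem IsTestFunction.deriv (h : IsTestFunction θ) : IsTestFunction (deriv θ) :=
  ⟨(contDiff_infty_iff_deriv.1 h.1).2, h.2.deriv⟩

theorem iteratedDeriv_two {F : Type*} [NormedAddCommGroup F] [NormedSpace ℝ F] (f : ℝ → F) :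
    iteratedDeriv 2 f = _root_.deriv (_root_.deriv f) := by
  rw [iteratedDeriv_succ, iteratedDeriv_one]

theorem IsTestFunction.iteratedDeriv_two (h : IsTestFunction θ) :
    IsTestFunction (iteratedDeriv 2 θ) := by
  rw [MultiStateCTRW.iteratedDeriv_two]
  exact h.deriv.deriv

theorem IsTestFunction.exists_bound (h : IsTestFunction ψ) :
    Measurable (fun x => (ψ x : ℂ)) ∧ ∃ C, ∀ x, ‖(ψ x : ℂ)‖ ≤ C := by
  obtain ⟨C, hC⟩ := h.1.continuous.bounded_above_of_compact_support h.2
  exact ⟨Complex.measurable_ofReal.comp h.1.continuous.measurable, C,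
    fun x => by rw [Complex.norm_real]; exact hC x⟩

theorem IsTestFunction.integral_deriv (h : IsTestFunction θ) :
    ∫ t in Ioi (0 : ℝ), _root_.deriv θ t = -θ 0 := by
  have hd : Differentiable ℝ θ := h.1.differentiable (by simp)
  have ht : Tendsto θ atTop (𝓝 0) := by
    have := h.2.is_zero_at_infty
    exact this.mono_left (atTop_le_cocompact)
  rw [integral_Ioi_of_hasDerivAt_of_tendsto h.1.continuous.continuousWithinAt
    (fun t _ => (hd t).hasDerivAt)
    (h.deriv.1.continuous.integrable_of_hasCompactSupport h.deriv.2).integrableOn ht, zero_sub]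

/-- On the half-line `t > 0` every test function is the derivative of a test function of the line:
the primitive that vanishes far to the right, cut off at the left of the origin. -/
theorem IsTestFunction.exists_primitive (h : IsTestFunction θ) :
    ∃ ζ, IsTestFunction ζ ∧ (∀ t ∈ Ioi (0 : ℝ), _root_.deriv ζ t = θ t) ∧
      ζ 0 = -∫ t in Ioi (0 : ℝ), θ t := by
  set A := ∫ t in Ioi (0 : ℝ), θ t with hA
  have hi : Integrable θ := h.1.continuous.integrable_of_hasCompactSupport h.2
  set g : ℝ → ℝ := fun t => (∫ τ in (0 : ℝ)..t, θ τ) - A with hg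
  have hgd : ∀ t, HasDerivAt g (θ t) t := fun t =>
    (h.1.continuous.integral_hasStrictDerivAt 0 t).hasDerivAt.sub_const A
  have hgc : ContDiff ℝ (⊤ : ℕ∞) g := by
    refine contDiff_infty_iff_deriv.2 ⟨fun t => (hgd t).differentiableAt, ?_⟩
    rw [show _root_.deriv g = θ from funext fun t => (hgd t).deriv]
    exact h.1
  obtain ⟨R, hR⟩ := h.2.isCompact.isBounded.subset_closedBall 0
  have hθR : ∀ t, R < t → θ t = 0 := fun t ht => by
    refine image_eq_zero_of_notMem_tsupport fun hmem => ?_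
    have := hR hmem
    rw [Real.closedBall_eq_Icc] at this
    linarith [this.2]
  have hgR : ∀ t, max R 0 ≤ t → g t = 0 := fun t ht => by
    have h0 : 0 ≤ t := (le_max_right _ _).trans ht
    have : A = ∫ τ in (0 : ℝ)..t, θ τ := by
      rw [hA, intervalIntegral.integral_of_le h0]
      refine (setIntegral_eq_of_subset_of_forall_sdiff_eq_zero measurableSet_Ioi
        Ioc_subset_Ioi_self fun τ hτ => hθR τ ?_)
      by_contra hle
      exact hτ.2 ⟨hτ.1, by linarith [le_max_left R 0]⟩
    simp only [hg, ← this, sub_self]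
  refine ⟨fun t => Real.smoothTransition (t + 1) * g t, ⟨?_, ?_⟩, fun t ht => ?_, ?_⟩
  · exact (Real.smoothTransition.contDiff.comp (contDiff_id.add contDiff_const)).mul hgc
  · refine HasCompactSupport.intro (isCompact_Icc (a := -1) (b := max R 0)) fun t ht => ?_
    rcases not_and_or.1 (show ¬(-1 ≤ t ∧ t ≤ max R 0) from ht) with h1 | h1
    · rw [Real.smoothTransition.zero_of_nonpos (by linarith), zero_mul]
    · rw [hgR t (not_le.1 h1).le, mul_zero]
  · have : (fun t => Real.smoothTransition (t + 1) * g t) =ᶠ[𝓝 t] g := by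
      filter_upwards [Ioi_mem_nhds ht] with τ hτ
      rw [Real.smoothTransition.one_of_one_le (by linarith [mem_Ioi.1 hτ]), one_mul]
    rw [this.deriv_eq, (hgd t).deriv]
  · simp [hg]

end TestFunction

section TimeDeriv

variable {a : ℝ} {f g θ : ℝ → ℝ}

theorem LaplaceIntegrable.integrable_deriv (hf : LaplaceIntegrable a f) (h : IsTestFunction θ) :
    IntegrableOn (fun t => f t * deriv θ t) (Ioi 0) :=
  hf.integrable_mul h.deriv.1.continuous h.deriv.2

theorem timeDeriv_const_mul (c : ℝ) (f θ : ℝ → ℝ) :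
    timeDeriv (fun t => c * f t) θ = c * timeDeriv f θ := by
  simp only [timeDeriv, mul_assoc, integral_const_mul, mul_neg]

theorem timeDeriv_sub (hf : LaplaceIntegrable a f) (hg : LaplaceIntegrable a g)
    (h : IsTestFunction θ) :
    timeDeriv (fun t => f t - g t) θ = timeDeriv f θ - timeDeriv g θ := by
  simp only [timeDeriv, sub_mul]
  rw [integral_sub (hf.integrable_deriv h) (hg.integrable_deriv h)]
  ring

theorem timeDeriv_sum {ι : Type*} (S : Finset ι) {f : ι → ℝ → ℝ}
    (hf : ∀ i ∈ S, LaplaceIntegrable a (f i)) (h : IsTestFunction θ) :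
    timeDeriv (fun t => ∑ i ∈ S, f i t) θ = ∑ i ∈ S, timeDeriv (f i) θ := by
  simp only [timeDeriv, Finset.sum_mul]
  rw [integral_finsetSum S fun i hi => (hf i hi).integrable_deriv h, Finset.sum_neg_distrib]

/-- The equation `∂ₜ f = c δ` on the whole axis, for a function extended by zero to negative times,
means that `f` is constant: the initial condition is part of the equation. -/
theorem LaplaceIntegrable.forall_timeDeriv_eq_iff (hf : LaplaceIntegrable a f) (c : ℝ) :
    (∀ θ, IsTestFunction θ → timeDeriv f θ = c * θ 0) ↔
      ∀ᵐ t ∂volume.restrict (Ioi (0 : ℝ)), f t = c := by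
  constructor
  · intro h
    have hloc : LocallyIntegrableOn (fun t => f t - c) (Ioi 0) := by
      have hf' : LaplaceIntegrable (max a 1) fun t => f t - c :=
        (hf.mono (le_max_left _ _)).sub
          (laplaceIntegrable_const (lt_of_lt_of_le one_pos (le_max_right _ _)) c)
      have h1 : LocallyIntegrableOn (fun t => Real.exp (max a 1 * t) *
          (Real.exp (-(max a 1) * t) * (f t - c))) (Ioi 0) :=
        (IntegrableOn.locallyIntegrableOn hf').continuousOn_mul (by fun_prop)
          (isOpen_Ioi.isLocallyClosed)
      have e : (fun t => Real.exp (max a 1 * t) * (Real.exp (-(max a 1) * t) * (f t - c))) =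
          fun t => f t - c := by
        ext t
        rw [← mul_assoc, ← Real.exp_add]
        simp
      rwa [e] at h1
    have hz := isOpen_Ioi.ae_eq_zero_of_integral_contDiff_smul_eq_zero hloc
      fun η hη1 hη2 hη3 => by
        obtain ⟨ζ, hζ, hd, h0⟩ := IsTestFunction.exists_primitive ⟨hη1, hη2⟩
        have h1 := h ζ hζ
        rw [timeDeriv, h0] at h1
        have h2 : ∫ t in Ioi (0 : ℝ), f t * deriv ζ t = ∫ t in Ioi (0 : ℝ), f t * η t :=
          setIntegral_congr_fun measurableSet_Ioi fun t ht => by simp only [hd t ht]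
        have h3 : ∫ t, η t • (f t - c) = ∫ t in Ioi (0 : ℝ), (f t * η t - c * η t) := by
          rw [← setIntegral_eq_integral_of_forall_compl_eq_zero (s := Ioi 0)]
          · exact integral_congr_ae (Eventually.of_forall fun t => by simp only [smul_eq_mul]; ring)
          · intro t ht
            rw [image_eq_zero_of_notMem_tsupport fun hmem => ht (hη3 hmem), zero_smul]
        rw [h3, integral_sub (hf.integrable_mul hη1.continuous hη2)
          ((hη1.continuous.integrable_of_hasCompactSupport hη2).integrableOn.const_mul c),
          integral_const_mul, ← h2]
        linarith
    rw [ae_restrict_iff' measurableSet_Ioi]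
    filter_upwards [hz] with t ht hmem
    linarith [ht hmem]
  · intro h θ hθ
    have : ∫ t in Ioi (0 : ℝ), f t * deriv θ t = ∫ t in Ioi (0 : ℝ), c * deriv θ t :=
      integral_congr_ae (h.mono fun t ht => by simp only [ht])
    rw [timeDeriv, this, integral_const_mul, hθ.integral_deriv]
    ring

/-- The same equation in terms of the Laplace transform. -/
theorem LaplaceIntegrable.forall_timeDeriv_eq_iff_laplace {s₀ : ℝ} (hs₀ : 0 ≤ s₀)
    (hf : ∀ a > s₀, LaplaceIntegrable a f) (c : ℝ) :
    (∀ θ, IsTestFunction θ → timeDeriv f θ = c * θ 0) ↔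
      ∀ s : ℂ, s₀ < s.re → laplaceReal f s = s⁻¹ * c := by
  rw [(hf (s₀ + 1) (by linarith)).forall_timeDeriv_eq_iff]
  constructor
  · intro h s hs
    rw [← laplaceReal_const (hs₀.trans_lt hs)]
    exact integral_congr_ae (h.mono fun t ht => by simp only [ht])
  · intro h
    have h1 : (0 : ℝ) < s₀ + 1 := by linarith
    have hz := ae_eq_zero_of_laplaceReal_eq_zero (f := fun t => f t - c)
      ((hf (s₀ + 1) (by linarith)).sub (laplaceIntegrable_const h1 c)) fun y => by
        have hre : ((s₀ + 1 : ℝ) + y * Complex.I : ℂ).re = s₀ + 1 := by simp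
        rw [laplaceReal_sub (by rw [hre]; exact hf _ (by linarith))
          (by rw [hre]; exact laplaceIntegrable_const h1 c), h _ (by rw [hre]; linarith),
          laplaceReal_const (by rw [hre]; exact h1), sub_self]
    filter_upwards [hz] with t ht
    linarith

end TimeDeriv

section System

variable {N : ℕ} {M : Matrix (Fin N) (Fin N) ℝ} {p₀ α B : Fin N → ℝ} {σ s₀ : ℝ}
  {H : Fin N → ℝ → SignedMeasure ℝ}

theorem IsLaplaceFamily.laplaceIntegrable_signedIntegral {H : ℝ → SignedMeasure ℝ}
    (hH : IsLaplaceFamily s₀ H) {ψ : ℝ → ℝ} (hψ : IsTestFunction ψ) {a : ℝ} (ha : s₀ ≤ a) :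
    LaplaceIntegrable a fun t => signedIntegral (H t) ψ := by
  obtain ⟨hm, C, hC⟩ := hψ.exists_bound
  have h := (hH.integrable_pairing hm hC (s := a) (by simpa using ha)).re
  refine h.congr (Eventually.of_forall fun t => ?_)
  simp only [← ofReal_signedIntegral]
  rw [← Complex.ofReal_neg, ← Complex.ofReal_mul, ← Complex.ofReal_exp, ← Complex.ofReal_mul]
  exact Complex.ofReal_re _

theorem laplaceReal_signedIntegral (H : ℝ → SignedMeasure ℝ) (ψ : ℝ → ℝ) (s : ℂ) :
    laplaceReal (fun t => signedIntegral (H t) ψ) s =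
      laplacePairing H s fun x => (ψ x : ℂ) := by
  simp only [laplaceReal, laplacePairing, ofReal_signedIntegral]

/-- The fractional Fokker-Planck equation in Laplace variables, tested in space against `f` with
second derivative `f''`; the point source contributes `p₀ i * f 0 / s`. -/
def SpatialEquation (M : Matrix (Fin N) (Fin N) ℝ) (p₀ α B : Fin N → ℝ) (σ : ℝ)
    (H : Fin N → ℝ → SignedMeasure ℝ) (s : ℂ) (i : Fin N) (f f'' : ℝ → ℂ) : Prop :=
  ∑ j, ((M j i : ℂ) - ((M j i - (1 : Matrix (Fin N) (Fin N) ℝ) j i) * (B j)⁻¹ : ℝ) *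
        s ^ (-α j : ℂ)) * laplacePairing (H j) s f -
      ∑ j, ((M j i * (σ ^ 2 / B j) : ℝ) : ℂ) * s ^ (-α j : ℂ) * laplacePairing (H j) s f'' =
    s⁻¹ * p₀ i * f 0

/-- Passing to the Laplace transform in time turns the distributional equation into a family of
equations in space. -/
theorem solvesFokkerPlanck_iff_spatialEquation (hα : ∀ i, 0 < α i ∧ α i < 1) (hs₀ : 0 ≤ s₀)
    (hH : ∀ i, IsLaplaceFamily s₀ (H i)) :
    SolvesFokkerPlanck M p₀ α B σ H ↔ ∀ ψ, IsTestFunction ψ → ∀ (s : ℂ), s₀ < s.re → ∀ i,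
      SpatialEquation M p₀ α B σ H s i (fun x => ψ x) fun x => (iteratedDeriv 2 ψ x : ℝ) := by
  have key : ∀ ψ, IsTestFunction ψ → ∀ i,
      ((∀ θ, IsTestFunction θ →
        ∑ j, M j i * timeDeriv (fun t => signedIntegral (H j t) ψ) θ =
        ∑ j, (M j i - (1 : Matrix (Fin N) (Fin N) ℝ) j i) * (B j)⁻¹ *
          rlDeriv (1 - α j) (fun t => signedIntegral (H j t) ψ) θ +
        ∑ j, M j i * (σ ^ 2 / B j) *
          rlDeriv (1 - α j) (fun t => signedIntegral (H j t) (iteratedDeriv 2 ψ)) θ +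
        p₀ i * (ψ 0 * θ 0)) ↔ ∀ s : ℂ, s₀ < s.re →
      SpatialEquation M p₀ α B σ H s i (fun x => ψ x) fun x => (iteratedDeriv 2 ψ x : ℝ)) := by
    intro ψ hψ i
    set u : Fin N → ℝ → ℝ := fun j t => signedIntegral (H j t) ψ
    set v : Fin N → ℝ → ℝ := fun j t => signedIntegral (H j t) (iteratedDeriv 2 ψ)
    set b : Fin N → ℝ := fun j => (M j i - (1 : Matrix (Fin N) (Fin N) ℝ) j i) * (B j)⁻¹
    set d : Fin N → ℝ := fun j => M j i * (σ ^ 2 / B j)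
    have hu : ∀ a > s₀, ∀ j, LaplaceIntegrable a (u j) := fun a ha j =>
      (hH j).laplaceIntegrable_signedIntegral hψ ha.le
    have hv : ∀ a > s₀, ∀ j, LaplaceIntegrable a (v j) := fun a ha j =>
      (hH j).laplaceIntegrable_signedIntegral hψ.iteratedDeriv_two ha.le
    have hIu : ∀ a > s₀, ∀ j, LaplaceIntegrable a (rlIntegral (α j) (u j)) := fun a ha j =>
      (hu a ha j).rlIntegral (hα j).1 (hs₀.trans_lt ha)
    have hIv : ∀ a > s₀, ∀ j, LaplaceIntegrable a (rlIntegral (α j) (v j)) := fun a ha j =>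
      (hv a ha j).rlIntegral (hα j).1 (hs₀.trans_lt ha)
    have i1 : ∀ a > s₀, LaplaceIntegrable a fun t => ∑ j, M j i * u j t := fun a ha =>
      LaplaceIntegrable.sum _ fun j _ => (hu a ha j).const_mul _
    have i2 : ∀ a > s₀, LaplaceIntegrable a fun t => ∑ j, b j * rlIntegral (α j) (u j) t :=
      fun a ha => LaplaceIntegrable.sum _ fun j _ => (hIu a ha j).const_mul _
    have i3 : ∀ a > s₀, LaplaceIntegrable a fun t => ∑ j, d j * rlIntegral (α j) (v j) t :=
      fun a ha => LaplaceIntegrable.sum _ fun j _ => (hIv a ha j).const_mul _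
    -- The function whose time derivative is `p₀ i * ψ 0 * δ`.
    have hF := LaplaceIntegrable.forall_timeDeriv_eq_iff_laplace hs₀
      (f := fun t => ∑ j, M j i * u j t - ∑ j, b j * rlIntegral (α j) (u j) t -
        ∑ j, d j * rlIntegral (α j) (v j) t)
      (fun a ha => ((i1 a ha).sub (i2 a ha)).sub (i3 a ha)) (p₀ i * ψ 0)
    refine (Iff.trans (forall₂_congr fun θ hθ => ?_) hF).trans (forall₂_congr fun s hs => ?_)
    · have h1 : s₀ + 1 > s₀ := by linarith
      rw [timeDeriv_sub ((i1 _ h1).sub (i2 _ h1)) (i3 _ h1) hθ,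
        timeDeriv_sub (i1 _ h1) (i2 _ h1) hθ,
        timeDeriv_sum _ (fun j _ => (hu _ h1 j).const_mul _) hθ,
        timeDeriv_sum _ (fun j _ => (hIu _ h1 j).const_mul _) hθ,
        timeDeriv_sum _ (fun j _ => (hIv _ h1 j).const_mul _) hθ]
      simp only [timeDeriv_const_mul, rlDeriv, sub_sub_cancel]
      constructor <;> intro h <;> linarith
    · have hs' : 0 < s.re := hs₀.trans_lt hs
      rw [laplaceReal_sub ((i1 _ hs).sub (i2 _ hs)) (i3 _ hs), laplaceReal_sub (i1 _ hs) (i2 _ hs),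
        laplaceReal_sum _ (fun j _ => (hu _ hs j).const_mul _),
        laplaceReal_sum _ (fun j _ => (hIu _ hs j).const_mul _),
        laplaceReal_sum _ (fun j _ => (hIv _ hs j).const_mul _)]
      simp only [laplaceReal_const_mul]
      simp only [laplaceReal_rlIntegral (hα _).1 hs' (hu _ hs _),
        laplaceReal_rlIntegral (hα _).1 hs' (hv _ hs _)]
      simp only [u, v, laplaceReal_signedIntegral, SpatialEquation, sub_mul,
        Finset.sum_sub_distrib, mul_assoc, b, d, Complex.ofReal_mul]
  constructor
  · intro h ψ hψ s hs i
    exact (key ψ hψ i).1 (fun θ hθ => h ψ θ hψ hθ i) s hs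
  · intro h ψ θ hψ hθ i
    exact (key ψ hψ i).2 (fun s hs => h ψ hψ s hs i) θ hθ

end System

end MultiStateCTRW

/-! ### The Fourier transform in space -/

namespace MultiStateCTRW

section SpatialEquation

variable {N : ℕ} {M : Matrix (Fin N) (Fin N) ℝ} {p₀ α B : Fin N → ℝ} {σ s₀ : ℝ}
  {H : Fin N → ℝ → SignedMeasure ℝ} {s : ℂ} {i : Fin N} {f f'' g g'' : ℝ → ℂ} {C : ℝ}

theorem SpatialEquation.const_mul (h : SpatialEquation M p₀ α B σ H s i f f'') (c : ℂ) :
    SpatialEquation M p₀ α B σ H s i (fun x => c * f x) (fun x => c * f'' x) := by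
  simp only [SpatialEquation, laplacePairing_const_mul] at h ⊢
  simp only [mul_left_comm _ c, ← Finset.mul_sum, ← mul_sub, h]

theorem SpatialEquation.add (hH : ∀ i, IsLaplaceFamily s₀ (H i)) (hs : s₀ ≤ s.re)
    (h : SpatialEquation M p₀ α B σ H s i f f'') (h' : SpatialEquation M p₀ α B σ H s i g g'')
    (hf : Measurable f) (hg : Measurable g) (hf'' : Measurable f'') (hg'' : Measurable g'')
    (hC : ∀ x, ‖f x‖ ≤ C ∧ ‖f'' x‖ ≤ C ∧ ‖g x‖ ≤ C ∧ ‖g'' x‖ ≤ C) :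
    SpatialEquation M p₀ α B σ H s i (fun x => f x + g x) (fun x => f'' x + g'' x) := by
  have e1 : ∀ j, laplacePairing (H j) s (fun x => f x + g x) =
      laplacePairing (H j) s f + laplacePairing (H j) s g := fun j =>
    (hH j).laplacePairing_add hs hf (fun x => (hC x).1) hg fun x => (hC x).2.2.1
  have e2 : ∀ j, laplacePairing (H j) s (fun x => f'' x + g'' x) =
      laplacePairing (H j) s f'' + laplacePairing (H j) s g'' := fun j =>
    (hH j).laplacePairing_add hs hf'' (fun x => (hC x).2.1) hg'' fun x => (hC x).2.2.2
  simp only [SpatialEquation, e1, e2, mul_add _ (laplacePairing _ _ _), Finset.sum_add_distrib]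
    at h h' ⊢
  linear_combination h + h'

/-- The equation survives bounded pointwise limits of the test function and its second
derivative. -/
theorem SpatialEquation.of_tendsto (hH : ∀ i, IsLaplaceFamily s₀ (H i)) (hs : s₀ ≤ s.re)
    {F F'' : ℕ → ℝ → ℂ} (h : ∀ n, SpatialEquation M p₀ α B σ H s i (F n) (F'' n))
    (hF : ∀ n, Measurable (F n)) (hF'' : ∀ n, Measurable (F'' n))
    (hC : ∀ n x, ‖F n x‖ ≤ C) (hC'' : ∀ n x, ‖F'' n x‖ ≤ C)
    (hlim : ∀ x, Tendsto (fun n => F n x) atTop (𝓝 (f x)))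
    (hlim'' : ∀ x, Tendsto (fun n => F'' n x) atTop (𝓝 (f'' x))) :
    SpatialEquation M p₀ α B σ H s i f f'' := by
  refine tendsto_nhds_unique (Tendsto.congr h ?_) ((hlim 0).const_mul _)
  refine Tendsto.sub (tendsto_finsetSum _ fun j _ => Tendsto.const_mul _ ?_)
    (tendsto_finsetSum _ fun j _ => Tendsto.const_mul _ ?_)
  · exact (hH j).tendsto_laplacePairing hs hF hC hlim
  · exact (hH j).tendsto_laplacePairing hs hF'' hC'' hlim''

/-- The equation for all characters can be superposed. -/
theorem SpatialEquation.integral_wave (hH : ∀ i, IsLaplaceFamily s₀ (H i)) (hs : s₀ ≤ s.re)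
    (h : ∀ k : ℝ, SpatialEquation M p₀ α B σ H s i (wave k) fun x => -(k : ℂ) ^ 2 * wave k x)
    {g : ℝ → ℂ} (hg : Integrable g) (hg'' : Integrable fun k : ℝ => g k * -(k : ℂ) ^ 2) :
    SpatialEquation M p₀ α B σ H s i (fun x => ∫ k, g k * wave k x)
      fun x => ∫ k : ℝ, g k * -(k : ℂ) ^ 2 * wave k x := by
  have e1 := fun j => (hH j).laplacePairing_integral_wave hs hg
  have e2 := fun j => (hH j).laplacePairing_integral_wave hs hg''
  simp only [SpatialEquation, laplacePairing_const_mul] at h ⊢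
  simp only [(e1 _).2, (e2 _).2, ← integral_const_mul]
  rw [← integral_finsetSum _ fun j _ => (e1 j).1.const_mul _,
    ← integral_finsetSum _ fun j _ => (e2 j).1.const_mul _,
    ← integral_sub (integrable_finsetSum _ fun j _ => (e1 j).1.const_mul _)
      (integrable_finsetSum _ fun j _ => (e2 j).1.const_mul _)]
  refine integral_congr_ae (Eventually.of_forall fun k => ?_)
  have hk := congrArg (g k * ·) (h k)
  simp only [mul_sub, Finset.mul_sum] at hk
  beta_reduce
  refine (Eq.trans ?_ hk).trans (by ring)
  exact congrArg₂ _ (Finset.sum_congr rfl fun j _ => by ring)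
    (Finset.sum_congr rfl fun j _ => by ring)

/-- The equation for test functions extends to smooth functions that are bounded with two
derivatives: they are cut off by the dilations `χ (ε x)` of a test function, and `ε → 0`. -/
theorem SpatialEquation.of_bounded (hH : ∀ i, IsLaplaceFamily s₀ (H i)) (hs : s₀ ≤ s.re)
    (h : ∀ ψ, IsTestFunction ψ → SpatialEquation M p₀ α B σ H s i (fun x => ψ x)
      fun x => (iteratedDeriv 2 ψ x : ℝ))
    {g g' g'' : ℝ → ℝ} (hg : ContDiff ℝ (⊤ : ℕ∞) g) (hg' : ∀ x, HasDerivAt g (g' x) x)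
    (hg'' : ∀ x, HasDerivAt g' (g'' x) x) {C : ℝ}
    (hC : ∀ x, |g x| ≤ C ∧ |g' x| ≤ C ∧ |g'' x| ≤ C) :
    SpatialEquation M p₀ α B σ H s i (fun x => g x) fun x => g'' x := by
  let χ : ContDiffBump (0 : ℝ) := default
  have hχ : IsTestFunction χ := ⟨χ.contDiff, χ.hasCompactSupport⟩
  have hχ0 : χ (0 : ℝ) = 1 := χ.one_of_mem_closedBall (by simp [χ.rIn_pos.le])
  have hbd : ∀ θ, IsTestFunction θ → ∃ D, ∀ x, |θ x| ≤ D := fun θ hθ =>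
    hθ.1.continuous.bounded_above_of_compact_support hθ.2
  obtain ⟨D₀, hD₀⟩ := hbd _ hχ
  obtain ⟨D₁, hD₁⟩ := hbd _ hχ.deriv
  obtain ⟨D₂, hD₂⟩ := hbd _ hχ.deriv.deriv
  have hdiff : ∀ θ, IsTestFunction θ → ∀ ε x, HasDerivAt (fun x => θ (ε * x))
      (ε * deriv θ (ε * x)) x := fun θ hθ ε x => by
    have h1 := ((hθ.1.differentiable (by simp)) (ε * x)).hasDerivAt.comp x
      ((hasDerivAt_id x).const_mul ε)
    simpa [mul_comm, Function.comp_def] using h1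
  set F : ℝ → ℝ → ℝ := fun ε x => χ (ε * x) * g x
  set F'' : ℝ → ℝ → ℝ := fun ε x => ε * (ε * deriv (deriv χ) (ε * x)) * g x +
    2 * (ε * deriv χ (ε * x) * g' x) + χ (ε * x) * g'' x
  have hFd : ∀ ε, iteratedDeriv 2 (F ε) = F'' ε := fun ε => by
    have e1 : deriv (F ε) = fun x => ε * deriv χ (ε * x) * g x + χ (ε * x) * g' x :=
      funext fun x => ((hdiff _ hχ ε x).mul (hg' x)).deriv
    rw [iteratedDeriv_two, e1]
    ext x
    refine ((((hdiff _ hχ.deriv ε x).const_mul ε).mul (hg' x)).add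
      ((hdiff _ hχ ε x).mul (hg'' x))).deriv.trans ?_
    simp only [F'']
    ring
  have hFt : ∀ ε, ε ≠ 0 → IsTestFunction (F ε) := fun ε hε =>
    ⟨(hχ.1.comp (contDiff_const.mul contDiff_id)).mul hg, (hχ.2.comp_smul hε).mul_right⟩
  set e : ℕ → ℝ := fun n => 1 / ((n : ℝ) + 1)
  have he : ∀ n, 0 < e n ∧ e n ≤ 1 := fun n =>
    ⟨Nat.one_div_pos_of_nat, (div_le_one (by positivity)).2 (by linarith [n.cast_nonneg (α := ℝ)])⟩
  have het : Tendsto e atTop (𝓝 0) := tendsto_one_div_add_atTop_nhds_zero_nat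
  have hlim : ∀ (u : ℝ → ℝ) (c : ℝ), Continuous u → u 0 = c →
      Tendsto (fun n => ((u (e n) : ℝ) : ℂ)) atTop (𝓝 (c : ℂ)) := fun u c hu h0 =>
    (Complex.continuous_ofReal.tendsto c).comp (h0 ▸ (hu.tendsto 0).comp het)
  have hχc := hχ.1.continuous
  have hχc' := hχ.deriv.1.continuous
  have hχc'' := hχ.deriv.deriv.1.continuous
  refine SpatialEquation.of_tendsto (C := max (D₀ * C) (D₂ * C + 2 * (D₁ * C) + D₀ * C)) hH hs
    (F := fun n x => F (e n) x) (F'' := fun n x => (iteratedDeriv 2 (F (e n)) x : ℝ))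
    (fun n => h _ (hFt _ (he n).1.ne')) (fun n => ((hFt _ (he n).1.ne').exists_bound).1)
    (fun n => ((hFt _ (he n).1.ne').iteratedDeriv_two.exists_bound).1) (fun n x => ?_)
    (fun n x => ?_) (fun x => ?_) (fun x => ?_)
  · rw [Complex.norm_real, Real.norm_eq_abs, abs_mul]
    exact (mul_le_mul (hD₀ _) (hC x).1 (abs_nonneg _) ((abs_nonneg _).trans (hD₀ 0))).trans
      (le_max_left _ _)
  · rw [Complex.norm_real, Real.norm_eq_abs, hFd]
    refine le_trans ?_ (le_max_right _ _)
    have hp : ∀ {a b D : ℝ}, |a| ≤ D → |b| ≤ C → |a * b| ≤ D * C := fun ha hb => by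
      rw [abs_mul]
      exact mul_le_mul ha hb (abs_nonneg _) ((abs_nonneg _).trans ha)
    have he' : ∀ {a D : ℝ}, |a| ≤ D → |e n * a| ≤ D := fun {a D} ha => by
      rw [abs_mul, abs_of_pos (he n).1]
      exact (mul_le_of_le_one_left (abs_nonneg _) (he n).2).trans ha
    refine (abs_add_le _ _).trans (add_le_add ((abs_add_le _ _).trans (add_le_add ?_ ?_)) ?_)
    · exact hp (he' (he' (hD₂ _))) (hC x).1
    · rw [abs_mul, abs_two]
      exact mul_le_mul_of_nonneg_left (hp (he' (hD₁ _)) (hC x).2.1) zero_le_two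
    · exact hp (hD₀ _) (hC x).2.2
  · exact hlim (fun ε => F ε x) _ (by fun_prop) (by simp [F, hχ0])
  · simp only [hFd]
    exact hlim (fun ε => F'' ε x) _ (by fun_prop) (by simp [F'', hχ0])

/-- The equation for test functions extends to the characters. -/
theorem SpatialEquation.wave (hH : ∀ i, IsLaplaceFamily s₀ (H i)) (hs : s₀ ≤ s.re)
    (h : ∀ ψ, IsTestFunction ψ → SpatialEquation M p₀ α B σ H s i (fun x => ψ x)
      fun x => (iteratedDeriv 2 ψ x : ℝ)) (k : ℝ) :
    SpatialEquation M p₀ α B σ H s i (wave k) fun x => -(k : ℂ) ^ 2 * wave k x := by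
  have hl : ∀ x, HasDerivAt (fun x => k * x) k x := fun x => by
    simpa using (hasDerivAt_id x).const_mul k
  have hb : ∀ {a : ℝ}, |a| ≤ 1 → |a| ≤ max 1 (k ^ 2) ∧ |k * a| ≤ max 1 (k ^ 2) ∧
      |k ^ 2 * a| ≤ max 1 (k ^ 2) := fun {a} ha => by
    refine ⟨ha.trans (le_max_left _ _), ?_, ?_⟩
    · rw [abs_mul]
      refine (mul_le_of_le_one_right (abs_nonneg k) ha).trans ?_
      rcases le_total |k| 1 with h1 | h1
      · exact h1.trans (le_max_left _ _)
      · rw [← sq_abs]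
        exact (le_self_pow₀ h1 two_ne_zero).trans (le_max_right _ _)
    · rw [abs_mul, abs_of_nonneg (sq_nonneg k)]
      exact (mul_le_of_le_one_right (sq_nonneg k) ha).trans (le_max_right _ _)
  have hcos := SpatialEquation.of_bounded hH hs h (g := fun x => Real.cos (k * x))
    (g' := fun x => -(k * Real.sin (k * x))) (g'' := fun x => -(k ^ 2 * Real.cos (k * x)))
    (C := max 1 (k ^ 2)) (Real.contDiff_cos.comp (contDiff_const.mul contDiff_id))
    (fun x => by convert! (hl x).cos using 1; ring)
    (fun x => by convert! ((hl x).sin.const_mul k).neg using 1; ring)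
    (fun x => by
      rw [abs_neg, abs_neg]
      exact ⟨(hb (Real.abs_cos_le_one _)).1, (hb (Real.abs_sin_le_one _)).2.1,
        (hb (Real.abs_cos_le_one _)).2.2⟩)
  have hsin := SpatialEquation.of_bounded hH hs h (g := fun x => Real.sin (k * x))
    (g' := fun x => k * Real.cos (k * x)) (g'' := fun x => -(k ^ 2 * Real.sin (k * x)))
    (C := max 1 (k ^ 2)) (Real.contDiff_sin.comp (contDiff_const.mul contDiff_id))
    (fun x => by convert! (hl x).sin using 1; ring)
    (fun x => by convert! (hl x).cos.const_mul k using 1; ring)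
    (fun x => by
      rw [abs_neg]
      exact ⟨(hb (Real.abs_sin_le_one _)).1, (hb (Real.abs_cos_le_one _)).2.1,
        (hb (Real.abs_sin_le_one _)).2.2⟩)
  have hadd := hcos.add hH hs (hsin.const_mul Complex.I) (by fun_prop) (by fun_prop) (by fun_prop)
    (by fun_prop) (C := max 1 (k ^ 2)) (fun x => by
      simp only [norm_mul, Complex.norm_I, one_mul, Complex.norm_real, Real.norm_eq_abs, abs_neg]
      exact ⟨(hb (Real.abs_cos_le_one _)).1, (hb (Real.abs_cos_le_one _)).2.2,
        (hb (Real.abs_sin_le_one _)).1, (hb (Real.abs_sin_le_one _)).2.2⟩)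
  have e : ∀ x, MultiStateCTRW.wave k x =
      (Real.cos (k * x) : ℂ) + Complex.I * (Real.sin (k * x) : ℂ) := fun x => by
    rw [MultiStateCTRW.wave, Complex.exp_mul_I]
    push_cast
    ring
  convert! hadd using 2 with x x
  · exact e x
  · rw [e]
    push_cast
    ring

/-- Fourier inversion: a test function and its second derivative are superpositions of
characters. -/
theorem IsTestFunction.exists_integral_wave {ψ : ℝ → ℝ} (h : IsTestFunction ψ) :
    ∃ g : ℝ → ℂ, Integrable g ∧ Integrable (fun k : ℝ => g k * -(k : ℂ) ^ 2) ∧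
      (∀ x, (ψ x : ℂ) = ∫ k, g k * wave k x) ∧
      ∀ x, ((iteratedDeriv 2 ψ x : ℝ) : ℂ) = ∫ k : ℝ, g k * -(k : ℂ) ^ 2 * wave k x := by
  have hinv : ∀ θ : ℝ → ℝ, IsTestFunction θ →
      Integrable (FourierTransform.fourier fun x => (θ x : ℂ)) ∧
      ∀ x, (θ x : ℂ) = ∫ k, (2 * Real.pi : ℂ)⁻¹ *
        FourierTransform.fourier (fun x => (θ x : ℂ)) (k / (2 * Real.pi)) * wave k x := by
    intro θ hθ
    have hc : HasCompactSupport fun x => (θ x : ℂ) := hθ.2.comp_left Complex.ofReal_zero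
    have hd : ContDiff ℝ (⊤ : ℕ∞) fun x => (θ x : ℂ) :=
      Complex.ofRealCLM.contDiff.comp hθ.1
    have hi : Integrable (FourierTransform.fourier fun x => (θ x : ℂ)) :=
      (FourierTransform.fourier (hc.toSchwartzMap hd)).integrable
    refine ⟨hi, fun x => ?_⟩
    have := congrFun (hd.continuous.fourierInv_fourier_eq
      (hd.continuous.integrable_of_hasCompactSupport hc) hi) x
    rw [← this, Real.fourierInv_eq']
    have hp : (0 : ℝ) < 2 * Real.pi := by positivity
    have hcv := Measure.integral_comp_mul_left (fun k => (2 * Real.pi : ℂ)⁻¹ *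
        FourierTransform.fourier (fun x => (θ x : ℂ)) (k / (2 * Real.pi)) * wave k x) (2 * Real.pi)
    rw [abs_of_pos (inv_pos.2 hp), eq_inv_smul_iff₀ hp.ne'] at hcv
    rw [← hcv, ← integral_smul]
    refine integral_congr_ae (Eventually.of_forall fun v => ?_)
    have e : 2 * Real.pi * v / (2 * Real.pi) = v := by field_simp
    simp only [e, wave, smul_eq_mul, Complex.real_smul, RCLike.inner_apply, conj_trivial]
    push_cast
    have hpc : (Real.pi : ℂ) ≠ 0 := by exact_mod_cast Real.pi_ne_zero
    field_simp
  have hp : (2 * Real.pi : ℝ) ≠ 0 := by positivity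
  have hF'' : ∀ k : ℝ, (2 * Real.pi : ℂ)⁻¹ *
      FourierTransform.fourier (fun x => ((iteratedDeriv 2 ψ x : ℝ) : ℂ)) (k / (2 * Real.pi)) =
      (2 * Real.pi : ℂ)⁻¹ *
        FourierTransform.fourier (fun x => (ψ x : ℂ)) (k / (2 * Real.pi)) * -(k : ℂ) ^ 2 := by
    intro k
    have hder : ∀ θ : ℝ → ℝ, IsTestFunction θ → (_root_.deriv fun x => (θ x : ℂ)) =
        fun x => ((_root_.deriv θ x : ℝ) : ℂ) :=
      fun θ hθ => funext fun x =>
        ((hθ.1.differentiable (by simp)) x).hasDerivAt.ofReal_comp.deriv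
    have hint : ∀ θ, IsTestFunction θ → Integrable fun x => (θ x : ℂ) := fun θ hθ =>
      (hθ.1.continuous.integrable_of_hasCompactSupport hθ.2).ofReal
    have hd : ∀ θ, IsTestFunction θ → ∀ x, DifferentiableAt ℝ (fun x => (θ x : ℂ)) x :=
      fun θ hθ x => ((hθ.1.differentiable (by simp)) x).hasDerivAt.ofReal_comp.differentiableAt
    have e1 := Real.fourier_deriv (hint _ h) (hd _ h) (by rw [hder _ h]; exact hint _ h.deriv)
    have e2 := Real.fourier_deriv (hint _ h.deriv) (hd _ h.deriv)
      (by rw [hder _ h.deriv]; exact hint _ h.deriv.deriv)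
    rw [hder _ h] at e1
    rw [hder _ h.deriv, e1] at e2
    have hpc : (Real.pi : ℂ) ≠ 0 := by exact_mod_cast Real.pi_ne_zero
    rw [MultiStateCTRW.iteratedDeriv_two, e2]
    simp only [smul_eq_mul, Complex.ofReal_div, Complex.ofReal_mul, Complex.ofReal_ofNat]
    field_simp
    rw [Complex.I_sq]
    ring
  refine ⟨_, ((hinv _ h).1.comp_div hp).const_mul _, ?_, (hinv _ h).2, fun x => ?_⟩
  · refine (((hinv _ h.iteratedDeriv_two).1.comp_div hp).const_mul (2 * Real.pi : ℂ)⁻¹).congr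
      (Eventually.of_forall hF'')
  · rw [(hinv _ h.iteratedDeriv_two).2 x]
    simp only [hF'']

/-- Testing in space against test functions and against characters is the same. -/
theorem forall_spatialEquation_iff_wave (hH : ∀ i, IsLaplaceFamily s₀ (H i)) (hs : s₀ ≤ s.re) :
    (∀ ψ, IsTestFunction ψ → SpatialEquation M p₀ α B σ H s i (fun x => ψ x)
      fun x => (iteratedDeriv 2 ψ x : ℝ)) ↔
    ∀ k : ℝ, SpatialEquation M p₀ α B σ H s i (wave k) fun x => -(k : ℂ) ^ 2 * wave k x := by
  refine ⟨SpatialEquation.wave hH hs, fun h ψ hψ => ?_⟩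
  obtain ⟨g, hg, hg2, e, e2⟩ := hψ.exists_integral_wave
  simp only [e, e2]
  exact SpatialEquation.integral_wave hH hs h hg hg2

end SpatialEquation

end MultiStateCTRW

/-! ### The fractional Fokker-Planck equation in Fourier-Laplace variables -/

namespace MultiStateCTRW

section FourierLaplace

variable {N : ℕ} {M : Matrix (Fin N) (Fin N) ℝ} {p₀ α B : Fin N → ℝ} {σ s₀ : ℝ}
  {H : Fin N → ℝ → SignedMeasure ℝ}

theorem leadingMatrix_apply (M : Matrix (Fin N) (Fin N) ℝ) (α B : Fin N → ℝ) (σ k : ℝ) (s : ℂ)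
    (i j : Fin N) : leadingMatrix M α B σ k s i j = (1 : Matrix (Fin N) (Fin N) ℂ) i j -
      (M j i : ℂ) * (1 - powerLaw α B s j - ((σ ^ 2 * k ^ 2 : ℝ) : ℂ)) := by
  rw [leadingMatrix_eq_walkMatrix, walkMatrix, mul_assoc, Matrix.diagonal_mul_diagonal,
    Matrix.sub_apply, Matrix.mul_diagonal, mul_one]
  rfl

theorem powerLaw_ne_zero (hB : ∀ i, 0 < B i) {s : ℂ} (hs : s ≠ 0) (i : Fin N) :
    powerLaw α B s i ≠ 0 :=
  mul_ne_zero (Complex.ofReal_ne_zero.2 (hB i).ne') (by simp [Complex.cpow_eq_zero_iff, hs])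

open Matrix in
/-- For a character the spatial equations are the linear system that defines `leadingDensity`, in
the unknowns `s Ĥ / Ψ`. -/
theorem forall_spatialEquation_wave_iff (hB : ∀ i, 0 < B i) {s : ℂ} (hs : s ≠ 0) (k : ℝ) :
    (∀ i, SpatialEquation M p₀ α B σ H s i (wave k) fun x => -(k : ℂ) ^ 2 * wave k x) ↔
    leadingMatrix M α B σ k s *ᵥ
        (fun j => s * (powerLaw α B s j)⁻¹ * laplacePairing (H j) s (wave k)) =
      fun i => (p₀ i : ℂ) := by
  rw [funext_iff]
  refine forall_congr' fun i => ?_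
  have hw : wave k 0 = 1 := by simp [wave]
  rw [leadingMatrix_eq_walkMatrix, walkMatrix_mulVec, SpatialEquation, hw, mul_one,
    ← mul_right_inj' hs, mul_inv_cancel_left₀ hs, ← Finset.sum_sub_distrib]
  simp only [laplacePairing_const_mul, mul_one]
  set X : Fin N → ℂ := fun j => laplacePairing (H j) s (wave k) with hX
  have h1 : s * (powerLaw α B s i)⁻¹ * X i = ∑ j, ((1 : Matrix (Fin N) (Fin N) ℝ) j i : ℂ) *
      (s * (powerLaw α B s j)⁻¹ * X j) := by
    rw [Finset.sum_eq_single i (fun j _ hj => by simp [Matrix.one_apply_ne hj]) (by simp)]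
    simp
  change _ ↔ s * (powerLaw α B s i)⁻¹ * X i - _ = _
  rw [h1, ← Finset.sum_sub_distrib, Finset.mul_sum]
  refine Eq.congr_left (Finset.sum_congr rfl fun j _ => ?_)
  change s * (_ * X j - _ * (_ * X j)) = _ * (_ * X j) - _ * (_ * (_ * X j))
  have hb : (B j : ℂ) ≠ 0 := Complex.ofReal_ne_zero.2 (hB j).ne'
  have hc : s ^ (α j : ℂ) ≠ 0 := by simp [Complex.cpow_eq_zero_iff, hs]
  rw [powerLaw, Complex.cpow_neg]
  push_cast
  field_simp
  ring

open Matrix in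
/-- Where the matrix is invertible, solving the linear system means being `leadingDensity`. -/
theorem leadingMatrix_mulVec_eq_iff (hB : ∀ i, 0 < B i) {s : ℂ} (hs : s ≠ 0) {k : ℝ}
    (hu : IsUnit (leadingMatrix M α B σ k s)) (X : Fin N → ℂ) :
    leadingMatrix M α B σ k s *ᵥ (fun j => s * (powerLaw α B s j)⁻¹ * X j) =
      (fun i => (p₀ i : ℂ)) ↔ X = leadingDensity M p₀ α B σ k s := by
  constructor
  · intro h
    ext i
    have hp := powerLaw_ne_zero (α := α) hB hs i
    rw [leadingDensity_apply hu h]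
    field_simp
  · intro h
    have hv : leadingMatrix M α B σ k s *ᵥ ((leadingMatrix M α B σ k s)⁻¹ *ᵥ fun i => (p₀ i : ℂ)) =
        fun i => (p₀ i : ℂ) := by
      rw [mulVec_mulVec, mul_nonsing_inv _ ((isUnit_iff_isUnit_det _).1 hu), one_mulVec]
    refine Eq.trans (congrArg _ (funext fun j => ?_)) hv
    have hp := powerLaw_ne_zero (α := α) hB hs j
    rw [h, leadingDensity_apply hu hv]
    field_simp

theorem analyticAt_leadingMatrix (M : Matrix (Fin N) (Fin N) ℝ) (α B : Fin N → ℝ) (σ : ℝ)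
    {q : ℝ × ℂ} (hq : 0 < q.2.re) (i j : Fin N) :
    AnalyticAt ℝ (fun q : ℝ × ℂ => leadingMatrix M α B σ q.1 q.2 i j) q := by
  have h1 : AnalyticAt ℝ (fun s : ℂ => powerLaw α B s j) q.2 := by
    have : AnalyticAt ℂ (fun s : ℂ => (B j : ℂ) * s ^ (α j : ℂ)) q.2 :=
      analyticAt_const.mul (analyticAt_id.cpow analyticAt_const (Or.inl hq))
    exact this.restrictScalars
  have h2 : AnalyticAt ℝ (fun q : ℝ × ℂ => powerLaw α B q.2 j) q := h1.comp analyticAt_snd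
  have h3 : AnalyticAt ℝ (fun q : ℝ × ℂ => ((σ ^ 2 * q.1 ^ 2 : ℝ) : ℂ)) q :=
    (Complex.ofRealCLM.analyticAt _).comp (analyticAt_const.mul (analyticAt_fst.pow 2))
  simp only [leadingMatrix_apply]
  exact analyticAt_const.sub (analyticAt_const.mul ((analyticAt_const.sub h2).sub h3))

/-- The matrix is invertible at points `(k, s)` arbitrarily close to any given one: its determinant
is analytic on the half-space `0 < re s` and does not vanish near the origin. -/
theorem frequently_isUnit_leadingMatrix (h0 : ∀ i j, 0 ≤ M i j) (h1 : ∀ i, ∑ j, M i j = 1)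
    (hα : ∀ i, 0 < α i ∧ α i < 1) (hB : ∀ i, 0 < B i) (σ : ℝ) {q : ℝ × ℂ} (hq : 0 < q.2.re) :
    ∃ᶠ q' in 𝓝 q, IsUnit (leadingMatrix M α B σ q'.1 q'.2) := by
  intro hev
  have han : AnalyticOnNhd ℝ (fun q : ℝ × ℂ => (leadingMatrix M α B σ q.1 q.2).det)
      {q | 0 < q.2.re} := fun q hq => by
    simp only [Matrix.det_apply']
    exact Finset.analyticAt_fun_sum _ fun τ _ => analyticAt_const.mul
      (Finset.analyticAt_fun_prod _ fun i _ => analyticAt_leadingMatrix M α B σ hq _ _)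
  have hpre : IsPreconnected {q : ℝ × ℂ | 0 < q.2.re} :=
    ((convex_halfSpace_re_gt 0).is_linear_preimage
      (LinearMap.snd ℝ ℝ ℂ).isLinear).isPreconnected
  have hzero := han.eqOn_zero_of_preconnected_of_eventuallyEq_zero hpre hq (by
    filter_upwards [hev] with q' hq'
    by_contra hne
    exact hq' ((Matrix.isUnit_iff_isUnit_det _).2 (isUnit_iff_ne_zero.2 hne)))
  have hs : ∀ᶠ s : ℝ in 𝓝[>] 0, 0 < s ∧ IsUnit (leadingMatrix M α B σ 0 s) := by
    have hp : Tendsto (fun s : ℝ => (s, (0 : ℝ))) (𝓝[>] 0) (𝓝[>] 0 ×ˢ 𝓝 0) :=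
      tendsto_id.prodMk tendsto_const_nhds
    filter_upwards [hp.eventually (eventually_rates hα hB σ)] with s ⟨b1, b2, b3, b4⟩
    exact ⟨b1, (leadingDensity_eq (p₀ := fun _ => 0) h0 h1 b1 b2 b3 b4).1⟩
  obtain ⟨s, hs0, hs1⟩ := hs.exists
  refine ((Matrix.isUnit_iff_isUnit_det _).1 hs1).ne_zero ?_
  exact hzero (x := ((0 : ℝ), (s : ℂ))) (by simpa using hs0)

open Matrix in
/-- The fractional Fokker-Planck equation holds if and only if the Fourier-Laplace transform is
`leadingDensity` wherever the latter is defined. At the remaining points the equation follows by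
continuity. -/
theorem solvesFokkerPlanck_iff (h0 : ∀ i j, 0 ≤ M i j) (h1 : ∀ i, ∑ j, M i j = 1)
    (hα : ∀ i, 0 < α i ∧ α i < 1) (hB : ∀ i, 0 < B i) (hs₀ : 0 ≤ s₀)
    (hH : ∀ i, IsLaplaceFamily s₀ (H i)) :
    SolvesFokkerPlanck M p₀ α B σ H ↔ ∀ (k : ℝ) (s : ℂ), s₀ < s.re →
      IsUnit (leadingMatrix M α B σ k s) →
      (fun i => signedFourierLaplace (H i) k s) = leadingDensity M p₀ α B σ k s := by
  have hne : ∀ s : ℂ, s₀ < s.re → s ≠ 0 := fun s hs h => by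
    rw [h, Complex.zero_re] at hs
    linarith
  have hsys : SolvesFokkerPlanck M p₀ α B σ H ↔ ∀ (k : ℝ) (s : ℂ), s₀ < s.re →
      leadingMatrix M α B σ k s *ᵥ
        (fun j => s * (powerLaw α B s j)⁻¹ * laplacePairing (H j) s (wave k)) =
      fun i => (p₀ i : ℂ) := by
    rw [solvesFokkerPlanck_iff_spatialEquation hα hs₀ hH]
    constructor
    · intro h k s hs
      exact (forall_spatialEquation_wave_iff hB (hne s hs) k).1 fun i =>
        (forall_spatialEquation_iff_wave hH hs.le).1 (fun ψ hψ => h ψ hψ s hs i) k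
    · intro h ψ hψ s hs i
      exact (forall_spatialEquation_iff_wave hH hs.le).2 (fun k =>
        (forall_spatialEquation_wave_iff hB (hne s hs) k).2 (h k s hs) i) ψ hψ
  rw [hsys]
  simp only [signedFourierLaplace_eq]
  constructor
  · intro h k s hs hu
    exact (leadingMatrix_mulVec_eq_iff hB (hne s hs) hu _).1 (h k s hs)
  · intro h k s hs
    ext i
    have hs' : 0 < s.re := hs₀.trans_lt hs
    have hL : ∀ j, ContinuousAt (fun q : ℝ × ℂ => leadingMatrix M α B σ q.1 q.2 i j) (k, s) :=
      fun j => (analyticAt_leadingMatrix M α B σ hs' i j).continuousAt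
    have hP : ∀ j, ContinuousAt (fun q : ℝ × ℂ => powerLaw α B q.2 j) (k, s) := fun j =>
      continuousAt_const.mul (continuousAt_snd.cpow continuousAt_const (Or.inl hs'))
    have hcont : ContinuousAt (fun q : ℝ × ℂ => (leadingMatrix M α B σ q.1 q.2 *ᵥ
        (fun j => q.2 * (powerLaw α B q.2 j)⁻¹ * laplacePairing (H j) q.2 (wave q.1))) i)
        (k, s) := by
      simp only [mulVec, dotProduct]
      refine tendsto_finsetSum _ fun j _ => ?_
      exact (hL j).mul ((continuousAt_snd.mul ((hP j).inv₀ (powerLaw_ne_zero hB (hne s hs) j))).mul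
        ((hH j).continuousAt_laplacePairing_wave hs))
    have hev : ∀ᶠ q : ℝ × ℂ in 𝓝 (k, s), s₀ < q.2.re :=
      ((Complex.continuous_re.comp continuous_snd).tendsto _).eventually_const_lt hs
    by_contra hni
    obtain ⟨q, hu, hq, hqi⟩ := ((frequently_isUnit_leadingMatrix h0 h1 hα hB σ hs').and_eventually
      (hev.and (hcont.eventually_ne hni))).exists
    exact hqi (congrFun ((leadingMatrix_mulVec_eq_iff hB (hne _ hq) hu _).2 (h _ _ hq hu)) i)

end FourierLaplace

end MultiStateCTRW

theorem mainTheorem1 {N : ℕ} (M : Matrix (Fin N) (Fin N) ℝ)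
    (hM : M ∈ Matrix.rowStochastic ℝ (Fin N))
    (p₀ : Fin N → ℝ) (hp₀ : p₀ ∈ stdSimplex ℝ (Fin N))
    (φ lam : Fin N → Measure ℝ)
    (hφ : ∀ i, IsProbabilityMeasure (φ i)) (hφpos : ∀ i, φ i (Iic 0) = 0)
    (hlam : ∀ i, IsProbabilityMeasure (lam i))
    {Ω : Type*} [MeasurableSpace Ω] (P : Measure Ω) [IsProbabilityMeasure P]
    (state : ℕ → Ω → Fin N) (wait jump : ℕ → Ω → ℝ)
    (hW : MultiStateCTRW.IsCTRW P M p₀ φ lam state wait jump) :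
    (∀ (k : ℝ) (s : ℂ), 0 < s.re →
      (∀ i, IntegrableOn (fun t : ℝ => Complex.exp (-s * t) *
        charFun (MultiStateCTRW.stateLaw P state wait jump i t) k) (Ioi 0)) ∧
      IsUnit (MultiStateCTRW.walkMatrix M (fun i => MultiStateCTRW.laplace (φ i) s)
        (fun i => charFun (lam i) k)) ∧
      (fun i => MultiStateCTRW.fourierLaplace
          (MultiStateCTRW.stateLaw P state wait jump i) k s) =
        MultiStateCTRW.walkDensity M p₀ (fun i => MultiStateCTRW.laplace (φ i) s)
          (fun i => charFun (lam i) k) s) ∧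
    ∀ (α B : Fin N → ℝ) (σ : ℝ), (∀ i, 0 < α i ∧ α i < 1) → (∀ i, 0 < B i) → 0 < σ →
      (∀ i, lam i = gaussianReal 0 (2 * σ ^ 2).toNNReal) →
      (∀ i, Asymptotics.IsEquivalent (𝓝[>] (0 : ℝ))
        (fun s : ℝ => 1 - MultiStateCTRW.laplace (φ i) s)
        (fun s : ℝ => MultiStateCTRW.powerLaw α B s i)) →
      (∀ᶠ q : ℝ × ℝ in 𝓝[>] 0 ×ˢ 𝓝 0,
        IsUnit (MultiStateCTRW.walkMatrix M (fun i => 1 - MultiStateCTRW.powerLaw α B q.1 i)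
          (fun _ => ((1 - σ ^ 2 * q.2 ^ 2 : ℝ) : ℂ))) ∧
        IsUnit (MultiStateCTRW.leadingMatrix M α B σ q.2 q.1)) ∧
      (∀ i,
        Asymptotics.IsEquivalent (𝓝[>] (0 : ℝ) ×ˢ 𝓝 (0 : ℝ))
          (fun q : ℝ × ℝ => MultiStateCTRW.fourierLaplace
            (MultiStateCTRW.stateLaw P state wait jump i) q.2 q.1)
          (fun q : ℝ × ℝ => MultiStateCTRW.walkDensity M p₀
            (fun j => 1 - MultiStateCTRW.powerLaw α B q.1 j)
            (fun _ => ((1 - σ ^ 2 * q.2 ^ 2 : ℝ) : ℂ)) q.1 i) ∧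
        Asymptotics.IsEquivalent (𝓝[>] (0 : ℝ) ×ˢ 𝓝 (0 : ℝ))
          (fun q : ℝ × ℝ => MultiStateCTRW.fourierLaplace
            (MultiStateCTRW.stateLaw P state wait jump i) q.2 q.1)
          (fun q : ℝ × ℝ => MultiStateCTRW.leadingDensity M p₀ α B σ q.2 q.1 i)) ∧
      ∀ (s₀ : ℝ), 0 ≤ s₀ → ∀ H : Fin N → ℝ → SignedMeasure ℝ,
        (∀ i, MultiStateCTRW.IsLaplaceFamily s₀ (H i)) →
        (MultiStateCTRW.SolvesFokkerPlanck M p₀ α B σ H ↔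
          ∀ (k : ℝ) (s : ℂ), s₀ < s.re →
            IsUnit (MultiStateCTRW.leadingMatrix M α B σ k s) →
            (fun i => MultiStateCTRW.signedFourierLaplace (H i) k s) =
              MultiStateCTRW.leadingDensity M p₀ α B σ k s) := by
  have := hφ
  have := hlam
  obtain ⟨h0, h1⟩ := Matrix.mem_rowStochastic_iff_sum.1 hM
  refine ⟨fun k s hs => ⟨fun i => (hW.hasSum_fourierLaplace hφpos h0 h1 hp₀.1 k hs i).1,
    MultiStateCTRW.isUnit_walkMatrix h0 h1 fun i =>
      MultiStateCTRW.norm_laplace_mul_charFun_lt_one (hφpos i) hs k,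
    funext fun i => hW.fourierLaplace_eq hφpos h0 h1 hp₀.1 k hs i⟩, ?_⟩
  intro α B σ hα hB _ hgauss hpow
  refine ⟨?_, fun i => hW.isEquivalent_densities hφpos h0 h1 hp₀.1 hα hB hgauss hpow i,
    fun s₀ hs₀ H hH => MultiStateCTRW.solvesFokkerPlanck_iff h0 h1 hα hB hs₀ hH⟩
  filter_upwards [MultiStateCTRW.eventually_rates hα hB σ] with q ⟨b1, b2, b3, b4⟩
  exact ⟨(MultiStateCTRW.walkDensity_powerLaw_eq (p₀ := p₀) h0 h1 b1 b2 b3 b4).1,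
    (MultiStateCTRW.leadingDensity_eq (p₀ := p₀) h0 h1 b1 b2 b3 b4).1⟩
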